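/- Let $T,O,I\subset SO(3)$ denote the rotation groups of a regular tetrahedron, octahedron and icosahedron centred at the origin, in any position. For $G\in\{T,O,I\}$ let $\Gamma^1,\dots,\Gamma^{N_{\rm rep}}$ be a complete list of pairwise inequivalent irreducible complex unitary matrix representations of $G$, with $\Gamma^p$ of dimension $d_p$. A basis function for $\Gamma^p$ is a vector function $f=(f_1,\dots,f_{d_p})$ with components in $L^2(S^2)$ (complex-valued functions, surface measure) such that $f(g^{-1}x)=\Gamma^p(g)^{T}f(x)$ for all $g\in G$ and almost every $x\in S^2$. Let $L_2^p$ be the closed subspace of $L^2(S^2)$ spanned by the components of all basis functions for $\Gamma^p$. A real orthonormal system of basis functions of $G$ is a family of basis functions $I_{p;\zeta}$ for $\Gamma^p$ ($1\le p\le N_{\rm rep}$, with $\zeta$ in an arbitrary index set depending on $p$) whose components are real-valued and, for all $p$, $\zeta$ together, orthonormal in $L^2(S^2)$. (1) If $G=O$ or $G=I$, then for a suitable choice of the matrices $\Gamma^p$ within their equivalence classes there are integers $N_{p;l}\ge 0$ and a real orthonormal system of basis functions $I_{p;l,n}$ ($1\le p\le N_{\rm rep}$, $l=0,1,2,\dots$,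 $1\le n\le N_{p;l}$) such that every component of $I_{p;l,n}$ is a spherical harmonic of degree $l$ (a linear combination of $Y_{l,-l},\dots,Y_{l,l}$), and such that the components of all the $I_{p;l,n}$ form a complete orthonormal system of $L^2(S^2)$. (2) Let $G=T$, with $N_{\rm rep}=4$ and the irreducible representations numbered so that $(d_1,d_2,d_3,d_4)=(1,1,1,3)$ and $\Gamma^1$ is trivial. Then for every choice of the matrices $\Gamma^p$, no real orthonormal system of basis functions of $G$ is complete in $L^2(S^2)$; every such system contains no function with $p=2$ or $p=3$, and the closed span of its components is contained in the closed span of $L_2^1$ and $L_2^4$. Moreover, for a suitable choice of the matrices $\Gamma^p$ there is a real orthonormal system of basis functions $I_{p;l,n}$, with components that are spherical harmonics of degree $l$, such that for $p=1$ and for $p=4$ the components of the $I_{p;l,n}$ have closed span exactly $L_2^p$. -/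

import Mathlib

open MeasureTheory

noncomputable section

namespace Polyhedral

/-! ### Polyhedral rotation groups -/

/-- Three-dimensional Euclidean space. -/
abbrev E3 : Type := EuclideanSpace ℝ (Fin 3)

/-- The group of rotations (linear isometries of determinant one) which map `V` onto itself. -/
def rotationGroup (V : Set E3) : Subgroup (E3 ≃ₗᵢ[ℝ] E3) where
  carrier := {g | LinearMap.det (g.toLinearEquiv : E3 →ₗ[ℝ] E3) = 1 ∧ g '' V = V}
  one_mem' := by
    refine ⟨?_, ?_⟩
    · have h : ((1 : E3 ≃ₗᵢ[ℝ] E3).toLinearEquiv : E3 →ₗ[ℝ] E3) = LinearMap.id := rfl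
      rw [h, LinearMap.det_id]
    · simp
  mul_mem' := by
    rintro a b ⟨ha, ha'⟩ ⟨hb, hb'⟩
    refine ⟨?_, ?_⟩
    · have h : ((a * b).toLinearEquiv : E3 →ₗ[ℝ] E3) =
          (a.toLinearEquiv : E3 →ₗ[ℝ] E3) ∘ₗ (b.toLinearEquiv : E3 →ₗ[ℝ] E3) := rfl
      rw [h, LinearMap.det_comp, ha, hb, one_mul]
    · have h : (⇑(a * b) : E3 → E3) = a ∘ b := rfl
      rw [h, Set.image_comp, hb', ha']
  inv_mem' := by
    rintro a ⟨ha, ha'⟩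
    refine ⟨?_, ?_⟩
    · have h : ((a⁻¹).toLinearEquiv : E3 →ₗ[ℝ] E3) ∘ₗ (a.toLinearEquiv : E3 →ₗ[ℝ] E3) =
          LinearMap.id := by
        ext1 x
        exact a.symm_apply_apply x
      have h2 := congrArg LinearMap.det h
      rw [LinearMap.det_comp, ha, mul_one, LinearMap.det_id] at h2
      exact h2
    · have h : (⇑(a⁻¹) : E3 → E3) '' (a '' V) = V := by
        rw [← Set.image_comp]
        have h3 : (⇑(a⁻¹) : E3 → E3) ∘ a = id := by
          funext x
          exact a.symm_apply_apply x
        rw [h3, Set.image_id]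
      rw [ha'] at h
      exact h

/-- The vertices of a regular tetrahedron centred at the origin. -/
def tetrahedronVertices : Set E3 :=
  {!₂[1, 1, 1], !₂[1, -1, -1], !₂[-1, 1, -1], !₂[-1, -1, 1]}

/-- The vertices of a regular octahedron centred at the origin. -/
def octahedronVertices : Set E3 :=
  {!₂[1, 0, 0], !₂[-1, 0, 0], !₂[0, 1, 0], !₂[0, -1, 0], !₂[0, 0, 1], !₂[0, 0, -1]}

/-- The vertices `(0, ±1, ±φ)`, `(±1, ±φ, 0)`, `(±φ, 0, ±1)` of a regular icosahedron centred at
the origin, where `φ` is the golden ratio. -/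
def icosahedronVertices : Set E3 :=
  {x | ∃ s t : ℝ, (s = 1 ∨ s = -1) ∧ (t = 1 ∨ t = -1) ∧
    (x = !₂[0, s, t * Real.goldenRatio] ∨ x = !₂[s, t * Real.goldenRatio, 0] ∨
      x = !₂[t * Real.goldenRatio, 0, s])}

/-- `G` is the rotation group of a regular tetrahedron, in some position around the origin. -/
def IsTetrahedral (G : Subgroup (E3 ≃ₗᵢ[ℝ] E3)) : Prop :=
  ∃ Q : E3 ≃ₗᵢ[ℝ] E3, G = rotationGroup (Q '' tetrahedronVertices)

/-- `G` is the rotation group of a regular octahedron, in some position around the origin. -/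
def IsOctahedral (G : Subgroup (E3 ≃ₗᵢ[ℝ] E3)) : Prop :=
  ∃ Q : E3 ≃ₗᵢ[ℝ] E3, G = rotationGroup (Q '' octahedronVertices)

/-- `G` is the rotation group of a regular icosahedron, in some position around the origin. -/
def IsIcosahedral (G : Subgroup (E3 ≃ₗᵢ[ℝ] E3)) : Prop :=
  ∃ Q : E3 ≃ₗᵢ[ℝ] E3, G = rotationGroup (Q '' icosahedronVertices)

/-! ### Irreducible matrix representations -/

/-- The representation on column vectors given by a matrix representation. -/
def matRep {G : Type*} [Group G] {d : ℕ} (Γ : G →* Matrix (Fin d) (Fin d) ℂ) :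
    Representation ℂ G (Fin d → ℂ) :=
  (Matrix.toLinAlgEquiv' (R := ℂ) (n := Fin d)).toAlgHom.toMonoidHom.comp Γ

/-- A list of `r` complex unitary matrix representations of `G` which are irreducible, pairwise
inequivalent, and represent every equivalence class of (finite-dimensional) irreducible complex
representations of `G`; `d p` is the dimension and `Γ p` are the matrices of the `p`-th one. -/
structure IrrepList (G : Type*) [Group G] (r : ℕ) where
  d : Fin r → ℕ
  Γ : ∀ p, G →* Matrix (Fin (d p)) (Fin (d p)) ℂ
  unitary : ∀ p g, Γ p g ∈ Matrix.unitaryGroup (Fin (d p)) ℂ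
  irreducible : ∀ p, (matRep (Γ p)).IsIrreducible
  inequivalent : ∀ p q, Nonempty ((matRep (Γ p)).Equiv (matRep (Γ q))) → p = q
  exhaustive : ∀ (n : ℕ) (Δ : G →* Matrix (Fin n) (Fin n) ℂ), (matRep Δ).IsIrreducible →
    ∃ p, Nonempty ((matRep (Γ p)).Equiv (matRep Δ))

/-- The numbering of the four irreducible representations of the tetrahedral group: the first one
is trivial, the second and the third are one-dimensional, the fourth is three-dimensional. -/
def IrrepList.IsTetrahedralNumbering {G : Type*} [Group G] (A : IrrepList G 4) : Prop :=
  A.d = ![1, 1, 1, 3] ∧ ∀ g, A.Γ 0 g = 1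

/-! ### Square integrable functions and spherical harmonics on the unit sphere -/

/-- The unit sphere. -/
abbrev S2 : Type := Metric.sphere (0 : E3) 1

/-- The surface measure on the unit sphere. -/
abbrev surface : Measure S2 := (volume : Measure E3).toSphere

/-- The Hilbert space of complex square integrable functions on the unit sphere. -/
abbrev L2S : Type := Lp ℂ 2 surface

/-- A linear isometry acting on the unit sphere. -/
def actS (g : E3 ≃ₗᵢ[ℝ] E3) (x : S2) : S2 :=
  ⟨g x, by simp⟩

/-- `f` is a spherical harmonic of degree `l`: the restriction to the sphere of a harmonic
homogeneous polynomial of degree `l` (equivalently, a linear combination of the functions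
`Y_{l,m}` with `-l ≤ m ≤ l`). -/
def IsSphericalHarmonic (l : ℕ) (f : L2S) : Prop :=
  ∃ P : MvPolynomial (Fin 3) ℂ, P.IsHomogeneous l ∧
    ∑ i, MvPolynomial.pderiv i (MvPolynomial.pderiv i P) = 0 ∧
    ∀ᵐ x ∂surface, f x = MvPolynomial.eval (fun i => ((x : E3) i : ℂ)) P

/-- `f` is real-valued. -/
def IsRealValued (f : L2S) : Prop :=
  ∀ᵐ x ∂surface, (f x).im = 0

/-! ### Symmetry-adapted basis functions -/

section Basis

variable {G : Subgroup (E3 ≃ₗᵢ[ℝ] E3)}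

/-- The vector function `f` is a basis function for the matrix representation `Γ`:
`f (R_g⁻¹ x) = Γ(g)ᵀ f (x)` for all `g` in the group. -/
def IsBasisFunction {d : ℕ} (Γ : G →* Matrix (Fin d) (Fin d) ℂ) (f : Fin d → L2S) : Prop :=
  ∀ g : G, ∀ᵐ x ∂surface, ∀ j,
    f j (actS (g : E3 ≃ₗᵢ[ℝ] E3)⁻¹ x) = ((Γ g).transpose.mulVec (fun k => f k x)) j

/-- The closed subspace spanned by the components of all complex basis functions for `Γ` (the
isotypic subspace of `Γ`). -/
def isotypic {d : ℕ} (Γ : G →* Matrix (Fin d) (Fin d) ℂ) : Submodule ℂ L2S :=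
  (Submodule.span ℂ {h | ∃ f : Fin d → L2S, IsBasisFunction Γ f ∧ ∃ j, h = f j}).topologicalClosure

/-- `I p z`, for `z : ζ p`, are real-valued basis functions for the `p`-th irreducible
representation in the list `A`, and all their components together are orthonormal. -/
structure IsRealOrthonormalBasisSystem {r : ℕ} (A : IrrepList G r) {ζ : Fin r → Type*}
    (I : ∀ p, ζ p → Fin (A.d p) → L2S) : Prop where
  real : ∀ p z j, IsRealValued (I p z j)
  transforms : ∀ p z, IsBasisFunction (A.Γ p) (I p z)
  orthonormal : Orthonormal ℂ
    (fun i : Σ p, ζ p × Fin (A.d p) => I i.1 i.2.1 i.2.2)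

/-- The closed subspace spanned by the components of the basis functions for the `p`-th irreducible
representation. -/
def closedSpanAt {r : ℕ} {A : IrrepList G r} {ζ : Fin r → Type*}
    (I : ∀ p, ζ p → Fin (A.d p) → L2S) (p : Fin r) : Submodule ℂ L2S :=
  (Submodule.span ℂ {h | ∃ z j, h = I p z j}).topologicalClosure

/-- The closed subspace spanned by the components of all basis functions of the system. -/
def closedSpan {r : ℕ} {A : IrrepList G r} {ζ : Fin r → Type*}
    (I : ∀ p, ζ p → Fin (A.d p) → L2S) : Submodule ℂ L2S :=
  (Submodule.span ℂ {h | ∃ p z j, h = I p z j}).topologicalClosure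

end Basis

end Polyhedral

end

/-! The complex isotypic subspaces of a finite rotation group together are dense in `L2S`; the
question is which of them have real bases. For an irreducible representation given by real
orthogonal matrices, the basis functions of degree `l` are stable under complex conjugation, and by
Schur's lemma each is determined by one component. A real orthonormal basis of the space of first
components therefore extends to real orthonormal basis functions (`exists_real_basisFunctions`).
Rotations commute with the projections onto spherical harmonics of degree `l`, so letting `l` vary
exhausts the isotypic subspace (`exists_real_system`).

Two density facts are needed. Spherical harmonics are complete: different degrees are orthogonal
because the sum of squares of the rotation generators is symmetric with eigenvalues `-l(l+1)`, every
polynomial on the sphere is a sum of harmonic ones, and Stone-Weierstrass applies. Isotypic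
subspaces are complete: a nonzero vector orthogonal to them would generate a finite-dimensional
invariant space, and a minimal invariant subspace of it would contain a basis function.

For the octahedron and icosahedron it remains to see that every irreducible representation has a
real form. Suppose a nonzero `u` is fixed up to sign by a subgroup `H`, and every `g` can be
multiplied by some `k` in `H` to give an involution `t`. For an invariant inner product, `⟪u, gu⟫`
is then `±⟪u, tu⟫`, which equals its own conjugate. So the real span of the orbit of `u` carries a
real inner product, and an orthonormal basis of it gives real orthogonal matrices. `H` is generated
by a quarter turn for the octahedron, and by a turn of order three with a half turn inverting it for
the icosahedron. Group relations produce `u`; the factorisation is a finite check, with exact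
coordinates in `ℚ(√5)`.

For the tetrahedron, a nonzero real basis function of a one-dimensional representation forces the
values `±1`. The group is generated by elements of order three, so such a representation is trivial,
which excludes the two other characters. Yet one of these does occur in `L2S`, on the quadratic form
`tetraQuadratic`, so no real system is complete. The trivial and the three-dimensional
representation are real, and the general construction applies to them. -/

namespace Polyhedral

/-! ### Matrix representations of finite groups -/

section MatrixRepresentations

variable {G : Type*} [Group G] {d e : ℕ}

lemma matRep_apply (Γ : G →* Matrix (Fin d) (Fin d) ℂ) (g : G) (v : Fin d → ℂ) :
    matRep Γ g v = (Γ g).mulVec v := rfl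

/-- The intertwining map given by a matrix. -/
noncomputable def intertwinerOfMatrix {Γ : G →* Matrix (Fin d) (Fin d) ℂ}
    {Δ : G →* Matrix (Fin e) (Fin e) ℂ} (A : Matrix (Fin d) (Fin e) ℂ)
    (h : ∀ g, Γ g * A = A * Δ g) : (matRep Δ).IntertwiningMap (matRep Γ) where
  toLinearMap := A.mulVecLin
  isIntertwining' g := by
    refine LinearMap.ext fun v => ?_
    simp [matRep_apply, Matrix.mulVec_mulVec, h]

lemma eq_zero_of_intertwines {Γ : G →* Matrix (Fin d) (Fin d) ℂ}
    {Δ : G →* Matrix (Fin e) (Fin e) ℂ} (hΓ : (matRep Γ).IsIrreducible)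
    (hΔ : (matRep Δ).IsIrreducible) (hne : ¬ Nonempty ((matRep Δ).Equiv (matRep Γ)))
    {A : Matrix (Fin d) (Fin e) ℂ} (h : ∀ g, Γ g * A = A * Δ g) : A = 0 := by
  rcases Representation.IsIrreducible.bijective_or_eq_zero (intertwinerOfMatrix A h) with hb | h0
  · exact absurd ⟨(intertwinerOfMatrix A h).ofBijective hb⟩ hne
  · have h1 : A.mulVecLin = 0 := congrArg (fun f => f.toLinearMap) h0
    exact Matrix.mulVec_injective (funext fun v => by
      simpa using congrArg (fun f : (Fin e → ℂ) →ₗ[ℂ] Fin d → ℂ => f v) h1)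

lemma eq_smul_one_of_commutes {Γ : G →* Matrix (Fin d) (Fin d) ℂ}
    (hΓ : (matRep Γ).IsIrreducible) {A : Matrix (Fin d) (Fin d) ℂ}
    (h : ∀ g, Γ g * A = A * Γ g) : ∃ c : ℂ, A = c • 1 := by
  obtain ⟨c, hc⟩ := (Representation.IsIrreducible.algebraMap_intertwiningMap_bijective_of_isAlgClosed
    (ρ := matRep Γ)).2 (intertwinerOfMatrix A h)
  refine ⟨c, ?_⟩
  refine Matrix.mulVec_injective (funext fun v => ?_)
  have h1 : c • v = A.mulVec v :=
    congrArg (fun f : (matRep Γ).IntertwiningMap (matRep Γ) => f v) hc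
  rw [← h1, Matrix.smul_mulVec, Matrix.one_mulVec]

lemma dim_ne_zero {Γ : G →* Matrix (Fin d) (Fin d) ℂ} (hΓ : (matRep Γ).IsIrreducible) : d ≠ 0 := by
  rintro rfl
  obtain ⟨x, y, hxy⟩ := hΓ.toNontrivial
  apply hxy
  apply Subrepresentation.toSubmodule_injective
  exact Subsingleton.elim _ _

variable [Fintype G]

/-- The average of a matrix over the group intertwines. -/
lemma mul_sum_conj (Γ : G →* Matrix (Fin d) (Fin d) ℂ) (Δ : G →* Matrix (Fin e) (Fin e) ℂ)
    (E : Matrix (Fin d) (Fin e) ℂ) (h : G) :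
    Γ h * (∑ g, Γ g⁻¹ * E * Δ g) = (∑ g, Γ g⁻¹ * E * Δ g) * Δ h := by
  rw [Matrix.mul_sum, Matrix.sum_mul, ← Equiv.sum_comp (Equiv.mulRight h)]
  refine Finset.sum_congr rfl fun g _ => ?_
  simp only [Equiv.coe_mulRight, mul_inv_rev, map_mul, Matrix.mul_assoc]
  rw [← Matrix.mul_assoc (Γ h), ← map_mul, mul_inv_cancel, map_one, Matrix.one_mul]

/-- Averaging a matrix unit turns sums of products of entries into entries of an intertwiner, so
that Schur's lemma yields the orthogonality relations. -/
lemma sum_inv_mul_entry (Γ : G →* Matrix (Fin d) (Fin d) ℂ) (Δ : G →* Matrix (Fin e) (Fin e) ℂ)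
    (i j : Fin d) (k l : Fin e) :
    (∑ g, Γ g⁻¹ * Matrix.single j k (1 : ℂ) * Δ g) i l = ∑ g, Γ g⁻¹ i j * Δ g k l := by
  rw [Matrix.sum_apply]
  refine Finset.sum_congr rfl fun g _ => ?_
  rw [Matrix.mul_assoc, Matrix.mul_apply, Finset.sum_eq_single j]
  · simp
  · intro b _ hb
    rw [Matrix.single_mul_apply_of_ne _ _ _ _ _ hb, mul_zero]
  · simp

lemma sum_inv_mul_of_inequivalent {Γ : G →* Matrix (Fin d) (Fin d) ℂ}
    {Δ : G →* Matrix (Fin e) (Fin e) ℂ} (hΓ : (matRep Γ).IsIrreducible)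
    (hΔ : (matRep Δ).IsIrreducible) (hne : ¬ Nonempty ((matRep Δ).Equiv (matRep Γ)))
    (i j : Fin d) (k l : Fin e) : ∑ g, Γ g⁻¹ i j * Δ g k l = 0 := by
  rw [← sum_inv_mul_entry, eq_zero_of_intertwines hΓ hΔ hne (mul_sum_conj Γ Δ _)]
  rfl

/-- The averaged matrix unit is a scalar `c`, found by taking traces: every conjugate has trace `1`
or `0`, and the scalar matrix has trace `d * c`. Writing `g⁻¹` in place of a conjugate entry avoids
any use of unitarity. -/
lemma sum_inv_mul_self {Γ : G →* Matrix (Fin d) (Fin d) ℂ} (hΓ : (matRep Γ).IsIrreducible)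
    (i j k l : Fin d) :
    ∑ g, Γ g⁻¹ i j * Γ g k l = if i = l ∧ j = k then (Fintype.card G / d : ℂ) else 0 := by
  obtain ⟨c, hc⟩ := eq_smul_one_of_commutes hΓ (mul_sum_conj Γ Γ (Matrix.single j k 1))
  have ht := congrArg Matrix.trace hc
  have h2 : ∀ g, (Γ g⁻¹ * Matrix.single j k (1 : ℂ) * Γ g).trace = if j = k then 1 else 0 := by
    intro g
    rw [Matrix.trace_mul_comm, ← Matrix.mul_assoc, ← map_mul, mul_inv_cancel, map_one,
      Matrix.one_mul]
    split_ifs with h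
    · subst h; simp
    · exact Matrix.trace_single_eq_of_ne _ _ _ h
  have hd : (d : ℂ) ≠ 0 := by exact_mod_cast dim_ne_zero hΓ
  rw [Matrix.trace_sum, Finset.sum_congr rfl fun g _ => h2 g] at ht
  simp only [Finset.sum_const, Finset.card_univ, nsmul_eq_mul, Matrix.trace_smul,
    Matrix.trace_one, Fintype.card_fin, smul_eq_mul] at ht
  rw [← sum_inv_mul_entry, hc, Matrix.smul_apply, Matrix.one_apply]
  by_cases h1 : i = l <;> by_cases h3 : j = k <;> simp_all

/-- The matrix entries of pairwise inequivalent irreducible representations are linearly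
independent functions on the group. -/
lemma linearIndependent_entries {ι : Type*} {d : ι → ℕ}
    {Γ : ∀ p, G →* Matrix (Fin (d p)) (Fin (d p)) ℂ} (hirr : ∀ p, (matRep (Γ p)).IsIrreducible)
    (hne : ∀ p q, Nonempty ((matRep (Γ p)).Equiv (matRep (Γ q))) → p = q) :
    LinearIndependent ℂ
      (fun (x : Σ p, Fin (d p) × Fin (d p)) (g : G) => Γ x.1 g x.2.1 x.2.2) := by
  classical
  rw [linearIndependent_iff']
  rintro s c hs ⟨p, j, i⟩ hx
  have h1 : ∑ x ∈ s, c x * ∑ g, Γ p g⁻¹ i j * Γ x.1 g x.2.1 x.2.2 = 0 := by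
    simp_rw [Finset.mul_sum]
    rw [Finset.sum_comm]
    refine Finset.sum_eq_zero fun g _ => ?_
    have := congrFun hs g
    rw [Finset.sum_apply] at this
    simp only [Pi.smul_apply, smul_eq_mul, Pi.zero_apply] at this
    calc _ = Γ p g⁻¹ i j * ∑ x ∈ s, c x * Γ x.1 g x.2.1 x.2.2 := by
          rw [Finset.mul_sum]
          exact Finset.sum_congr rfl fun x _ => by ring
      _ = 0 := by rw [this, mul_zero]
  rw [Finset.sum_eq_single_of_mem _ hx] at h1
  · simp only [sum_inv_mul_self (hirr p), and_self, if_true] at h1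
    have hd : (d p : ℂ) ≠ 0 := by exact_mod_cast dim_ne_zero (hirr p)
    have hG : (Fintype.card G : ℂ) ≠ 0 := by exact_mod_cast Fintype.card_ne_zero
    exact (mul_eq_zero.mp h1).resolve_right (div_ne_zero hG hd)
  · rintro ⟨q, k, l⟩ _ hq
    by_cases hpq : p = q
    · subst hpq
      simp only [sum_inv_mul_self (hirr p)]
      rw [if_neg, mul_zero]
      rintro ⟨rfl, rfl⟩
      exact hq rfl
    · rw [sum_inv_mul_of_inequivalent (hirr p) (hirr q), mul_zero]
      exact fun h => hpq (hne _ _ h).symm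

/-- One entry from each representation already gives independent functions on `G`. The bound stops
the construction in `exists_real_irrepList`. -/
lemma card_le_of_inequivalent {r : ℕ} {d : Fin r → ℕ}
    {Γ : ∀ p, G →* Matrix (Fin (d p)) (Fin (d p)) ℂ} (hirr : ∀ p, (matRep (Γ p)).IsIrreducible)
    (hne : ∀ p q, Nonempty ((matRep (Γ p)).Equiv (matRep (Γ q))) → p = q) :
    r ≤ Fintype.card G := by
  have h := linearIndependent_entries hirr hne
  have hpos : ∀ p, 0 < d p := fun p => Nat.pos_of_ne_zero (dim_ne_zero (hirr p))
  have h2 := h.comp (fun p : Fin r => (⟨p, ⟨0, hpos p⟩, ⟨0, hpos p⟩⟩ : Σ p, Fin (d p) × Fin (d p)))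
    (fun p q hpq => congrArg Sigma.fst hpq)
  simpa using h2.fintype_card_le_finrank

/-- A list of pairwise inequivalent irreducible representations is complete if the sum of the
squares of the dimensions is at least the group order. -/
lemma exhaustive_of_card_le {r : ℕ} {d : Fin r → ℕ}
    {Γ : ∀ p, G →* Matrix (Fin (d p)) (Fin (d p)) ℂ} (hirr : ∀ p, (matRep (Γ p)).IsIrreducible)
    (hne : ∀ p q, Nonempty ((matRep (Γ p)).Equiv (matRep (Γ q))) → p = q)
    (hcard : Fintype.card G ≤ ∑ p, d p * d p) {n : ℕ} {Δ : G →* Matrix (Fin n) (Fin n) ℂ}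
    (hΔ : (matRep Δ).IsIrreducible) : ∃ p, Nonempty ((matRep (Γ p)).Equiv (matRep Δ)) := by
  by_contra hcon
  push Not at hcon
  have h := linearIndependent_entries hirr hne
  have hspan : Submodule.span ℂ (Set.range
      (fun (x : Σ p, Fin (d p) × Fin (d p)) (g : G) => Γ x.1 g x.2.1 x.2.2)) = ⊤ := by
    apply h.span_eq_top_of_card_eq_finrank'
    apply le_antisymm h.fintype_card_le_finrank
    simpa using hcard
  have hn := Nat.pos_of_ne_zero (dim_ne_zero hΔ)
  -- The known entries span all functions on `G`, and an entry of a further inequivalent `Δ` pairs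
  -- to zero with each of them. The indicator of the identity then gives `Δ 1 0 0 = 0`, a
  -- contradiction.
  have key : ∀ a : G → ℂ, ∑ g, Δ g⁻¹ ⟨0, hn⟩ ⟨0, hn⟩ * a g = 0 := by
    intro a
    have ha : a ∈ Submodule.span ℂ (Set.range
      (fun (x : Σ p, Fin (d p) × Fin (d p)) (g : G) => Γ x.1 g x.2.1 x.2.2)) := by
      rw [hspan]; trivial
    induction ha using Submodule.span_induction with
    | mem x hx =>
      obtain ⟨x, rfl⟩ := hx
      exact sum_inv_mul_of_inequivalent hΔ (hirr x.1) (not_nonempty_iff.mpr (hcon x.1)) _ _ _ _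
    | zero => simp
    | add x y _ _ hx hy => simp [mul_add, Finset.sum_add_distrib, hx, hy]
    | smul c x _ hx =>
      simp only [Pi.smul_apply, smul_eq_mul, mul_left_comm _ c, ← Finset.mul_sum, hx, mul_zero]
  classical
  have h1 := key (Pi.single 1 1)
  rw [Finset.sum_eq_single 1] at h1
  · simp at h1
  · intro b _ hb; simp [hb]
  · simp

end MatrixRepresentations

/-! ### Representations with real orthogonal matrices -/

section Realization

variable {G : Type*} [Group G]

open scoped InnerProductSpace

/-- A finite-dimensional real subspace on which the complex inner product is real has a basis which
is orthonormal over the complex numbers. -/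
lemma exists_orthonormal_of_real_inner {E : Type*} [NormedAddCommGroup E] [InnerProductSpace ℂ E]
    (W : Submodule ℝ E) [FiniteDimensional ℝ W] (hW : ∀ x ∈ W, ∀ y ∈ W, (⟪x, y⟫_ℂ).im = 0) :
    ∃ (n : ℕ) (b : Fin n → E), Orthonormal ℂ b ∧ (∀ i, b i ∈ W) ∧
      ∀ x ∈ W, x = ∑ i, ⟪b i, x⟫_ℂ • b i := by
  let _ : InnerProductSpace ℝ E := InnerProductSpace.complexToReal
  let W' : @Submodule ℝ E _ _ (InnerProductSpace.complexToReal (G := E)).toNormedSpace.toModule := W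
  have : FiniteDimensional ℝ W' := ‹FiniteDimensional ℝ W›
  let b := stdOrthonormalBasis ℝ W'
  refine ⟨_, fun i => b i, ?_, fun i => (b i).2, fun x hx => ?_⟩
  · rw [orthonormal_iff_ite]
    intro i j
    have h1 := orthonormal_iff_ite.mp b.orthonormal i j
    apply Complex.ext
    · have h2 : ⟪b i, b j⟫_ℝ = (⟪(b i : E), (b j : E)⟫_ℂ).re := rfl
      rw [← h2, h1]
      split_ifs <;> simp
    · rw [hW _ (b i).2 _ (b j).2]
      split_ifs <;> simp
  · have h1 := congrArg Subtype.val (b.sum_repr' (⟨x, hx⟩ : W'))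
    refine h1.symm.trans ?_
    simp only [Submodule.coe_sum, Submodule.coe_smul]
    refine Finset.sum_congr rfl fun i _ => ?_
    have h2 : ⟪b i, (⟨x, hx⟩ : W')⟫_ℝ = (⟪(b i : E), x⟫_ℂ).re := rfl
    have h3 : ⟪(b i : E), x⟫_ℂ = ((⟪(b i : E), x⟫_ℂ).re : ℂ) :=
      Complex.ext rfl (by simpa using hW _ (b i).2 _ hx)
    rw [h2, h3, Complex.ofReal_re, Complex.coe_smul]

/-- If an irreducible representation has an invariant Hermitian form and the Gram matrix of the
orbit of a nonzero vector is real, then it is given by real orthogonal matrices. -/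
lemma exists_real_matrices_of_real_gram [Finite G] {V E : Type*} [AddCommGroup V] [Module ℂ V]
    [NormedAddCommGroup E] [InnerProductSpace ℂ E] {ρ : Representation ℂ G V}
    (hρ : ρ.IsIrreducible) (Φ : V →ₗ[ℂ] E) (hΦ : Function.Injective Φ)
    (hinv : ∀ g x y, ⟪Φ (ρ g x), Φ (ρ g y)⟫_ℂ = ⟪Φ x, Φ y⟫_ℂ) {u : V} (hu : u ≠ 0)
    (hreal : ∀ g, (⟪Φ u, Φ (ρ g u)⟫_ℂ).im = 0) :
    ∃ (d : ℕ) (Γ : G →* Matrix (Fin d) (Fin d) ℂ), (∀ g, Γ g ∈ Matrix.unitaryGroup (Fin d) ℂ) ∧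
      (∀ g i j, (Γ g i j).im = 0) ∧ Nonempty ((matRep Γ).Equiv ρ) := by
  -- The real form: the real span of the orbit of `u`. Invariance reduces all inner products of
  -- orbit vectors to the given real ones.
  let W : Submodule ℝ E := Submodule.span ℝ (Set.range fun g => Φ (ρ g u))
  have hWreal : ∀ x ∈ W, ∀ y ∈ W, (⟪x, y⟫_ℂ).im = 0 := by
    intro x hx y hy
    induction hx, hy using Submodule.span_induction₂ with
    | mem_mem x y hx hy =>
      obtain ⟨g, rfl⟩ := hx
      obtain ⟨h, rfl⟩ := hy
      have := hinv g⁻¹ (ρ g u) (ρ h u)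
      rw [ρ.inv_self_apply, ← Module.End.mul_apply, ← map_mul] at this
      simp only
      rw [← this]
      exact hreal _
    | zero_left => simp
    | zero_right => simp
    | add_left x y z _ _ _ h1 h2 => simp [h1, h2]
    | add_right x y z _ _ _ h1 h2 => simp [h1, h2]
    | smul_left r x y _ _ h => 
      rw [← Complex.coe_smul, inner_smul_left]; simp [h]
    | smul_right r x y _ _ h => 
      rw [← Complex.coe_smul, inner_smul_right]; simp [h]
  have hWinv : ∀ g, ∀ v, Φ v ∈ W → Φ (ρ g v) ∈ W := by
    intro g
    -- Span induction runs over vectors of `E`, while `ρ` acts on `V`; injectivity of `Φ` identifies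
    -- the preimage.
    suffices h : ∀ x ∈ W, ∃ v, Φ v = x ∧ Φ (ρ g v) ∈ W by
      intro v hv
      obtain ⟨w, hw, hw'⟩ := h _ hv
      rwa [← hΦ hw]
    intro x hx
    induction hx using Submodule.span_induction with
    | mem x hx =>
      obtain ⟨h, rfl⟩ := hx
      refine ⟨ρ h u, rfl, ?_⟩
      rw [← Module.End.mul_apply, ← map_mul]
      exact Submodule.subset_span ⟨g * h, rfl⟩
    | zero => exact ⟨0, by simp, by simp⟩
    | add x y _ _ hx hy =>
      obtain ⟨v, rfl, hv⟩ := hx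
      obtain ⟨w, rfl, hw⟩ := hy
      exact ⟨v + w, by simp, by simpa using W.add_mem hv hw⟩
    | smul r x _ hx =>
      obtain ⟨v, rfl, hv⟩ := hx
      refine ⟨(r : ℂ) • v, by simp, ?_⟩
      rw [map_smul, map_smul, Complex.coe_smul]
      exact W.smul_mem r hv
  have : FiniteDimensional ℝ W := FiniteDimensional.span_of_finite ℝ (Set.finite_range _)
  obtain ⟨d, b, hb, hbW, hbexp⟩ := exists_orthonormal_of_real_inner W hWreal
  have hWrange : ∀ x ∈ W, ∃ v, Φ v = x := by
    have : W ≤ (LinearMap.range Φ).restrictScalars ℝ := by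
      refine Submodule.span_le.mpr ?_
      rintro _ ⟨g, rfl⟩
      exact ⟨_, rfl⟩
    exact this
  choose w hw using fun i => hWrange (b i) (hbW i)
  have horth : Orthonormal ℂ fun i => Φ (w i) := by simpa only [hw] using hb
  have hexp : ∀ v, Φ v ∈ W → v = ∑ i, ⟪Φ (w i), Φ v⟫_ℂ • w i := by
    intro v hv
    apply hΦ
    conv_lhs => rw [hbexp _ hv]
    simp only [map_sum, map_smul, hw]
  have hli : LinearIndependent ℂ w := horth.linearIndependent.of_comp Φ
  have hspan : ⊤ ≤ Submodule.span ℂ (Set.range w) := by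
    let S : Subrepresentation ρ := ⟨Submodule.span ℂ (Set.range w), by
      intro g v hv
      induction hv using Submodule.span_induction with
      | mem x hx =>
        obtain ⟨i, rfl⟩ := hx
        rw [hexp (ρ g (w i)) (hWinv g _ (by rw [hw]; exact hbW i))]
        exact Submodule.sum_mem _ fun j _ => Submodule.smul_mem _ _ (Submodule.subset_span ⟨j, rfl⟩)
      | zero => simp
      | add x y _ _ hx hy => rw [map_add]; exact Submodule.add_mem _ hx hy
      | smul c x _ hx => rw [map_smul]; exact Submodule.smul_mem _ _ hx⟩
    -- The complex span of the real basis is invariant and contains `u ≠ 0`, so irreducibility makes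
    -- it everything.
    have hS : S = ⊤ := by
      refine (hρ.eq_bot_or_eq_top S).resolve_left fun h0 => hu ?_
      have hmem : u ∈ S.toSubmodule := by
        rw [hexp u (Submodule.subset_span ⟨1, by simp⟩)]
        exact Submodule.sum_mem _ fun j _ => Submodule.smul_mem _ _ (Submodule.subset_span ⟨j, rfl⟩)
      rw [h0] at hmem
      exact (Submodule.mem_bot ℂ).mp hmem
    exact (congrArg Subrepresentation.toSubmodule hS).ge
  let B := Module.Basis.mk hli hspan
  have hB : ∀ i, B i = w i := fun i => Module.Basis.mk_apply hli hspan i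
  have hrepr : ∀ v i, B.repr v i = ⟪Φ (w i), Φ v⟫_ℂ := by
    intro v i
    conv_rhs => rw [← B.sum_repr v]
    simp only [map_sum, map_smul, hB]
    rw [horth.inner_right_fintype]
  let Γ : G →* Matrix (Fin d) (Fin d) ℂ :=
    (LinearMap.toMatrixAlgEquiv B).toAlgHom.toMonoidHom.comp ρ
  have hΓ : ∀ g i j, Γ g i j = ⟪Φ (w i), Φ (ρ g (w j))⟫_ℂ := by
    intro g i j
    rw [← hrepr, ← hB j]
    exact LinearMap.toMatrixAlgEquiv_apply B _ i j
  refine ⟨_, Γ, ?_, ?_, ?_⟩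
  · intro g
    rw [Matrix.mem_unitaryGroup_iff']
    ext i j
    rw [Matrix.mul_apply]
    have h1 : ⟪Φ (ρ g (w i)), Φ (ρ g (w j))⟫_ℂ = (1 : Matrix _ _ ℂ) i j := by
      rw [hinv, orthonormal_iff_ite.mp horth, Matrix.one_apply]
    rw [← h1, hexp (ρ g (w i)) (hWinv g _ (by rw [hw]; exact hbW i)), map_sum, sum_inner]
    refine Finset.sum_congr rfl fun k _ => ?_
    rw [map_smul, inner_smul_left, Matrix.star_apply, hΓ, hΓ]
    rfl
  · intro g i j
    rw [hΓ]
    refine hWreal _ (by rw [hw]; exact hbW i) _ (hWinv g _ (by rw [hw]; exact hbW j))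
  · refine ⟨.mk B.equivFun.symm fun g => ?_⟩
    apply (Pi.basisFun ℂ _).ext
    intro j
    have h1 : B.equivFun.symm (Pi.single j 1) = w j := by
      rw [B.equivFun_symm_apply, ← hB j]
      simp
    simp only [Pi.basisFun_apply, LinearMap.comp_apply, LinearEquiv.coe_coe, matRep_apply]
    rw [h1, Matrix.mulVec_single_one, B.equivFun_symm_apply]
    rw [hexp (ρ g (w j)) (hWinv g _ (by rw [hw]; exact hbW j))]
    refine Finset.sum_congr rfl fun k _ => ?_
    rw [hB, Matrix.col_apply, hΓ]

/-- An irreducible representation of a finite group is given by real orthogonal matrices if, for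
some nonzero vector `u`, every group element is a product `h₁ t h₂` with `t ^ 2 = 1` and with
`h₁`, `h₂` acting on `u` by a sign. -/
lemma exists_real_matrices_of_signs [Finite G] {V : Type*} [AddCommGroup V] [Module ℂ V]
    [FiniteDimensional ℂ V] {ρ : Representation ℂ G V} (hρ : ρ.IsIrreducible) {u : V} (hu : u ≠ 0)
    (hsign : ∀ g, ∃ h₁ t h₂, g = h₁ * t * h₂ ∧ t * t = 1 ∧ (ρ h₁ u = u ∨ ρ h₁ u = -u) ∧
      (ρ h₂ u = u ∨ ρ h₂ u = -u)) :
    ∃ (d : ℕ) (Γ : G →* Matrix (Fin d) (Fin d) ℂ), (∀ g, Γ g ∈ Matrix.unitaryGroup (Fin d) ℂ) ∧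
      (∀ g i j, (Γ g i j).im = 0) ∧ Nonempty ((matRep Γ).Equiv ρ) := by
  have := Fintype.ofFinite G
  let e : V ≃ₗ[ℂ] EuclideanSpace ℂ (Fin (Module.finrank ℂ V)) :=
    (Module.finBasis ℂ V).equivFun ≪≫ₗ (WithLp.linearEquiv 2 ℂ _).symm
  -- Sending `v` to the family `ρ g v` pulls back the averaged, hence invariant, inner product.
  let Φ : V →ₗ[ℂ] PiLp 2 (fun _ : G => EuclideanSpace ℂ (Fin (Module.finrank ℂ V))) :=
    (WithLp.linearEquiv 2 ℂ _).symm.toLinearMap ∘ₗ LinearMap.pi fun g => e.toLinearMap ∘ₗ ρ g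
  have hΦ : ∀ v g, Φ v g = e (ρ g v) := fun v g => rfl
  have hinner : ∀ x y, ⟪Φ x, Φ y⟫_ℂ = ∑ g, ⟪e (ρ g x), e (ρ g y)⟫_ℂ := fun x y => by
    rw [PiLp.inner_apply]
    rfl
  have hinv : ∀ g x y, ⟪Φ (ρ g x), Φ (ρ g y)⟫_ℂ = ⟪Φ x, Φ y⟫_ℂ := by
    intro g x y
    rw [hinner x, ← Equiv.sum_comp (Equiv.mulRight g), hinner]
    refine Finset.sum_congr rfl fun h _ => ?_
    simp only [Equiv.coe_mulRight, map_mul ρ h g, Module.End.mul_apply]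
  refine exists_real_matrices_of_real_gram hρ Φ ?_ hinv hu fun g => ?_
  · intro x y hxy
    have h1 : Φ x 1 = Φ y 1 := by rw [hxy]
    simpa [hΦ] using h1
  obtain ⟨h₁, t, h₂, rfl, ht, h1, h2⟩ := hsign g
  -- An involution moves across the invariant form, so this number equals its conjugate.
  have key : (⟪Φ u, Φ (ρ t u)⟫_ℂ).im = 0 := by
    have h3 := hinv t u (ρ t u)
    rw [← Module.End.mul_apply, ← map_mul, ht, map_one, Module.End.one_apply] at h3
    rw [← Complex.conj_eq_iff_im, inner_conj_symm, h3]
  have h4 := hinv h₁ u (ρ t u)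
  rw [map_mul, map_mul, Module.End.mul_apply, Module.End.mul_apply]
  have h5 : (⟪Φ u, Φ (ρ h₁ (ρ t u))⟫_ℂ).im = 0 := by
    rcases h1 with h1 | h1 <;> rw [h1] at h4
    · rw [h4, key]
    · rw [map_neg, inner_neg_left, neg_eq_iff_eq_neg] at h4
      rw [h4, Complex.neg_im, key, neg_zero]
  rcases h2 with h2 | h2 <;> rw [h2]
  · exact h5
  · rw [map_neg, map_neg, map_neg, inner_neg_right, Complex.neg_im, h5, neg_zero]

/-- If all irreducible representations of a finite group are given by real orthogonal matrices,
then there is a complete list of irreducible representations with real matrices. -/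
lemma exists_real_irrepList [Finite G]
    (h : ∀ (n : ℕ) (Δ : G →* Matrix (Fin n) (Fin n) ℂ), (matRep Δ).IsIrreducible →
      ∃ (d : ℕ) (Γ : G →* Matrix (Fin d) (Fin d) ℂ), (∀ g, Γ g ∈ Matrix.unitaryGroup (Fin d) ℂ) ∧
      (∀ g i j, (Γ g i j).im = 0) ∧ Nonempty ((matRep Γ).Equiv (matRep Δ))) :
    ∃ (r : ℕ) (A : IrrepList G r), ∀ p g i j, (A.Γ p g i j).im = 0 := by
  have := Fintype.ofFinite G
  by_contra hcon
  -- Without a complete real list, every real list can be lengthened by a real form of a missing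
  -- representation. Length `Fintype.card G + 1` is impossible.
  have step : ∀ r : ℕ, ∃ F : Fin r → Σ d : ℕ, G →* Matrix (Fin d) (Fin d) ℂ,
      (∀ p g, (F p).2 g ∈ Matrix.unitaryGroup (Fin (F p).1) ℂ) ∧
      (∀ p g i j, ((F p).2 g i j).im = 0) ∧ (∀ p, (matRep (F p).2).IsIrreducible) ∧
      ∀ p q, Nonempty ((matRep (F p).2).Equiv (matRep (F q).2)) → p = q := by
    intro r
    induction r with
    | zero => exact ⟨fun p => p.elim0, fun p => p.elim0, fun p => p.elim0, fun p => p.elim0,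
        fun p => p.elim0⟩
    | succ r ih =>
      obtain ⟨F, hF, hF', hFirr, hFne⟩ := ih
      by_cases hex : ∀ (n : ℕ) (Δ : G →* Matrix (Fin n) (Fin n) ℂ), (matRep Δ).IsIrreducible →
          ∃ p, Nonempty ((matRep (F p).2).Equiv (matRep Δ))
      · exact absurd ⟨r, ⟨fun p => (F p).1, fun p => (F p).2, hF, hFirr, hFne, hex⟩, hF'⟩ hcon
      · push Not at hex
        obtain ⟨n, Δ, hΔ, hno⟩ := hex
        obtain ⟨d, Γ, hΓ, hΓ', ⟨e⟩⟩ := h n Δ hΔ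
        have hΓirr : (matRep Γ).IsIrreducible := by
          rw [Representation.irreducible_iff_isSimpleModule_asModule] at hΔ ⊢
          exact IsSimpleModule.congr
            (LinearEquiv.ofBijective (Representation.IntertwiningMap.equivLinearMapAsModule _ _
              e.toIntertwiningMap) e.toLinearEquiv.bijective)
        refine ⟨Fin.cons ⟨d, Γ⟩ F, ?_, ?_, ?_, ?_⟩
        · exact Fin.cases hΓ hF
        · exact Fin.cases hΓ' hF'
        · exact Fin.cases hΓirr hFirr
        · intro p q
          refine Fin.cases ?_ (fun p => ?_) p <;> refine Fin.cases ?_ (fun q => ?_) q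
          · exact fun _ => rfl
          · rintro ⟨e'⟩
            exact ((hno q).false (e'.symm.trans e)).elim
          · rintro ⟨e'⟩
            exact ((hno p).false (e'.trans e)).elim
          · exact fun h => congrArg Fin.succ (hFne _ _ h)
  obtain ⟨F, -, -, hirr, hne⟩ := step (Fintype.card G + 1)
  have := card_le_of_inequivalent hirr hne
  omega

end Realization

/-! ### Linear isometries and orthogonal matrices -/

section Isometries

/-- The matrix of a linear isometry in the standard basis. -/
noncomputable def matOf : (E3 ≃ₗᵢ[ℝ] E3) →* Matrix (Fin 3) (Fin 3) ℝ where
  toFun g := LinearMap.toMatrix (EuclideanSpace.basisFun (Fin 3) ℝ).toBasis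
    (EuclideanSpace.basisFun (Fin 3) ℝ).toBasis (g.toLinearEquiv : E3 →ₗ[ℝ] E3)
  map_one' := LinearMap.toMatrix_one _
  map_mul' g h := LinearMap.toMatrix_mul _ (g.toLinearEquiv : E3 →ₗ[ℝ] E3) h.toLinearEquiv

lemma matOf_mulVec (g : E3 ≃ₗᵢ[ℝ] E3) (x : E3) : (matOf g).mulVec x.ofLp = (g x).ofLp :=
  LinearMap.toMatrix_mulVec_repr (EuclideanSpace.basisFun (Fin 3) ℝ).toBasis
    (EuclideanSpace.basisFun (Fin 3) ℝ).toBasis (g.toLinearEquiv : E3 →ₗ[ℝ] E3) x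

lemma apply_eq_sum (g : E3 ≃ₗᵢ[ℝ] E3) (x : E3) (i : Fin 3) : g x i = ∑ j, matOf g i j * x j :=
  (congrFun (matOf_mulVec g x) i).symm

lemma matOf_injective : Function.Injective matOf := by
  intro g h hgh
  ext x : 1
  apply PiLp.ext
  intro i
  rw [apply_eq_sum, apply_eq_sum, hgh]

lemma det_matOf (g : E3 ≃ₗᵢ[ℝ] E3) :
    (matOf g).det = LinearMap.det (g.toLinearEquiv : E3 →ₗ[ℝ] E3) :=
  LinearMap.det_toMatrix _ _

lemma transpose_mul_matOf (g : E3 ≃ₗᵢ[ℝ] E3) : (matOf g).transpose * matOf g = 1 := by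
  have h : ∀ i j, matOf g i j = g (EuclideanSpace.single j 1) i := by
    intro i j
    rw [apply_eq_sum, Finset.sum_eq_single j] <;> simp +contextual
  ext i j
  have h1 := g.inner_map_map (EuclideanSpace.single i 1) (EuclideanSpace.single j 1)
  rw [PiLp.inner_apply, PiLp.inner_apply] at h1
  rw [Matrix.mul_apply]
  simp only [Matrix.transpose_apply, h]
  simp only [RCLike.inner_apply, conj_trivial] at h1
  calc _ = _ := Finset.sum_congr rfl fun k _ => mul_comm _ _
    _ = _ := h1
    _ = _ := by
      rw [Finset.sum_eq_single j] <;> simp +contextual [Matrix.one_apply, eq_comm]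

/-- The linear isometry given by an orthogonal matrix. -/
noncomputable def isometryOfMatrix (A : Matrix (Fin 3) (Fin 3) ℝ) (hA : A.transpose * A = 1) :
    E3 ≃ₗᵢ[ℝ] E3 :=
  LinearIsometry.toLinearIsometryEquiv (E₁ := E3) (F := E3)
    { toLinearMap := Matrix.toEuclideanLin A
      norm_map' := fun x => by
        rw [← sq_eq_sq₀ (norm_nonneg _) (norm_nonneg _), EuclideanSpace.real_norm_sq_eq,
          EuclideanSpace.real_norm_sq_eq]
        have h1 : ∀ y : Fin 3 → ℝ, ∑ i, y i ^ 2 = dotProduct y y := fun y =>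
          Finset.sum_congr rfl fun i _ => sq _
        rw [h1, h1]
        change dotProduct (A.mulVec x.ofLp) (A.mulVec x.ofLp) = _
        rw [Matrix.dotProduct_mulVec, Matrix.vecMul_mulVec, hA, Matrix.vecMul_one] } rfl

lemma matOf_isometryOfMatrix (A : Matrix (Fin 3) (Fin 3) ℝ) (hA : A.transpose * A = 1) :
    matOf (isometryOfMatrix A hA) = A := by
  have h : ∀ x : E3, (isometryOfMatrix A hA x).ofLp = A.mulVec x.ofLp := fun x => rfl
  ext i j
  have h1 := congrFun (matOf_mulVec (isometryOfMatrix A hA) (EuclideanSpace.single j 1)) i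
  rw [h] at h1
  simpa using h1

end Isometries

/-! ### The action on square integrable functions -/

section Action

lemma continuous_actS (g : E3 ≃ₗᵢ[ℝ] E3) : Continuous (actS g) :=
  Continuous.subtype_mk (g.continuous.comp continuous_subtype_val) _

lemma actS_mul (g h : E3 ≃ₗᵢ[ℝ] E3) (x : S2) : actS (g * h) x = actS g (actS h x) := rfl

/-- The surface measure of a set is a constant times the volume of the cone over it, and linear
isometries preserve volume and commute with scaling. -/
lemma measurePreserving_actS (g : E3 ≃ₗᵢ[ℝ] E3) : MeasurePreserving (actS g) surface surface := by
  refine ⟨(continuous_actS g).measurable, ?_⟩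
  ext s hs
  rw [Measure.map_apply (continuous_actS g).measurable hs,
    Measure.toSphere_apply' _ ((continuous_actS g).measurable hs), Measure.toSphere_apply' _ hs]
  congr 1
  refine Eq.trans ?_
    (g.measurePreserving.measure_preimage_equiv (f := g.toHomeomorph.toMeasurableEquiv) _)
  congr 1
  ext x
  simp only [Set.mem_smul, Set.mem_image, Set.mem_preimage]
  constructor
  · rintro ⟨r, hr, _, ⟨y, hy, rfl⟩, rfl⟩
    exact ⟨r, hr, _, ⟨_, hy, rfl⟩, (map_smul g r (y : E3)).symm⟩
  · rintro ⟨r, hr, _, ⟨y, hy, rfl⟩, hx⟩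
    refine ⟨r, hr, _, ⟨actS g⁻¹ y, ?_, rfl⟩, ?_⟩
    · rw [← actS_mul, mul_inv_cancel]
      exact hy
    · apply g.injective
      refine Eq.trans ?_ hx
      rw [map_smul]
      exact congrArg (r • ·) (g.apply_symm_apply y)

/-- The unitary operator `f ↦ f ∘ g⁻¹`. -/
noncomputable def translate (g : E3 ≃ₗᵢ[ℝ] E3) : L2S →ₗᵢ[ℂ] L2S :=
  Lp.compMeasurePreservingₗᵢ ℂ (actS g⁻¹) (measurePreserving_actS g⁻¹)

lemma coeFn_translate (g : E3 ≃ₗᵢ[ℝ] E3) (f : L2S) :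
    translate g f =ᵐ[surface] fun x => f (actS g⁻¹ x) :=
  Lp.coeFn_compMeasurePreserving f (measurePreserving_actS g⁻¹)

lemma translate_one (f : L2S) : translate 1 f = f := by
  apply Lp.ext
  filter_upwards [coeFn_translate 1 f] with x hx
  rw [hx]
  rfl

lemma translate_mul (g h : E3 ≃ₗᵢ[ℝ] E3) (f : L2S) :
    translate (g * h) f = translate g (translate h f) := by
  apply Lp.ext
  filter_upwards [coeFn_translate (g * h) f, coeFn_translate g (translate h f),
    (measurePreserving_actS g⁻¹).quasiMeasurePreserving.ae (coeFn_translate h f)] with x h1 h2 h3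
  rw [h1, h2, h3, mul_inv_rev, actS_mul]

lemma translate_star (g : E3 ≃ₗᵢ[ℝ] E3) (f : L2S) : translate g (star f) = star (translate g f) := by
  apply Lp.ext
  filter_upwards [coeFn_translate g f, coeFn_translate g (star f), Lp.coeFn_star (translate g f),
    (measurePreserving_actS g⁻¹).quasiMeasurePreserving.ae (Lp.coeFn_star f)] with x h1 h2 h3 h4
  rw [h2, h3, h4, Pi.star_apply, Pi.star_apply, h1]

lemma star_smul_L2S (c : ℂ) (f : L2S) : star (c • f) = star c • star f := by
  apply Lp.ext
  filter_upwards [Lp.coeFn_star (c • f), Lp.coeFn_smul c f, Lp.coeFn_smul (star c) (star f),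
    Lp.coeFn_star f] with x h1 h2 h3 h4
  rw [h1, h3, Pi.star_apply, h2, Pi.smul_apply, Pi.smul_apply, h4, Pi.star_apply, star_smul]

lemma star_add_L2S (f h : L2S) : star (f + h) = star f + star h := by
  apply Lp.ext
  filter_upwards [Lp.coeFn_star (f + h), Lp.coeFn_add f h, Lp.coeFn_add (star f) (star h),
    Lp.coeFn_star f, Lp.coeFn_star h] with x h1 h2 h3 h4 h5
  rw [h1, h3, Pi.star_apply, h2, Pi.add_apply, Pi.add_apply, h4, h5, Pi.star_apply, Pi.star_apply,
    star_add]

open scoped InnerProductSpace in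
lemma inner_star_star (f h : L2S) : ⟪star f, star h⟫_ℂ = star ⟪f, h⟫_ℂ := by
  rw [L2.inner_def, L2.inner_def]
  rw [← starRingEnd_apply, ← integral_conj]
  refine integral_congr_ae ?_
  filter_upwards [Lp.coeFn_star f, Lp.coeFn_star h] with x h1 h2
  rw [h1, h2]
  simp

lemma isRealValued_iff (f : L2S) : IsRealValued f ↔ star f = f := by
  constructor
  · intro h
    apply Lp.ext
    filter_upwards [h, Lp.coeFn_star f] with x h1 h2
    rw [h2, Pi.star_apply]
    exact Complex.conj_eq_iff_im.mpr h1
  · intro h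
    have h1 := Lp.coeFn_star f
    rw [h] at h1
    filter_upwards [h1] with x hx
    exact Complex.conj_eq_iff_im.mp hx.symm

end Action

/-! ### Harmonic polynomials -/

section Polynomials

open MvPolynomial

/-- The commutator of two derivations is a derivation, and this one kills the variables. -/
lemma pderiv_comm (i j : Fin 3) (P : MvPolynomial (Fin 3) ℂ) :
    pderiv i (pderiv j P) = pderiv j (pderiv i P) := by
  have h : ⁅pderiv (R := ℂ) i, pderiv (R := ℂ) j⁆ = 0 := by
    apply MvPolynomial.derivation_ext
    intro k
    simp only [Derivation.commutator_apply, pderiv_X, Derivation.coe_zero, Pi.zero_apply]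
    rw [Pi.single_apply, Pi.single_apply]
    split_ifs <;> simp
  have h1 := congrArg (fun D : Derivation ℂ (MvPolynomial (Fin 3) ℂ) _ => D P) h
  simpa [Derivation.commutator_apply, sub_eq_zero] using h1

/-- The Laplace operator on polynomials. -/
noncomputable def laplacian : MvPolynomial (Fin 3) ℂ →ₗ[ℂ] MvPolynomial (Fin 3) ℂ :=
  ∑ i, (pderiv i).toLinearMap ∘ₗ (pderiv i).toLinearMap

lemma laplacian_apply (P : MvPolynomial (Fin 3) ℂ) :
    laplacian P = ∑ i, pderiv i (pderiv i P) := by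
  simp [laplacian]

/-- The generator of the rotations in the plane of the coordinates `i` and `j`. -/
noncomputable def rotGen (i j : Fin 3) (P : MvPolynomial (Fin 3) ℂ) : MvPolynomial (Fin 3) ℂ :=
  X i * pderiv j P - X j * pderiv i P

/-- With the Euler operator `E = ∑ i, X i * pderiv i`, the left-hand operator is `|x|² Δ - E (E +
1)`, and `E` acts as `l` in degree `l`. The derivatives of Euler's identity supply the second-order
terms. -/
lemma sum_rotGen_rotGen {l : ℕ} {P : MvPolynomial (Fin 3) ℂ} (hP : P.IsHomogeneous l)
    (hΔ : laplacian P = 0) :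
    rotGen 0 1 (rotGen 0 1 P) + rotGen 0 2 (rotGen 0 2 P) + rotGen 1 2 (rotGen 1 2 P) =
      -((l * (l + 1) : ℕ) : MvPolynomial (Fin 3) ℂ) * P := by
  have h1 := hP.sum_X_mul_pderiv
  have h2 : ∀ k : Fin 3, pderiv k (∑ i, X i * pderiv i P) = pderiv k (l • P) := fun k => by rw [h1]
  have h20 := h2 0
  have h21 := h2 1
  have h22 := h2 2
  rw [laplacian_apply] at hΔ
  simp only [Fin.sum_univ_three, map_add, pderiv_mul, pderiv_X_self, nsmul_eq_mul,
    pderiv_X_of_ne (show (0 : Fin 3) ≠ 1 by decide), pderiv_X_of_ne (show (1 : Fin 3) ≠ 0 by decide),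
    pderiv_X_of_ne (show (0 : Fin 3) ≠ 2 by decide), pderiv_X_of_ne (show (2 : Fin 3) ≠ 0 by decide),
    pderiv_X_of_ne (show (1 : Fin 3) ≠ 2 by decide), pderiv_X_of_ne (show (2 : Fin 3) ≠ 1 by decide),
    Derivation.map_natCast, zero_mul, zero_add, one_mul] at h1 h20 h21 h22 hΔ
  simp only [rotGen, map_sub, pderiv_mul, pderiv_X_self,
    pderiv_X_of_ne (show (0 : Fin 3) ≠ 1 by decide), pderiv_X_of_ne (show (1 : Fin 3) ≠ 0 by decide),
    pderiv_X_of_ne (show (0 : Fin 3) ≠ 2 by decide), pderiv_X_of_ne (show (2 : Fin 3) ≠ 0 by decide),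
    pderiv_X_of_ne (show (1 : Fin 3) ≠ 2 by decide), pderiv_X_of_ne (show (2 : Fin 3) ≠ 1 by decide),
    zero_mul, zero_add, one_mul]
  rw [pderiv_comm 1 0, pderiv_comm 2 0, pderiv_comm 2 1] at *
  push_cast
  linear_combination (X 0 ^ 2 + X 1 ^ 2 + X 2 ^ 2) * hΔ - X 0 * h20 - X 1 * h21 - X 2 * h22
    - (l + 1) * h1

/-- A polynomial in transformed variables. -/
noncomputable def substMatrix (A : Matrix (Fin 3) (Fin 3) ℝ) :
    MvPolynomial (Fin 3) ℂ →ₐ[ℂ] MvPolynomial (Fin 3) ℂ :=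
  aeval fun i => ∑ j, C (A i j : ℂ) * X j

lemma pderiv_substMatrix (A : Matrix (Fin 3) (Fin 3) ℝ) (k : Fin 3) (P : MvPolynomial (Fin 3) ℂ) :
    pderiv k (substMatrix A P) = ∑ j, C (A j k : ℂ) * substMatrix A (pderiv j P) := by
  induction P using MvPolynomial.induction_on with
  | C a => simp [substMatrix]
  | add p q hp hq => simp [hp, hq, mul_add, Finset.sum_add_distrib]
  | mul_X p n hp =>
    have hX : pderiv k (substMatrix A (X n)) = C (A n k : ℂ) := by
      simp only [substMatrix, aeval_X, map_sum, pderiv_C_mul, pderiv_X]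
      rw [Finset.sum_eq_single k] <;> simp +contextual [eq_comm]
    rw [map_mul, pderiv_mul, hX, hp, Finset.sum_mul]
    have h1 : ∀ j, C (A j k : ℂ) * substMatrix A (pderiv j (p * X n)) =
        C (A j k : ℂ) * substMatrix A (pderiv j p) * substMatrix A (X n) +
        if j = n then substMatrix A p * C (A n k : ℂ) else 0 := by
      intro j
      rw [pderiv_mul, map_add, map_mul, map_mul]
      split_ifs with h
      · subst h
        rw [pderiv_X_self, map_one]
        ring
      · rw [pderiv_X_of_ne (Ne.symm h), map_zero]
        ring
    simp only [h1, Finset.sum_add_distrib, Finset.sum_ite_eq', Finset.mem_univ, if_true]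

lemma laplacian_substMatrix {A : Matrix (Fin 3) (Fin 3) ℝ} (hA : A * A.transpose = 1)
    (P : MvPolynomial (Fin 3) ℂ) : laplacian (substMatrix A P) = substMatrix A (laplacian P) := by
  have h : ∀ i j, ∑ k, (C (A i k : ℂ) * C (A j k : ℂ) : MvPolynomial (Fin 3) ℂ) =
      if i = j then 1 else 0 := by
    intro i j
    have h1 := congrFun (congrFun hA i) j
    rw [Matrix.mul_apply, Matrix.one_apply] at h1
    simp only [← C_mul, ← map_sum, Matrix.transpose_apply] at h1 ⊢
    norm_cast
    rw [h1]
    split_ifs <;> simp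
  simp only [laplacian_apply, map_sum, pderiv_substMatrix, pderiv_C_mul]
  calc _ = ∑ i, ∑ j, (∑ k, C (A i k : ℂ) * C (A j k : ℂ)) *
        substMatrix A (pderiv i (pderiv j P)) := by
        simp only [Finset.mul_sum, Finset.sum_mul]
        rw [Finset.sum_comm]
        refine Finset.sum_congr rfl fun i _ => ?_
        rw [Finset.sum_comm]
        refine Finset.sum_congr rfl fun j _ => Finset.sum_congr rfl fun k _ => ?_
        rw [pderiv_comm]
        ring
    _ = _ := by
        simp only [h, ite_mul, one_mul, zero_mul, Finset.sum_ite_eq, Finset.mem_univ, if_true]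

lemma isHomogeneous_substMatrix (A : Matrix (Fin 3) (Fin 3) ℝ) {l : ℕ} {P : MvPolynomial (Fin 3) ℂ}
    (hP : P.IsHomogeneous l) : (substMatrix A P).IsHomogeneous l := by
  have h := hP.aeval (φ := P) (S := ℂ) (fun i => ∑ j, C (A i j : ℂ) * X j) (n := 1) fun i =>
    IsHomogeneous.sum _ _ _ fun j _ => isHomogeneous_C_mul_X _ _
  rwa [one_mul] at h

lemma laplacian_map_conj (P : MvPolynomial (Fin 3) ℂ) :
    laplacian (map (starRingEnd ℂ) P) = map (starRingEnd ℂ) (laplacian P) := by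
  simp only [laplacian_apply, pderiv_map, map_sum]

end Polynomials

/-! ### Polynomial functions on the sphere -/

section PolynomialFunctions

open MvPolynomial

/-- The restriction of a polynomial to the sphere. -/
noncomputable def polyC : MvPolynomial (Fin 3) ℂ →ₐ[ℂ] C(S2, ℂ) :=
  aeval fun i => ⟨fun x => ((x : E3) i : ℂ), by fun_prop⟩

lemma polyC_apply (P : MvPolynomial (Fin 3) ℂ) (x : S2) :
    polyC P x = eval (fun i => ((x : E3) i : ℂ)) P := by
  induction P using MvPolynomial.induction_on with
  | C a => simp [polyC]
  | add p q hp hq => simp [hp, hq]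
  | mul_X p n hp =>
    rw [map_mul, map_mul, ContinuousMap.mul_apply, hp]
    simp [polyC]

lemma polyC_map_conj (P : MvPolynomial (Fin 3) ℂ) (x : S2) :
    polyC (map (starRingEnd ℂ) P) x = starRingEnd ℂ (polyC P x) := by
  induction P using MvPolynomial.induction_on with
  | C a => simp [polyC]
  | add p q hp hq => simp [hp, hq]
  | mul_X p n hp =>
    rw [map_mul, map_mul, map_mul, ContinuousMap.mul_apply, ContinuousMap.mul_apply, hp, map_mul]
    simp [polyC_apply]

lemma polyC_substMatrix (g : E3 ≃ₗᵢ[ℝ] E3) (P : MvPolynomial (Fin 3) ℂ) (x : S2) :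
    polyC (substMatrix (matOf g) P) x = polyC P (actS g x) := by
  induction P using MvPolynomial.induction_on with
  | C a => simp [substMatrix]
  | add p q hp hq => simp [hp, hq]
  | mul_X p n hp =>
    rw [map_mul, map_mul, map_mul, ContinuousMap.mul_apply, ContinuousMap.mul_apply, hp]
    congr 1
    rw [polyC_apply, polyC_apply]
    simp only [substMatrix, aeval_X, eval_X, actS, apply_eq_sum, map_sum, map_mul, eval_C,
      Complex.ofReal_sum, Complex.ofReal_mul]

/-- The restriction of a polynomial to the sphere, as a square integrable function. -/
noncomputable def polyL2 : MvPolynomial (Fin 3) ℂ →ₗ[ℂ] L2S :=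
  (ContinuousMap.toLp 2 surface ℂ).toLinearMap ∘ₗ polyC.toLinearMap

lemma coeFn_polyL2 (P : MvPolynomial (Fin 3) ℂ) : polyL2 P =ᵐ[surface] polyC P :=
  ContinuousMap.coeFn_toLp surface (polyC P)

open scoped InnerProductSpace in
lemma inner_polyL2 (P Q : MvPolynomial (Fin 3) ℂ) :
    ⟪polyL2 P, polyL2 Q⟫_ℂ = ∫ x, polyC (map (starRingEnd ℂ) P * Q) x ∂surface := by
  rw [L2.inner_def]
  refine integral_congr_ae ?_
  filter_upwards [coeFn_polyL2 P, coeFn_polyL2 Q] with x h1 h2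
  rw [h1, h2, map_mul, ContinuousMap.mul_apply, polyC_map_conj]
  simp [mul_comm]

lemma translate_polyL2 (g : E3 ≃ₗᵢ[ℝ] E3) (P : MvPolynomial (Fin 3) ℂ) :
    translate g (polyL2 P) = polyL2 (substMatrix (matOf g⁻¹) P) := by
  apply Lp.ext
  filter_upwards [coeFn_translate g (polyL2 P), coeFn_polyL2 (substMatrix (matOf g⁻¹) P),
    (measurePreserving_actS g⁻¹).quasiMeasurePreserving.ae (coeFn_polyL2 P)] with x h1 h2 h3
  rw [h1, h2, h3, polyC_substMatrix]

lemma star_polyL2 (P : MvPolynomial (Fin 3) ℂ) :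
    star (polyL2 P) = polyL2 (map (starRingEnd ℂ) P) := by
  apply Lp.ext
  filter_upwards [Lp.coeFn_star (polyL2 P), coeFn_polyL2 (map (starRingEnd ℂ) P),
    coeFn_polyL2 P] with x h1 h2 h3
  rw [h1, h2, Pi.star_apply, h3, polyC_map_conj]
  rfl

lemma polyL2_eq_zero_iff (P : MvPolynomial (Fin 3) ℂ) : polyL2 P = 0 ↔ polyC P = 0 := by
  have h := ContinuousMap.toLp_injective (p := 2) (𝕜 := ℂ) (E := ℂ) surface
  exact map_eq_zero_iff _ h

lemma eval_mul_of_isHomogeneous {l : ℕ} {P : MvPolynomial (Fin 3) ℂ} (hP : P.IsHomogeneous l)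
    (c : ℂ) (v : Fin 3 → ℂ) : eval (fun i => c * v i) P = c ^ l * eval v P := by
  rw [eval_eq', eval_eq', Finset.mul_sum]
  refine Finset.sum_congr rfl fun m hm => ?_
  simp only [mul_pow, Finset.prod_mul_distrib, Finset.prod_pow_eq_pow_sum]
  have hl : ∑ i, m i = l :=
    (Finset.sum_subset (Finset.subset_univ m.support) fun i _ hi => by simpa using hi).symm.trans
      (hP.degree_eq_sum_deg_support hm).symm
  rw [hl]
  ring

/-- A homogeneous polynomial which vanishes on the sphere is zero. -/
lemma eq_zero_of_polyC_eq_zero {l : ℕ} {P : MvPolynomial (Fin 3) ℂ} (hP : P.IsHomogeneous l)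
    (h : polyC P = 0) : P = 0 := by
  have hinf : (Complex.ofReal '' Set.Ioi (0 : ℝ)).Infinite :=
    (Set.Ioi_infinite 0).image Complex.ofReal_injective.injOn
  -- Vectors with positive real coordinates form a product of infinite sets, so vanishing there
  -- suffices; homogeneity scales each of them to the sphere.
  refine funext_set (fun _ => Complex.ofReal '' Set.Ioi (0 : ℝ)) (fun _ => hinf) fun v hv => ?_
  rw [map_zero]
  choose r hr hrv using fun i => hv i (Set.mem_univ i)
  let y : E3 := WithLp.toLp 2 r
  have hy : y ≠ 0 := fun h0 => (hr 0).ne' (congrArg (fun z : E3 => z 0) h0)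
  have hy' : ‖y‖ ≠ 0 := norm_ne_zero_iff.mpr hy
  have hx : ‖y‖⁻¹ • y ∈ Metric.sphere (0 : E3) 1 := by
    rw [mem_sphere_zero_iff_norm, norm_smul, norm_inv, norm_norm, inv_mul_cancel₀ hy']
  have h1 : polyC P ⟨_, hx⟩ = 0 := by rw [h]; rfl
  rw [polyC_apply] at h1
  have h2 := eval_mul_of_isHomogeneous hP (‖y‖ : ℂ) fun i => ((‖y‖⁻¹ • y) i : ℂ)
  rw [h1, mul_zero] at h2
  rw [← h2]
  congr 2
  funext i
  rw [← hrv i, ← Complex.ofReal_mul]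
  change (r i : ℂ) = ((‖y‖ * (‖y‖⁻¹ * r i) : ℝ) : ℂ)
  rw [mul_inv_cancel_left₀ hy']

/-! ### Rotations in coordinate planes -/

/-- The rotation by the angle `θ` in the plane of the coordinates `i` and `j`. -/
noncomputable def planeRotationMatrix (i j : Fin 3) (θ : ℝ) : Matrix (Fin 3) (Fin 3) ℝ :=
  fun a b => if a = i then (if b = i then Real.cos θ else if b = j then -Real.sin θ else 0)
    else if a = j then (if b = i then Real.sin θ else if b = j then Real.cos θ else 0)
    else if a = b then 1 else 0

lemma transpose_mul_planeRotationMatrix {i j : Fin 3} (hij : i < j) (θ : ℝ) :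
    (planeRotationMatrix i j θ).transpose * planeRotationMatrix i j θ = 1 := by
  have h := Real.sin_sq_add_cos_sq θ
  fin_cases i <;> fin_cases j <;> simp at hij <;> ext a b <;> fin_cases a <;> fin_cases b <;>
    simp [planeRotationMatrix, Matrix.mul_apply, Fin.sum_univ_three] <;> nlinarith

lemma hasDerivAt_eval (P : MvPolynomial (Fin 3) ℂ) {γ : ℝ → Fin 3 → ℂ} {γ' : Fin 3 → ℂ} {t : ℝ}
    (hγ : ∀ i, HasDerivAt (fun s => γ s i) (γ' i) t) :
    HasDerivAt (fun s => eval (γ s) P) (∑ i, eval (γ t) (pderiv i P) * γ' i) t := by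
  induction P using MvPolynomial.induction_on with
  | C a => simpa using hasDerivAt_const t a
  | add p q hp hq => simpa [add_mul, Finset.sum_add_distrib] using hp.fun_add hq
  | mul_X p n hp =>
    have h := hp.fun_mul (hγ n)
    simp only [map_mul, eval_X]
    refine h.congr_deriv ?_
    have h1 : ∀ j, eval (γ t) (pderiv j (p * X n)) * γ' j =
        eval (γ t) (pderiv j p) * γ' j * γ t n +
        if j = n then eval (γ t) p * γ' n else 0 := by
      intro j
      rw [pderiv_mul, map_add, map_mul, map_mul, eval_X]
      split_ifs with h
      · subst h
        rw [pderiv_X_self, map_one]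
        ring
      · rw [pderiv_X_of_ne (Ne.symm h), map_zero]
        ring
    simp only [h1, Finset.sum_add_distrib, Finset.sum_ite_eq', Finset.mem_univ, if_true,
      Finset.sum_mul]

/-- `rotGen i j P` is the derivative at angle `0` of `P` composed with the plane rotation. The
integral of that composition does not depend on the angle, and it can be differentiated under the
integral sign because the derivative is bounded by a sup norm. -/
lemma integral_rotGen {i j : Fin 3} (hij : i < j) (P : MvPolynomial (Fin 3) ℂ) :
    ∫ x, polyC (rotGen i j P) x ∂surface = 0 := by
  let g : ℝ → (E3 ≃ₗᵢ[ℝ] E3) := fun θ =>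
    isometryOfMatrix (planeRotationMatrix i j θ) (transpose_mul_planeRotationMatrix hij θ)
  have hg : ∀ θ (x : E3) k, g θ x k = ∑ b, planeRotationMatrix i j θ k b * x b := by
    intro θ x k
    rw [apply_eq_sum, matOf_isometryOfMatrix]
  have hgi : ∀ θ x, g θ x i = Real.cos θ * x i - Real.sin θ * x j := by
    intro θ x
    rw [hg, Fintype.sum_eq_add i j hij.ne]
    · simp [planeRotationMatrix, hij.ne']
      ring
    · rintro k ⟨h1, h2⟩
      simp [planeRotationMatrix, h1, h2]
  have hgj : ∀ θ x, g θ x j = Real.sin θ * x i + Real.cos θ * x j := by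
    intro θ x
    rw [hg, Fintype.sum_eq_add i j hij.ne]
    · simp [planeRotationMatrix, hij.ne']
    · rintro k ⟨h1, h2⟩
      simp [planeRotationMatrix, h1, h2]
  have hgk : ∀ k, k ≠ i → k ≠ j → ∀ θ x, g θ x k = x k := by
    intro k hi hj θ x
    rw [hg, Finset.sum_eq_single k]
    · simp [planeRotationMatrix, hi, hj]
    · intro b _ hb
      simp [planeRotationMatrix, hi, hj, hb.symm]
    · simp
  have hderiv : ∀ (x : S2) θ, HasDerivAt (fun θ => polyC P (actS (g θ) x))
      (polyC (rotGen i j P) (actS (g θ) x)) θ := by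
    intro x θ
    have hγ : ∀ k, HasDerivAt (fun s => ((g s x k : ℝ) : ℂ))
        ((if k = i then -g θ x j else if k = j then g θ x i else 0 : ℝ) : ℂ) θ := by
      intro k
      apply HasDerivAt.ofReal_comp
      split_ifs with h1 h2
      · subst h1
        simp only [hgi, hgj]
        refine (((Real.hasDerivAt_cos θ).mul_const ((x : E3) k)).fun_sub
          ((Real.hasDerivAt_sin θ).mul_const ((x : E3) j))).congr_deriv ?_
        ring
      · subst h2
        simp only [hgi, hgj]
        refine (((Real.hasDerivAt_sin θ).mul_const ((x : E3) i)).fun_add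
          ((Real.hasDerivAt_cos θ).mul_const ((x : E3) k))).congr_deriv ?_
        ring
      · simp only [hgk k h1 h2]
        exact hasDerivAt_const _ _
    have h := hasDerivAt_eval P hγ
    simp only [polyC_apply]
    refine h.congr_deriv ?_
    rw [Fintype.sum_eq_add i j hij.ne]
    · simp [rotGen, hij.ne', actS]
      ring
    · rintro k ⟨h1, h2⟩
      simp [h1, h2]
  have hint : ∀ f : C(S2, ℂ), Integrable f surface := fun f =>
    f.continuous.integrable_of_hasCompactSupport (HasCompactSupport.of_compactSpace f)
  have hcont : ∀ (Q : MvPolynomial (Fin 3) ℂ) θ, Continuous fun x => polyC Q (actS (g θ) x) :=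
    fun Q θ => (polyC Q).continuous.comp (continuous_actS _)
  have key := (hasDerivAt_integral_of_dominated_loc_of_deriv_le (μ := surface) (x₀ := (0 : ℝ))
    (s := Set.univ) (F := fun θ x => polyC P (actS (g θ) x))
    (F' := fun θ x => polyC (rotGen i j P) (actS (g θ) x)) (bound := fun _ => ‖polyC (rotGen i j P)‖)
    Filter.univ_mem (.of_forall fun θ => (hcont P θ).aestronglyMeasurable)
    (hint ⟨_, hcont P 0⟩) (hcont _ 0).aestronglyMeasurable
    (.of_forall fun x θ _ => ContinuousMap.norm_coe_le_norm _ _) (integrable_const _)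
    (.of_forall fun x θ _ => hderiv x θ)).2
  have hconst : (fun θ => ∫ x, polyC P (actS (g θ) x) ∂surface) =
      fun _ => ∫ x, polyC P x ∂surface := by
    funext θ
    have hmp := measurePreserving_actS (g θ)
    rw [← hmp.map_eq, integral_map (continuous_actS _).aemeasurable
      (polyC P).continuous.aestronglyMeasurable, hmp.map_eq]
  rw [hconst] at key
  have h0 := key.unique (hasDerivAt_const _ _)
  have hg0 : ∀ x, actS (g 0) x = x := by
    intro x
    apply Subtype.ext
    apply PiLp.ext
    intro k
    change g 0 x k = (x : E3) k
    by_cases h1 : k = i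
    · subst h1; simp [hgi]
    · by_cases h2 : k = j
      · subst h2; simp [hgj]
      · exact hgk k h1 h2 0 x
  simpa only [hg0] using h0

end PolynomialFunctions

/-! ### Spherical harmonics -/

section SphericalHarmonics

open MvPolynomial
open scoped InnerProductSpace

/-- The harmonic homogeneous polynomials of degree `l`. -/
noncomputable def harmonicPolys (l : ℕ) : Submodule ℂ (MvPolynomial (Fin 3) ℂ) :=
  homogeneousSubmodule (Fin 3) ℂ l ⊓ LinearMap.ker laplacian

lemma mem_harmonicPolys {l : ℕ} {P : MvPolynomial (Fin 3) ℂ} :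
    P ∈ harmonicPolys l ↔ P.IsHomogeneous l ∧ laplacian P = 0 := by
  rw [harmonicPolys, Submodule.mem_inf, mem_homogeneousSubmodule, LinearMap.mem_ker]

/-- The space of spherical harmonics of degree `l`. -/
noncomputable def harmonicSpace (l : ℕ) : Submodule ℂ L2S := (harmonicPolys l).map polyL2

lemma mem_harmonicSpace {l : ℕ} {f : L2S} : f ∈ harmonicSpace l ↔ IsSphericalHarmonic l f := by
  simp only [harmonicSpace, Submodule.mem_map, mem_harmonicPolys, IsSphericalHarmonic, and_assoc,
    laplacian_apply]
  refine exists_congr fun P => and_congr_right fun _ => and_congr_right fun _ => ?_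
  constructor
  · rintro rfl
    filter_upwards [coeFn_polyL2 P] with x hx
    rw [hx, polyC_apply]
  · intro h
    apply Lp.ext
    filter_upwards [coeFn_polyL2 P, h] with x hx h
    rw [hx, h, polyC_apply]

instance finiteDimensional_homogeneousSubmodule (l : ℕ) :
    FiniteDimensional ℂ (homogeneousSubmodule (Fin 3) ℂ l) :=
  Module.Finite.of_fg (homogeneousSubmodule_fg (R := ℂ) (σ := Fin 3) l)

instance finiteDimensional_harmonicSpace (l : ℕ) : FiniteDimensional ℂ (harmonicSpace l) := by
  have : FiniteDimensional ℂ (harmonicPolys l) :=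
    Submodule.finiteDimensional_of_le (inf_le_left : _ ≤ homogeneousSubmodule (Fin 3) ℂ l)
  exact inferInstanceAs (FiniteDimensional ℂ ((harmonicPolys l).map polyL2))

lemma translate_mem_harmonicSpace (g : E3 ≃ₗᵢ[ℝ] E3) {l : ℕ} {f : L2S} (hf : f ∈ harmonicSpace l) :
    translate g f ∈ harmonicSpace l := by
  obtain ⟨P, hP, rfl⟩ := hf
  obtain ⟨h1, h2⟩ := mem_harmonicPolys.mp hP
  rw [translate_polyL2]
  refine ⟨_, mem_harmonicPolys.mpr ⟨isHomogeneous_substMatrix _ h1, ?_⟩, rfl⟩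
  rw [laplacian_substMatrix (mul_eq_one_comm.mp (transpose_mul_matOf _)), h2, map_zero]

lemma star_mem_harmonicSpace {l : ℕ} {f : L2S} (hf : f ∈ harmonicSpace l) :
    star f ∈ harmonicSpace l := by
  obtain ⟨P, hP, rfl⟩ := hf
  obtain ⟨h1, h2⟩ := mem_harmonicPolys.mp hP
  rw [star_polyL2]
  exact ⟨_, mem_harmonicPolys.mpr ⟨h1.map _, by rw [laplacian_map_conj, h2, map_zero]⟩, rfl⟩

/-- The integral of a polynomial over the sphere. -/
noncomputable def sphereIntegral : MvPolynomial (Fin 3) ℂ →ₗ[ℂ] ℂ where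
  toFun P := ∫ x, polyC P x ∂surface
  map_add' P Q := by
    simp only [map_add, ContinuousMap.add_apply]
    exact integral_add
      ((polyC P).continuous.integrable_of_hasCompactSupport (HasCompactSupport.of_compactSpace _))
      ((polyC Q).continuous.integrable_of_hasCompactSupport (HasCompactSupport.of_compactSpace _))
  map_smul' c P := by
    simp only [map_smul, ContinuousMap.smul_apply, RingHom.id_apply]
    exact integral_smul c _

/-- Integration by parts: the Leibniz rule and the vanishing integral of `rotGen i j (P * Q)` make
the generators antisymmetric, hence their squares symmetric. -/
lemma sphereIntegral_rotGen_mul {i j : Fin 3} (hij : i < j) (P Q : MvPolynomial (Fin 3) ℂ) :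
    sphereIntegral (rotGen i j P * Q) = -sphereIntegral (P * rotGen i j Q) := by
  have h : rotGen i j (P * Q) = rotGen i j P * Q + P * rotGen i j Q := by
    simp only [rotGen, pderiv_mul]
    ring
  have h1 : sphereIntegral (rotGen i j (P * Q)) = 0 := integral_rotGen hij _
  rw [h, map_add] at h1
  exact eq_neg_of_add_eq_zero_left h1

lemma sphereIntegral_rotGen_rotGen_mul {i j : Fin 3} (hij : i < j) (P Q : MvPolynomial (Fin 3) ℂ) :
    sphereIntegral (rotGen i j (rotGen i j P) * Q) =
      sphereIntegral (P * rotGen i j (rotGen i j Q)) := by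
  rw [sphereIntegral_rotGen_mul hij, sphereIntegral_rotGen_mul hij, neg_neg]

/-- The two functions are eigenvectors of the same symmetric operator, with eigenvalues `-l(l+1)`
and `-m(m+1)`, and `l(l+1)` is strictly increasing in `l`. -/
lemma inner_eq_zero_of_ne {l m : ℕ} (hlm : l ≠ m) {f h : L2S} (hf : f ∈ harmonicSpace l)
    (hh : h ∈ harmonicSpace m) : ⟪f, h⟫_ℂ = 0 := by
  obtain ⟨P, hP, rfl⟩ := hf
  obtain ⟨Q, hQ, rfl⟩ := hh
  obtain ⟨hP1, hP2⟩ := mem_harmonicPolys.mp hP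
  obtain ⟨hQ1, hQ2⟩ := mem_harmonicPolys.mp hQ
  rw [inner_polyL2]
  change sphereIntegral _ = 0
  have h1 := sum_rotGen_rotGen (hP1.map (starRingEnd ℂ)) (by rw [laplacian_map_conj, hP2, map_zero])
  have h2 := sum_rotGen_rotGen hQ1 hQ2
  set R := map (starRingEnd ℂ) P
  have h3 := congrArg (fun S => sphereIntegral (S * Q)) h1
  have h4 := congrArg (fun S => sphereIntegral (R * S)) h2
  have hc : ∀ (k : ℕ) (S : MvPolynomial (Fin 3) ℂ),
      sphereIntegral (-(k : MvPolynomial (Fin 3) ℂ) * S) = -(k : ℂ) * sphereIntegral S := by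
    intro k S
    rw [neg_mul, ← nsmul_eq_mul, map_neg, map_nsmul, nsmul_eq_mul, neg_mul]
  simp only [add_mul, mul_add, map_add] at h3 h4
  rw [sphereIntegral_rotGen_rotGen_mul (by decide), sphereIntegral_rotGen_rotGen_mul (by decide),
    sphereIntegral_rotGen_rotGen_mul (by decide), h4, mul_left_comm, mul_assoc, hc, hc] at h3
  by_contra hne
  have h5 := mul_right_cancel₀ hne h3
  have h6 := Nat.cast_injective (R := ℂ) (neg_injective h5)
  rcases lt_or_gt_of_ne hlm with h | h <;> nlinarith

lemma inner_eq_zero_of_mem_iSup {m n : ℕ} (hmn : m < n) {f h : L2S} (hh : h ∈ harmonicSpace n)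
    (hf : f ∈ ⨆ k, ⨆ (_ : k ≤ m), harmonicSpace k) : ⟪h, f⟫_ℂ = 0 := by
  have h2 : (⨆ k, ⨆ (_ : k ≤ m), harmonicSpace k) ≤ (harmonicSpace n)ᗮ := by
    refine iSup₂_le fun k hk f hf => ?_
    rw [Submodule.mem_orthogonal]
    exact fun h hh => inner_eq_zero_of_ne (by omega) hh hf
  exact (Submodule.mem_orthogonal _ _).mp (h2 hf) h hh

lemma polyC_sum_sq : polyC (∑ i, X i ^ 2) = 1 := by
  ext x
  rw [polyC_apply]
  have h := EuclideanSpace.real_norm_sq_eq (x : E3)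
  rw [norm_eq_of_mem_sphere, one_pow] at h
  simp only [map_sum, map_pow, eval_X, ContinuousMap.one_apply]
  exact_mod_cast h.symm

lemma laplacian_isHomogeneous {l : ℕ} {P : MvPolynomial (Fin 3) ℂ} (hP : P.IsHomogeneous (l + 2)) :
    (laplacian P).IsHomogeneous l := by
  rw [laplacian_apply]
  exact IsHomogeneous.sum _ _ _ fun i _ => (hP.pderiv (i := i)).pderiv

lemma laplacian_eq_zero_of_lt {l : ℕ} (hl : l < 2) {P : MvPolynomial (Fin 3) ℂ}
    (hP : P.IsHomogeneous l) : laplacian P = 0 := by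
  rw [laplacian_apply]
  refine Finset.sum_eq_zero fun i _ => ?_
  have h := hP.pderiv (i := i)
  rw [show l - 1 = 0 by omega, ← totalDegree_zero_iff_isHomogeneous,
    totalDegree_eq_zero_iff_eq_C] at h
  rw [h, pderiv_C]

/-- On the sphere, a homogeneous polynomial is a sum of spherical harmonics. -/
lemma polyL2_mem_of_isHomogeneous (l : ℕ) {P : MvPolynomial (Fin 3) ℂ} (hP : P.IsHomogeneous l) :
    polyL2 P ∈ ⨆ k, ⨆ (_ : k ≤ l), harmonicSpace k := by
  induction l using Nat.strong_induction_on generalizing P with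
  | _ l ih =>
  have hle : harmonicSpace l ≤ ⨆ k, ⨆ (_ : k ≤ l), harmonicSpace k :=
    le_iSup₂_of_le l le_rfl le_rfl
  rcases lt_or_ge l 2 with hl | hl
  · exact hle ⟨P, mem_harmonicPolys.mpr ⟨hP, laplacian_eq_zero_of_lt hl hP⟩, rfl⟩
  obtain ⟨m, rfl⟩ := Nat.exists_eq_add_of_le' hl
  let s : MvPolynomial (Fin 3) ℂ := ∑ i, X i ^ 2
  have hs : s.IsHomogeneous 2 :=
    IsHomogeneous.sum Finset.univ (fun i => X i ^ 2) 2 fun i _ => isHomogeneous_X_pow i 2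
  have hsmul : ∀ {Q : MvPolynomial (Fin 3) ℂ}, Q.IsHomogeneous m → (s * Q).IsHomogeneous (m + 2) :=
    fun hQ => by rw [add_comm]; exact hs.mul hQ
  have hpoly : ∀ Q, polyL2 (s * Q) = polyL2 Q := fun Q =>
    congrArg (ContinuousMap.toLp 2 surface ℂ) (show polyC (s * Q) = polyC Q by
      rw [map_mul, polyC_sum_sq, one_mul])
  -- `P` is corrected to a harmonic polynomial by subtracting `s * Q`, where `s = |x|²` and `Q`
  -- solves `Δ(s * Q) = Δ P`. On the sphere `s * Q` equals `Q`, which has lower degree.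
  let L : MvPolynomial (Fin 3) ℂ →ₗ[ℂ] MvPolynomial (Fin 3) ℂ :=
    laplacian ∘ₗ LinearMap.mulLeft ℂ s
  have hL : ∀ Q, L Q = laplacian (s * Q) := fun Q => rfl
  have hLmem : ∀ Q ∈ homogeneousSubmodule (Fin 3) ℂ m, L Q ∈ homogeneousSubmodule (Fin 3) ℂ m := by
    intro Q hQ
    rw [mem_homogeneousSubmodule] at hQ ⊢
    rw [hL]
    exact laplacian_isHomogeneous (hsmul hQ)
  clear_value L s
  let T := L.restrict hLmem
  -- If `s * Q` is harmonic, then on the sphere `Q` is a harmonic of degree `m + 2` and, by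
  -- induction, a sum of harmonics of degree at most `m`; so it is orthogonal to itself. Injectivity
  -- gives solvability in finite dimension.
  have hT : Function.Injective T := by
    rw [injective_iff_map_eq_zero]
    rintro ⟨Q, hQ⟩ hTQ
    have hlap : laplacian (s * Q) = 0 := (hL Q).symm.trans (congrArg Subtype.val hTQ)
    have h1 : polyL2 Q ∈ harmonicSpace (m + 2) :=
      ⟨s * Q, mem_harmonicPolys.mpr ⟨hsmul hQ, hlap⟩, hpoly Q⟩
    have h2 := inner_eq_zero_of_mem_iSup (Nat.lt_add_of_pos_right two_pos) h1 (ih m (by omega) hQ)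
    have h3 : polyL2 Q = 0 := (inner_self_eq_zero (𝕜 := ℂ)).mp h2
    exact Subtype.ext (eq_zero_of_polyC_eq_zero hQ ((polyL2_eq_zero_iff Q).mp h3))
  obtain ⟨⟨Q, hQ⟩, hTQ⟩ := LinearMap.injective_iff_surjective.mp hT
    ⟨laplacian P, laplacian_isHomogeneous hP⟩
  have hlap : laplacian (s * Q) = laplacian P := (hL Q).symm.trans (congrArg Subtype.val hTQ)
  have h1 : polyL2 (P - s * Q) ∈ harmonicSpace (m + 2) :=
    ⟨_, mem_harmonicPolys.mpr ⟨hP.sub (hsmul hQ), by rw [map_sub, hlap, sub_self]⟩, rfl⟩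
  have h2 : (⨆ k, ⨆ (_ : k ≤ m), harmonicSpace k) ≤ ⨆ k, ⨆ (_ : k ≤ m + 2), harmonicSpace k :=
    biSup_mono fun k hk => by omega
  have h3 := Submodule.add_mem _ (hle h1) (h2 (ih m (by omega) hQ))
  rwa [map_sub, hpoly, sub_add_cancel] at h3

lemma polyL2_mem_iSup (P : MvPolynomial (Fin 3) ℂ) : polyL2 P ∈ ⨆ k, harmonicSpace k := by
  rw [← sum_homogeneousComponent P, map_sum]
  refine Submodule.sum_mem _ fun l _ => ?_
  have h : (⨆ k, ⨆ (_ : k ≤ l), harmonicSpace k) ≤ ⨆ k, harmonicSpace k :=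
    iSup_mono fun k => iSup_le fun _ => le_rfl
  exact h (polyL2_mem_of_isHomogeneous l (homogeneousComponent_isHomogeneous l P))

/-- The spherical harmonics are complete. -/
lemma topologicalClosure_iSup_harmonicSpace : (⨆ k, harmonicSpace k).topologicalClosure = ⊤ := by
  let A : StarSubalgebra ℂ C(S2, ℂ) :=
    { polyC.range with
      star_mem' := by
        rintro _ ⟨P, rfl⟩
        refine ⟨map (starRingEnd ℂ) P, ?_⟩
        ext x
        exact polyC_map_conj P x }
  -- Stone-Weierstrass: the coordinate functions separate points. Continuous functions are in turn
  -- dense in `L2S`.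
  have hA : A.topologicalClosure = ⊤ := by
    apply ContinuousMap.starSubalgebra_topologicalClosure_eq_top_of_separatesPoints
    intro x y hxy
    have : ∃ i, (x : E3) i ≠ (y : E3) i := by
      by_contra! h
      exact hxy (Subtype.ext (PiLp.ext h))
    obtain ⟨i, hi⟩ := this
    refine ⟨_, ⟨polyC (X i), ⟨X i, rfl⟩, rfl⟩, ?_⟩
    simp only [polyC_apply, eval_X]
    exact_mod_cast hi
  set K := (⨆ k, harmonicSpace k).topologicalClosure with hK
  have hKc : IsClosed (K : Set L2S) := Submodule.isClosed_topologicalClosure _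
  have h1 : ∀ f : C(S2, ℂ), ContinuousMap.toLp 2 surface ℂ f ∈ K := by
    intro f
    have hf : f ∈ closure (A : Set C(S2, ℂ)) := by
      have : f ∈ A.topologicalClosure := by rw [hA]; trivial
      exact this
    have hsub : (A : Set C(S2, ℂ)) ⊆ ContinuousMap.toLp 2 surface ℂ ⁻¹' (K : Set L2S) := by
      rintro _ ⟨P, rfl⟩
      exact Submodule.le_topologicalClosure _ (polyL2_mem_iSup P)
    exact closure_minimal hsub (hKc.preimage (ContinuousLinearMap.continuous _)) hf
  have h2 : DenseRange (ContinuousMap.toLp (E := ℂ) 2 surface ℂ) :=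
    ContinuousMap.toLp_denseRange ℂ surface ℂ (by norm_num)
  rw [eq_top_iff]
  intro f _
  have h3 : closure (Set.range (ContinuousMap.toLp (E := ℂ) 2 surface ℂ)) ⊆ K :=
    closure_minimal (Set.range_subset_iff.mpr h1) hKc
  exact h3 (h2 f)

lemma isHilbertSum_harmonicSpace :
    IsHilbertSum ℂ (fun l => harmonicSpace l) fun l => (harmonicSpace l).subtypeₗᵢ := by
  apply IsHilbertSum.mkInternal
  · intro l m hlm f h
    exact inner_eq_zero_of_ne hlm f.2 h.2
  · exact topologicalClosure_iSup_harmonicSpace.ge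

end SphericalHarmonics

/-! ### Basis functions -/

section BasisFunctions

open scoped InnerProductSpace

variable {G : Subgroup (E3 ≃ₗᵢ[ℝ] E3)} {d e : ℕ}

lemma isBasisFunction_iff {Γ : G →* Matrix (Fin d) (Fin d) ℂ} {f : Fin d → L2S} :
    IsBasisFunction Γ f ↔
      ∀ (g : G) (j : Fin d), translate (g : E3 ≃ₗᵢ[ℝ] E3) (f j) = ∑ k, Γ g k j • f k := by
  have hsum : ∀ (g : G) j, (∑ k, Γ g k j • f k : L2S) =ᵐ[surface]
      fun x => ∑ k, Γ g k j * f k x := by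
    intro g j
    have h1 : ∀ᵐ x ∂surface, ∀ k, (Γ g k j • f k : L2S) x = Γ g k j * f k x := by
      rw [ae_all_iff]
      intro k
      filter_upwards [Lp.coeFn_smul (Γ g k j) (f k)] with x hx
      rw [hx]
      rfl
    filter_upwards [h1, Lp.coeFn_finsetSum Finset.univ (fun k => Γ g k j • f k)] with x h1 h2
    rw [h2, Finset.sum_apply]
    exact Finset.sum_congr rfl fun k _ => h1 k
  constructor
  · intro h g j
    apply Lp.ext
    filter_upwards [coeFn_translate (g : E3 ≃ₗᵢ[ℝ] E3) (f j), h g, hsum g j] with x h1 h2 h3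
    rw [h1, h2, h3]
    rfl
  · intro h g
    rw [ae_all_iff]
    intro j
    filter_upwards [coeFn_translate (g : E3 ≃ₗᵢ[ℝ] E3) (f j), hsum g j] with x h1 h3
    rw [h g j] at h1
    rw [← h1, h3]
    rfl

/-- Translations are isometries, so the matrix `M` of inner products satisfies `M = Γ(g)* M Δ(g)`;
unitarity moves `Γ g` to the other side. Schur's lemma then governs all inner products of basis
functions. -/
lemma intertwines_inner {Γ : G →* Matrix (Fin d) (Fin d) ℂ} {Δ : G →* Matrix (Fin e) (Fin e) ℂ}
    (hΓ : ∀ g, Γ g ∈ Matrix.unitaryGroup (Fin d) ℂ) {f : Fin d → L2S} {h : Fin e → L2S}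
    (hf : IsBasisFunction Γ f) (hh : IsBasisFunction Δ h) (g : G) :
    Γ g * Matrix.of (fun j k => ⟪f j, h k⟫_ℂ) = Matrix.of (fun j k => ⟪f j, h k⟫_ℂ) * Δ g := by
  set M : Matrix (Fin d) (Fin e) ℂ := Matrix.of (fun j k => ⟪f j, h k⟫_ℂ) with hM
  have h1 : M = star (Γ g) * (M * Δ g) := by
    ext j k
    have h2 : M j k = ⟪translate (g : E3 ≃ₗᵢ[ℝ] E3) (f j),
        translate (g : E3 ≃ₗᵢ[ℝ] E3) (h k)⟫_ℂ := ((translate _).inner_map_map _ _).symm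
    rw [h2, isBasisFunction_iff.mp hf, isBasisFunction_iff.mp hh, sum_inner, Matrix.mul_apply]
    refine Finset.sum_congr rfl fun a _ => ?_
    rw [inner_sum, Matrix.mul_apply, Finset.mul_sum]
    refine Finset.sum_congr rfl fun b _ => ?_
    rw [inner_smul_left, inner_smul_right, Matrix.star_apply, hM, Matrix.of_apply, mul_comm (Δ g b k)]
    rfl
  conv_lhs => rw [h1]
  rw [← Matrix.mul_assoc, Matrix.mem_unitaryGroup_iff.mp (hΓ g), Matrix.one_mul]

lemma inner_eq_zero_of_inequivalent {Γ : G →* Matrix (Fin d) (Fin d) ℂ}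
    {Δ : G →* Matrix (Fin e) (Fin e) ℂ} (hΓ : ∀ g, Γ g ∈ Matrix.unitaryGroup (Fin d) ℂ)
    (hΓi : (matRep Γ).IsIrreducible) (hΔi : (matRep Δ).IsIrreducible)
    (hne : ¬ Nonempty ((matRep Δ).Equiv (matRep Γ))) {f : Fin d → L2S} {h : Fin e → L2S}
    (hf : IsBasisFunction Γ f) (hh : IsBasisFunction Δ h) (j : Fin d) (k : Fin e) :
    ⟪f j, h k⟫_ℂ = 0 :=
  congrFun (congrFun (eq_zero_of_intertwines hΓi hΔi hne (intertwines_inner hΓ hf hh)) j) k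

/-- By Schur's lemma the matrix of inner products is scalar, so the inner product of a single pair
of corresponding components decides all the others. -/
lemma exists_inner_eq {Γ : G →* Matrix (Fin d) (Fin d) ℂ}
    (hΓ : ∀ g, Γ g ∈ Matrix.unitaryGroup (Fin d) ℂ) (hΓi : (matRep Γ).IsIrreducible)
    {f h : Fin d → L2S} (hf : IsBasisFunction Γ f) (hh : IsBasisFunction Γ h) :
    ∃ c : ℂ, ∀ j k, ⟪f j, h k⟫_ℂ = if j = k then c else 0 := by
  obtain ⟨c, hc⟩ := eq_smul_one_of_commutes hΓi (intertwines_inner hΓ hf hh)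
  refine ⟨c, fun j k => ?_⟩
  have h1 := congrFun (congrFun hc j) k
  rw [Matrix.smul_apply, Matrix.one_apply, Matrix.of_apply] at h1
  rw [h1]
  split_ifs <;> simp

/-- The basis functions form a complex vector space. -/
noncomputable def basisFunctions (Γ : G →* Matrix (Fin d) (Fin d) ℂ) :
    Submodule ℂ (Fin d → L2S) where
  carrier := {f | IsBasisFunction Γ f}
  add_mem' := by
    intro f h hf hh
    rw [Set.mem_ofPred_eq, isBasisFunction_iff] at *
    intro g j
    simp only [Pi.add_apply, map_add, hf g j, hh g j, smul_add, Finset.sum_add_distrib]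
  zero_mem' := by
    rw [Set.mem_ofPred_eq, isBasisFunction_iff]
    simp
  smul_mem' := by
    intro c f hf
    rw [Set.mem_ofPred_eq, isBasisFunction_iff] at *
    intro g j
    simp only [Pi.smul_apply, map_smul, hf g j, Finset.smul_sum, smul_comm c]

lemma mem_basisFunctions {Γ : G →* Matrix (Fin d) (Fin d) ℂ} {f : Fin d → L2S} :
    f ∈ basisFunctions Γ ↔ IsBasisFunction Γ f := Iff.rfl

lemma star_sum_L2S {ι : Type*} (s : Finset ι) (f : ι → L2S) :
    star (∑ i ∈ s, f i) = ∑ i ∈ s, star (f i) :=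
  map_sum (AddMonoidHom.mk' (star : L2S → L2S) star_add_L2S) f s

lemma IsBasisFunction.star {Γ : G →* Matrix (Fin d) (Fin d) ℂ} (hΓ : ∀ g i j, (Γ g i j).im = 0)
    {f : Fin d → L2S} (hf : IsBasisFunction Γ f) : IsBasisFunction Γ fun j => star (f j) := by
  rw [isBasisFunction_iff] at *
  intro g j
  rw [translate_star, hf g j, star_sum_L2S]
  refine Finset.sum_congr rfl fun k _ => ?_
  rw [star_smul_L2S]
  congr 1
  exact Complex.conj_eq_iff_im.mpr (hΓ g k j)

/-- The harmonic space is stable under `g` and under `g⁻¹`, so its orthogonal complement is stable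
too. -/
lemma translate_starProjection (g : E3 ≃ₗᵢ[ℝ] E3) (l : ℕ) (f : L2S) :
    translate g ((harmonicSpace l).starProjection f) =
      (harmonicSpace l).starProjection (translate g f) := by
  refine (Submodule.eq_starProjection_of_mem_of_inner_eq_zero
    (translate_mem_harmonicSpace g (Submodule.starProjection_apply_mem _ _)) fun h hh => ?_).symm
  have h1 : h = translate g (translate g⁻¹ h) := by
    rw [← translate_mul, mul_inv_cancel, translate_one]
  rw [h1, ← map_sub, (translate g).inner_map_map]
  exact Submodule.starProjection_inner_eq_zero _ _ (translate_mem_harmonicSpace g⁻¹ hh)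

lemma IsBasisFunction.starProjection {Γ : G →* Matrix (Fin d) (Fin d) ℂ} {f : Fin d → L2S}
    (hf : IsBasisFunction Γ f) (l : ℕ) :
    IsBasisFunction Γ fun j => (harmonicSpace l).starProjection (f j) := by
  rw [isBasisFunction_iff] at *
  intro g j
  rw [translate_starProjection, hf g j, map_sum]
  exact Finset.sum_congr rfl fun k _ => map_smul _ _ _

lemma hasSum_starProjection (f : L2S) :
    HasSum (fun l => (harmonicSpace l).starProjection f) f := by
  obtain ⟨w, hw⟩ := isHilbertSum_harmonicSpace.surjective_isometry f
  have h1 := isHilbertSum_harmonicSpace.OrthogonalFamily.hasSum_linearIsometry w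
  rw [hw] at h1
  have h2 : ∀ l, (harmonicSpace l).starProjection f = (w l : L2S) := by
    intro l
    refine Submodule.eq_starProjection_of_mem_of_inner_eq_zero (w l).2 fun h hh => ?_
    have h3 : HasSum (fun m => ⟪(w m : L2S), h⟫_ℂ) ⟪f, h⟫_ℂ :=
      h1.map (innerSLFlip ℂ h) (innerSLFlip ℂ h).continuous
    have h4 := h3.unique (hasSum_single l fun m hm => inner_eq_zero_of_ne hm (w m).2 hh)
    rw [inner_sub_left, h4, sub_self]
  simp only [h2]
  exact h1

end BasisFunctions

/-! ### Real orthonormal systems -/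

section RealSystems

open scoped InnerProductSpace

/-- A finite-dimensional subspace which is stable under a conjugation has an orthonormal basis of
vectors which are fixed by the conjugation. -/
lemma exists_orthonormal_fixed {E : Type*} [NormedAddCommGroup E] [InnerProductSpace ℂ E]
    (W : Submodule ℂ E) [FiniteDimensional ℂ W] (σ : E → E) (hadd : ∀ x y, σ (x + y) = σ x + σ y)
    (hsmul : ∀ (c : ℂ) x, σ (c • x) = star c • σ x) (hσ : ∀ x, σ (σ x) = x)
    (hinner : ∀ x y, ⟪σ x, σ y⟫_ℂ = star ⟪x, y⟫_ℂ) (hW : ∀ x ∈ W, σ x ∈ W) :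
    ∃ (n : ℕ) (b : Fin n → E), Orthonormal ℂ b ∧ (∀ i, b i ∈ W ∧ σ (b i) = b i) ∧
      ∀ x ∈ W, x = ∑ i, ⟪b i, x⟫_ℂ • b i := by
  let S : Submodule ℝ E :=
    { carrier := {x | x ∈ W ∧ σ x = x}
      add_mem' := fun {x y} hx hy => ⟨W.add_mem hx.1 hy.1, by rw [hadd, hx.2, hy.2]⟩
      zero_mem' := ⟨W.zero_mem, by simpa using hsmul 0 0⟩
      smul_mem' := fun r x hx => by
        rw [← Complex.coe_smul]
        exact ⟨W.smul_mem _ hx.1, by rw [hsmul, hx.2]; simp⟩ }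
  have hSW : S ≤ W.restrictScalars ℝ := fun x hx => hx.1
  have : FiniteDimensional ℝ (W.restrictScalars ℝ) :=
    inferInstanceAs (FiniteDimensional ℝ W)
  have : FiniteDimensional ℝ S := Submodule.finiteDimensional_of_le hSW
  obtain ⟨n, b, hb, hbS, hexp⟩ := exists_orthonormal_of_real_inner S fun x hx y hy => by
    rw [← Complex.conj_eq_iff_im]
    have := hinner x y
    rw [hx.2, hy.2] at this
    exact this.symm
  refine ⟨n, b, hb, hbS, fun x hx => ?_⟩
  have h1 : x + σ x ∈ S := ⟨W.add_mem hx (hW x hx), by rw [hadd, hσ, add_comm]⟩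
  -- The difference `x - σ x` changes sign under `σ`; the factor `I` makes it fixed. Thus `x` is a
  -- complex combination of two fixed vectors.
  have h2 : Complex.I • (x - σ x) ∈ S := by
    refine ⟨W.smul_mem _ (W.sub_mem hx (hW x hx)), ?_⟩
    have h3 : σ (-σ x) = -x := by
      have := hsmul (-1) (σ x)
      rwa [hσ, neg_one_smul, star_neg, star_one, neg_one_smul] at this
    rw [hsmul, sub_eq_add_neg, hadd, h3]
    simp only [RCLike.star_def, Complex.conj_I, neg_smul, ← smul_neg]
    congr 1
    abel
  have h3 : x = (1 / 2 : ℂ) • (x + σ x) + (-Complex.I / 2) • (Complex.I • (x - σ x)) := by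
    rw [smul_smul, show -Complex.I / 2 * Complex.I = 1 / 2 by
      rw [div_mul_eq_mul_div, neg_mul, Complex.I_mul_I, neg_neg]]
    rw [← smul_add, add_add_sub_cancel, ← two_smul ℂ x, smul_smul]
    norm_num
  have hlin : ∀ (a c : ℂ) (y z : E), y = ∑ i, ⟪b i, y⟫_ℂ • b i → z = ∑ i, ⟪b i, z⟫_ℂ • b i →
      a • y + c • z = ∑ i, ⟪b i, a • y + c • z⟫_ℂ • b i := by
    intro a c y z hy hz
    simp only [inner_add_right, inner_smul_right, add_smul, Finset.sum_add_distrib, mul_smul,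
      ← Finset.smul_sum]
    rw [← hy, ← hz]
  rw [h3]
  exact hlin _ _ _ _ (hexp _ h1) (hexp _ h2)

variable {G : Subgroup (E3 ≃ₗᵢ[ℝ] E3)} {d : ℕ}

/-- For a real irreducible representation, the basis functions made of spherical harmonics of a
given degree are spanned by an orthonormal system of real ones. -/
lemma exists_real_basisFunctions {Γ : G →* Matrix (Fin d) (Fin d) ℂ}
    (hΓ : ∀ g, Γ g ∈ Matrix.unitaryGroup (Fin d) ℂ) (hΓi : (matRep Γ).IsIrreducible)
    (hΓr : ∀ g i j, (Γ g i j).im = 0) (l : ℕ) :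
    ∃ (N : ℕ) (I : Fin N → Fin d → L2S), (∀ n, IsBasisFunction Γ (I n)) ∧
      (∀ n j, I n j ∈ harmonicSpace l) ∧ (∀ n j, IsRealValued (I n j)) ∧
      (∀ n m j k, ⟪I n j, I m k⟫_ℂ = if n = m ∧ j = k then 1 else 0) ∧
      ∀ f, IsBasisFunction Γ f → (∀ j, f j ∈ harmonicSpace l) →
        ∃ c : Fin N → ℂ, ∀ j, f j = ∑ n, c n • I n j := by
  have hd : 0 < d := Nat.pos_of_ne_zero (dim_ne_zero hΓi)
  let o : Fin d := ⟨0, hd⟩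
  let B : Submodule ℂ (Fin d → L2S) :=
    basisFunctions Γ ⊓ Submodule.pi Set.univ fun _ => harmonicSpace l
  have hB : ∀ f, f ∈ B ↔ IsBasisFunction Γ f ∧ ∀ j, f j ∈ harmonicSpace l := by
    intro f
    simp [B, Submodule.mem_inf, mem_basisFunctions, Submodule.mem_pi]
  have hBstar : ∀ f ∈ B, (fun j => star (f j)) ∈ B := fun f hf =>
    (hB _).mpr ⟨((hB f).mp hf).1.star hΓr, fun j => star_mem_harmonicSpace (((hB f).mp hf).2 j)⟩
  -- All components of a basis function have the same norm, so one vanishing component forces the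
  -- others to vanish.
  have hinj : ∀ f ∈ B, f o = 0 → f = 0 := by
    intro f hf h0
    obtain ⟨c, hc⟩ := exists_inner_eq hΓ hΓi ((hB f).mp hf).1 ((hB f).mp hf).1
    have hc0 : c = 0 := by simpa [h0] using (hc o o).symm
    funext j
    have := hc j j
    rw [hc0, ite_self] at this
    exact inner_self_eq_zero.mp this
  have heq : ∀ f ∈ B, ∀ h ∈ B, f o = h o → f = h := fun f hf h hh hfh =>
    sub_eq_zero.mp (hinj _ (B.sub_mem hf hh) (by rw [Pi.sub_apply, hfh, sub_self]))
  -- A real orthonormal basis is chosen among the `o`-th components only; `heq` and Schur's lemma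
  -- carry reality and orthonormality to the rest.
  let W : Submodule ℂ L2S := B.map (LinearMap.proj o)
  have hWle : W ≤ harmonicSpace l := by
    rintro _ ⟨f, hf, rfl⟩
    exact ((hB f).mp hf).2 o
  have : FiniteDimensional ℂ W := Submodule.finiteDimensional_of_le hWle
  obtain ⟨N, b, hb, hbW, hexp⟩ := exists_orthonormal_fixed W (star : L2S → L2S) star_add_L2S
    star_smul_L2S star_star inner_star_star (by
      rintro _ ⟨f, hf, rfl⟩
      exact ⟨_, hBstar f hf, rfl⟩)
  choose I hIB hIb using fun n => (hbW n).1
  replace hIb : ∀ n, I n o = b n := hIb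
  refine ⟨N, I, fun n => ((hB _).mp (hIB n)).1, fun n => ((hB _).mp (hIB n)).2, ?_, ?_, ?_⟩
  · intro n j
    rw [isRealValued_iff]
    refine congrFun (heq _ (hBstar _ (hIB n)) _ (hIB n) ?_) j
    rw [hIb, (hbW n).2]
  · intro n m j k
    obtain ⟨c, hc⟩ := exists_inner_eq hΓ hΓi ((hB _).mp (hIB n)).1 ((hB _).mp (hIB m)).1
    have h1 : (if n = m then 1 else 0) = c := by
      rw [← orthonormal_iff_ite.mp hb n m, ← hIb, ← hIb, hc, if_pos rfl]
    rw [hc, ← h1]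
    by_cases hn : n = m <;> by_cases hj : j = k <;> simp [hn, hj]
  · intro f hf hfl
    refine ⟨fun n => ⟪b n, f o⟫_ℂ, ?_⟩
    have hfB := (hB f).mpr ⟨hf, hfl⟩
    have h1 : f = ∑ n, ⟪b n, f o⟫_ℂ • I n := by
      refine heq f hfB _ (B.sum_mem fun n _ => B.smul_mem _ (hIB n)) ?_
      rw [Finset.sum_apply]
      simp only [Pi.smul_apply, hIb]
      exact hexp _ ⟨f, hfB, rfl⟩
    intro j
    conv_lhs => rw [h1]
    rw [Finset.sum_apply]
    rfl

/-- For every complete list of irreducible representations there is a real orthonormal system of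
basis functions made of spherical harmonics, which spans the isotypic subspaces of the
representations with real matrices. -/
theorem exists_real_system {r : ℕ} (A : IrrepList G r) :
    ∃ (N : Fin r → ℕ → ℕ) (I : ∀ p, (Σ l, Fin (N p l)) → Fin (A.d p) → L2S),
      IsRealOrthonormalBasisSystem A I ∧
      (∀ p l n j, IsSphericalHarmonic l (I p ⟨l, n⟩ j)) ∧
      ∀ p, (∀ g i j, (A.Γ p g i j).im = 0) → closedSpanAt I p = isotypic (A.Γ p) := by
  have key : ∀ p l, ∃ (N : ℕ) (I : Fin N → Fin (A.d p) → L2S), (∀ n, IsBasisFunction (A.Γ p) (I n)) ∧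
      (∀ n j, I n j ∈ harmonicSpace l) ∧ (∀ n j, IsRealValued (I n j)) ∧
      (∀ n m j k, ⟪I n j, I m k⟫_ℂ = if n = m ∧ j = k then 1 else 0) ∧
      ((∀ g i j, (A.Γ p g i j).im = 0) → ∀ f, IsBasisFunction (A.Γ p) f →
        (∀ j, f j ∈ harmonicSpace l) → ∃ c : Fin N → ℂ, ∀ j, f j = ∑ n, c n • I n j) := by
    intro p l
    -- Representations whose matrices are not all real receive the empty family, `N = 0`.
    by_cases hr : ∀ g i j, (A.Γ p g i j).im = 0
    · obtain ⟨N, I, h1, h2, h3, h4, h5⟩ :=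
        exists_real_basisFunctions (A.unitary p) (A.irreducible p) hr l
      exact ⟨N, I, h1, h2, h3, h4, fun _ => h5⟩
    · exact ⟨0, fun n => n.elim0, fun n => n.elim0, fun n => n.elim0, fun n => n.elim0,
        fun n => n.elim0, fun h => absurd h hr⟩
  choose N I hbasis hharm hreal horth hspan using key
  refine ⟨N, fun p z => I p z.1 z.2, ⟨fun p z => hreal p z.1 z.2, fun p z => hbasis p z.1 z.2, ?_⟩,
    fun p l n j => mem_harmonicSpace.mp (hharm p l n j), fun p hr => ?_⟩
  · classical
    rw [orthonormal_iff_ite]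
    rintro ⟨p, ⟨l, n⟩, j⟩ ⟨q, ⟨m, n'⟩, k⟩
    by_cases hpq : p = q
    · subst hpq
      by_cases hlm : l = m
      · subst hlm
        simp only [horth]
        congr 1
        simp
      · simp only
        rw [inner_eq_zero_of_ne hlm (hharm p l n j) (hharm p m n' k), if_neg]
        intro h
        simp only [Sigma.mk.injEq, heq_eq_eq, Prod.mk.injEq, true_and] at h
        exact hlm h.1.1
    · simp only
      rw [inner_eq_zero_of_inequivalent (A.unitary p) (A.irreducible p) (A.irreducible q) _
        (hbasis p l n) (hbasis q m n') j k, if_neg]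
      · exact fun h => hpq (congrArg Sigma.fst h)
      · exact fun h => hpq (A.inequivalent _ _ h).symm
  · apply le_antisymm
    · refine Submodule.topologicalClosure_mono (Submodule.span_mono ?_)
      rintro _ ⟨z, j, rfl⟩
      exact ⟨_, hbasis p z.1 z.2, j, rfl⟩
    · refine Submodule.topologicalClosure_minimal _ ?_ (Submodule.isClosed_topologicalClosure _)
      refine Submodule.span_le.mpr ?_
      rintro _ ⟨f, hf, j, rfl⟩
      -- A basis function is the sum of its degree `l` parts, which are again basis functions and
      -- hence combinations of the chosen ones.
      refine (Submodule.isClosed_topologicalClosure _).mem_of_tendsto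
        (hasSum_starProjection (f j)) (.of_forall fun s => Submodule.sum_mem _ fun l _ => ?_)
      obtain ⟨c, hc⟩ := hspan p l hr _ (hf.starProjection l)
        fun j => Submodule.starProjection_apply_mem _ _
      refine Submodule.le_topologicalClosure _ ?_
      rw [hc j]
      exact Submodule.sum_mem _ fun n _ =>
        Submodule.smul_mem _ _ (Submodule.subset_span ⟨⟨l, n⟩, j, rfl⟩)

end RealSystems

/-! ### Completeness of the isotypic subspaces -/

section Completeness

open scoped InnerProductSpace

variable {G : Subgroup (E3 ≃ₗᵢ[ℝ] E3)}

lemma translate_mem_isotypic {d : ℕ} {Γ : G →* Matrix (Fin d) (Fin d) ℂ} (g : G) {f : L2S}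
    (hf : f ∈ isotypic Γ) : translate (g : E3 ≃ₗᵢ[ℝ] E3) f ∈ isotypic Γ := by
  have hcl : IsClosed (isotypic Γ : Set L2S) := Submodule.isClosed_topologicalClosure _
  have h1 : isotypic Γ ≤ (isotypic Γ).comap (translate (g : E3 ≃ₗᵢ[ℝ] E3)).toLinearMap := by
    refine Submodule.topologicalClosure_minimal _ (Submodule.span_le.mpr ?_)
      (hcl.preimage (translate (g : E3 ≃ₗᵢ[ℝ] E3)).continuous)
    rintro _ ⟨f, hf, j, rfl⟩
    refine Submodule.le_topologicalClosure _ ?_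
    change translate (g : E3 ≃ₗᵢ[ℝ] E3) (f j) ∈ _
    rw [isBasisFunction_iff.mp hf]
    exact Submodule.sum_mem _ fun k _ =>
      Submodule.smul_mem _ _ (Submodule.subset_span ⟨f, hf, k, rfl⟩)
  exact h1 hf

/-- A nonzero finite-dimensional invariant subspace contains the components of a nonzero basis
function for one of the representations of a complete list. -/
lemma exists_basisFunction_mem {r : ℕ} (A : IrrepList G r) (F : Submodule ℂ L2S)
    [FiniteDimensional ℂ F] (hF : F ≠ ⊥)
    (hinv : ∀ g : G, ∀ f ∈ F, translate (g : E3 ≃ₗᵢ[ℝ] E3) f ∈ F) :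
    ∃ p, ∃ f : Fin (A.d p) → L2S, IsBasisFunction (A.Γ p) f ∧ (∀ j, f j ∈ F) ∧ f ≠ 0 := by
  classical
  -- A nonzero invariant subspace of least dimension will be irreducible.
  let Q : ℕ → Prop := fun n => ∃ S : Submodule ℂ L2S, S ≤ F ∧ S ≠ ⊥ ∧
    (∀ g : G, ∀ f ∈ S, translate (g : E3 ≃ₗᵢ[ℝ] E3) f ∈ S) ∧ Module.finrank ℂ S = n
  have hQ : ∃ n, Q n := ⟨_, F, le_rfl, hF, hinv, rfl⟩
  obtain ⟨S, hSF, hS0, hSinv, hSn⟩ := Nat.find_spec hQ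
  set n := Nat.find hQ
  have hmin : ∀ T : Submodule ℂ L2S, T ≤ F → T ≠ ⊥ →
      (∀ g : G, ∀ f ∈ T, translate (g : E3 ≃ₗᵢ[ℝ] E3) f ∈ T) → n ≤ Module.finrank ℂ T :=
    fun T h1 h2 h3 => Nat.find_min' hQ ⟨T, h1, h2, h3, rfl⟩
  have : FiniteDimensional ℂ S := Submodule.finiteDimensional_of_le hSF
  let b : Module.Basis (Fin n) ℂ S := Module.finBasisOfFinrankEq ℂ S hSn
  let ρ : G →* Module.End ℂ S :=
    { toFun := fun g => (translate (g : E3 ≃ₗᵢ[ℝ] E3)).toLinearMap.restrict (hSinv g)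
      map_one' := by
        refine LinearMap.ext fun f => Subtype.ext ?_
        exact translate_one (f : L2S)
      map_mul' := fun g h => by
        refine LinearMap.ext fun f => Subtype.ext ?_
        exact translate_mul (g : E3 ≃ₗᵢ[ℝ] E3) (h : E3 ≃ₗᵢ[ℝ] E3) (f : L2S) }
  let Δ : G →* Matrix (Fin n) (Fin n) ℂ :=
    (LinearMap.toMatrixAlgEquiv b).toAlgHom.toMonoidHom.comp ρ
  let Φ : (Fin n → ℂ) →ₗ[ℂ] L2S := S.subtype ∘ₗ b.equivFun.symm.toLinearMap
  have hΦinj : Function.Injective Φ :=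
    Subtype.val_injective.comp b.equivFun.symm.injective
  have hΦS : ∀ v, Φ v ∈ S := fun v => (b.equivFun.symm v).2
  have hΦ : ∀ (g : G) v, translate (g : E3 ≃ₗᵢ[ℝ] E3) (Φ v) = Φ (matRep Δ g v) := by
    intro g v
    change ((ρ g (b.equivFun.symm v) : S) : L2S) = ((b.equivFun.symm ((Δ g).mulVec v) : S) : L2S)
    congr 1
    rw [LinearEquiv.eq_symm_apply]
    have h1 := LinearMap.toMatrix_mulVec_repr b b (ρ g) (b.equivFun.symm v)
    have h2 : (b.repr (b.equivFun.symm v) : Fin n → ℂ) = v := b.equivFun.apply_symm_apply v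
    rw [h2] at h1
    exact h1.symm
  have hn : 0 < n := by
    rw [← hSn]
    have : Nontrivial S := Submodule.nontrivial_iff_ne_bot.mpr hS0
    exact Module.finrank_pos
  have hΔ : (matRep Δ).IsIrreducible := by
    refine { exists_pair_ne := ⟨⊥, ⊤, fun h => ?_⟩, eq_bot_or_eq_top := fun T => ?_ }
    · have h1 : (⊥ : Submodule ℂ (Fin n → ℂ)) = ⊤ := congrArg Subrepresentation.toSubmodule h
      have : Nonempty (Fin n) := ⟨⟨0, hn⟩⟩
      exact bot_ne_top h1
    · by_cases hT : T.toSubmodule = ⊥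
      · exact Or.inl (Subrepresentation.toSubmodule_injective hT)
      · right
        apply Subrepresentation.toSubmodule_injective
        have h1 : n ≤ Module.finrank ℂ (T.toSubmodule.map Φ) := by
          refine hmin _ ?_ ?_ ?_
          · rintro _ ⟨v, _, rfl⟩
            exact hSF (hΦS v)
          · exact fun h => hT (Submodule.map_injective_of_injective hΦinj
              (h.trans (Submodule.map_bot Φ).symm))
          · rintro g _ ⟨v, hv, rfl⟩
            rw [hΦ]
            exact Submodule.mem_map_of_mem (T.apply_mem_toSubmodule g hv)
        rw [← (Submodule.equivMapOfInjective Φ hΦinj _).finrank_eq] at h1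
        refine Submodule.eq_top_of_finrank_eq (le_antisymm (Submodule.finrank_le _) ?_)
        rwa [Module.finrank_fin_fun]
  obtain ⟨p, ⟨e⟩⟩ := A.exhaustive n Δ hΔ
  -- The images of the standard basis under the equivalence transform by the columns of `Γ p g`, as
  -- required of a basis function.
  refine ⟨p, fun j => Φ (e (Pi.single j 1)), ?_, fun j => hSF (hΦS _), fun h0 => ?_⟩
  · rw [isBasisFunction_iff]
    intro g j
    have h0 : e (matRep (A.Γ p) g (Pi.single j 1)) = matRep Δ g (e (Pi.single j 1)) :=
      Representation.IntertwiningMap.isIntertwining _ _ e.toIntertwiningMap g (Pi.single j 1)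
    rw [hΦ, ← h0, matRep_apply, Matrix.mulVec_single_one]
    have h1 : (A.Γ p g).col j = ∑ k, A.Γ p g k j • Pi.single k (1 : ℂ) := by
      rw [pi_eq_sum_univ ((A.Γ p g).col j)]
      refine Finset.sum_congr rfl fun k _ => ?_
      rw [Matrix.col_apply]
      congr 1
      funext i
      simp [Pi.single_apply, eq_comm]
    rw [h1]
    simp only [map_sum, map_smul]
  · have hd : 0 < A.d p := Nat.pos_of_ne_zero (dim_ne_zero (A.irreducible p))
    have h1 : Φ (e (Pi.single ⟨0, hd⟩ 1)) = Φ (e 0) := by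
      rw [map_zero, map_zero]
      exact congrFun h0 ⟨0, hd⟩
    have h2 := congrFun (e.toLinearEquiv.injective (hΦinj h1)) ⟨0, hd⟩
    simp at h2

/-- The isotypic subspaces together are complete. -/
theorem topologicalClosure_iSup_isotypic [Finite G] {r : ℕ} (A : IrrepList G r) :
    (⨆ p, isotypic (A.Γ p)).topologicalClosure = ⊤ := by
  set K := (⨆ p, isotypic (A.Γ p)).topologicalClosure with hK
  have hKc : IsClosed (K : Set L2S) := Submodule.isClosed_topologicalClosure _
  have : CompleteSpace K := hKc.completeSpace_coe
  have hle : ∀ p, isotypic (A.Γ p) ≤ K := fun p =>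
    (le_iSup (fun p => isotypic (A.Γ p)) p).trans (Submodule.le_topologicalClosure _)
  have hKinv : ∀ (g : G), ∀ f ∈ K, translate (g : E3 ≃ₗᵢ[ℝ] E3) f ∈ K := by
    intro g
    have h1 : K ≤ K.comap (translate (g : E3 ≃ₗᵢ[ℝ] E3)).toLinearMap := by
      refine Submodule.topologicalClosure_minimal _ (iSup_le fun p f hf => ?_)
        (hKc.preimage (translate (g : E3 ≃ₗᵢ[ℝ] E3)).continuous)
      exact hle p (translate_mem_isotypic g hf)
    exact fun f hf => h1 hf
  have hKoinv : ∀ (g : G), ∀ f ∈ Kᗮ, translate (g : E3 ≃ₗᵢ[ℝ] E3) f ∈ Kᗮ := by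
    intro g f hf
    rw [Submodule.mem_orthogonal] at hf ⊢
    intro u hu
    have h1 : u = translate (g : E3 ≃ₗᵢ[ℝ] E3) (translate ((g⁻¹ : G) : E3 ≃ₗᵢ[ℝ] E3) u) := by
      rw [← translate_mul, ← Subgroup.coe_mul, mul_inv_cancel, Subgroup.coe_one, translate_one]
    rw [h1, (translate _).inner_map_map]
    exact hf _ (hKinv _ _ hu)
  rw [← Submodule.orthogonal_eq_bot_iff]
  by_contra hne
  obtain ⟨f, hf, hf0⟩ := Submodule.exists_mem_ne_zero_of_ne_bot hne
  -- Since `G` is finite, the orbit of `f` spans a finite-dimensional invariant subspace of the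
  -- complement.
  let F : Submodule ℂ L2S :=
    Submodule.span ℂ (Set.range fun g : G => translate (g : E3 ≃ₗᵢ[ℝ] E3) f)
  have hFK : F ≤ Kᗮ := Submodule.span_le.mpr (Set.range_subset_iff.mpr fun g => hKoinv g f hf)
  have : FiniteDimensional ℂ F := FiniteDimensional.span_of_finite ℂ (Set.finite_range _)
  have hF0 : F ≠ ⊥ := fun h => hf0 <| (Submodule.eq_bot_iff F).mp h f
    (Submodule.subset_span ⟨1, translate_one f⟩)
  have hFinv : ∀ g : G, ∀ h ∈ F, translate (g : E3 ≃ₗᵢ[ℝ] E3) h ∈ F := by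
    intro g
    have h1 : F ≤ F.comap (translate (g : E3 ≃ₗᵢ[ℝ] E3)).toLinearMap := by
      refine Submodule.span_le.mpr (Set.range_subset_iff.mpr fun h => ?_)
      change translate (g : E3 ≃ₗᵢ[ℝ] E3) (translate (h : E3 ≃ₗᵢ[ℝ] E3) f) ∈ F
      rw [← translate_mul]
      exact Submodule.subset_span ⟨g * h, rfl⟩
    exact fun h hh => h1 hh
  obtain ⟨p, h, hh, hhF, hh0⟩ := exists_basisFunction_mem A F hF0 hFinv
  apply hh0
  funext j
  have h1 : h j ∈ K := hle p (Submodule.le_topologicalClosure _ (Submodule.subset_span ⟨h, hh, j, rfl⟩))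
  exact inner_self_eq_zero.mp ((Submodule.mem_orthogonal _ _).mp (hFK (hhF j)) _ h1)

end Completeness

/-! ### Coordinates in the golden field -/

section Golden

/-- The field `ℚ(φ)`, where `φ` is the golden ratio. -/
abbrev GoldenField : Type := QuadraticAlgebra ℚ 1 1

/-- The embedding of `ℚ(φ)` into the real numbers. -/
noncomputable def goldenToReal : GoldenField →+* ℝ :=
  (QuadraticAlgebra.lift ⟨Real.goldenRatio, by
    rw [one_smul, one_smul, ← sq, Real.goldenRatio_sq, add_comm]⟩ : GoldenField →ₐ[ℚ] ℝ).toRingHom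

lemma goldenToReal_apply (x : GoldenField) :
    goldenToReal x = x.re + x.im * Real.goldenRatio := by
  simp [goldenToReal, QuadraticAlgebra.lift, Algebra.smul_def]

lemma goldenToReal_injective : Function.Injective goldenToReal := by
  rw [injective_iff_map_eq_zero]
  intro x hx
  rw [goldenToReal_apply] at hx
  have h0 : x.im = 0 := by
    by_contra h
    have := (Real.goldenRatio_irrational.ratCast_mul h).ratCast_add x.re
    rw [hx] at this
    exact not_irrational_zero this
  rw [h0, Rat.cast_zero, zero_mul, add_zero, Rat.cast_eq_zero] at hx
  exact QuadraticAlgebra.ext hx h0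

end Golden

/-! ### Rotation groups of finite sets of vertices -/

section Frames

open Matrix

variable {m : ℕ}

/-- The points of `E3` with the given coordinates in `ℚ(φ)`. -/
noncomputable def vertexSet (v : Fin m → Fin 3 → GoldenField) : Set E3 :=
  Set.range fun i => WithLp.toLp 2 (goldenToReal ∘ v i)

/-- The matrix with columns `v i`, `v j`, `v k`, multiplied by `R`. -/
def frameMatrix (v : Fin m → Fin 3 → GoldenField) (R : Matrix (Fin 3) (Fin 3) GoldenField)
    (i j k : Fin m) : Matrix (Fin 3) (Fin 3) GoldenField :=
  Matrix.of fun a b => v i a * R 0 b + v j a * R 1 b + v k a * R 2 b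

lemma triple_product_mulVec (M : Matrix (Fin 3) (Fin 3) ℝ) (hM : M.det = 1) (x y z : Fin 3 → ℝ) :
    (M *ᵥ x) ⬝ᵥ ((M *ᵥ y) ⨯₃ (M *ᵥ z)) = x ⬝ᵥ (y ⨯₃ z) := by
  rw [triple_product_eq_det, triple_product_eq_det]
  have h : Matrix.of ![M *ᵥ x, M *ᵥ y, M *ᵥ z] = Matrix.of ![x, y, z] * Mᵀ := by
    ext a b
    fin_cases a <;> simp [Matrix.mul_apply, Matrix.mulVec, dotProduct, mul_comm]
  have h2 := congrArg Matrix.det h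
  rw [Matrix.det_mul, Matrix.det_transpose, hM, mul_one] at h2
  exact h2

lemma goldenToReal_dotProduct (x y : Fin 3 → GoldenField) :
    goldenToReal (x ⬝ᵥ y) = (goldenToReal ∘ x) ⬝ᵥ (goldenToReal ∘ y) := by
  simp [dotProduct]

lemma goldenToReal_cross (x y : Fin 3 → GoldenField) :
    goldenToReal ∘ (x ⨯₃ y) = (goldenToReal ∘ x) ⨯₃ (goldenToReal ∘ y) := by
  ext a
  fin_cases a <;> simp [cross_apply]

/-- A rotation permuting the vertices preserves dot products and the oriented volume, and it is
recovered from the images of three independent vertices because `R` inverts the matrix with these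
columns. This confines the group to finitely many explicit matrices over a field with decidable
equality. -/
lemma exists_frameMatrix (v : Fin m → Fin 3 → GoldenField)
    {R : Matrix (Fin 3) (Fin 3) GoldenField} {p q r : Fin m} (hR : frameMatrix v R p q r = 1)
    {M : Matrix (Fin 3) (Fin 3) ℝ} (hM : Mᵀ * M = 1) (hdet : M.det = 1)
    (hv : ∀ i, ∃ j, M *ᵥ (goldenToReal ∘ v i) = goldenToReal ∘ v j) :
    ∃ i j k, v i ⬝ᵥ v j = v p ⬝ᵥ v q ∧ v i ⬝ᵥ v k = v p ⬝ᵥ v r ∧ v j ⬝ᵥ v k = v q ⬝ᵥ v r ∧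
      v i ⬝ᵥ (v j ⨯₃ v k) = v p ⬝ᵥ (v q ⨯₃ v r) ∧
      M = (frameMatrix v R i j k).map goldenToReal := by
  choose π hπ using hv
  have hdot : ∀ i j, v (π i) ⬝ᵥ v (π j) = v i ⬝ᵥ v j := by
    intro i j
    apply goldenToReal_injective
    rw [goldenToReal_dotProduct, goldenToReal_dotProduct, ← hπ, ← hπ, Matrix.dotProduct_mulVec,
      Matrix.vecMul_mulVec, hM, Matrix.vecMul_one]
  refine ⟨π p, π q, π r, hdot _ _, hdot _ _, hdot _ _, ?_, ?_⟩
  · apply goldenToReal_injective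
    rw [goldenToReal_dotProduct, goldenToReal_dotProduct, goldenToReal_cross, goldenToReal_cross,
      ← hπ, ← hπ, ← hπ, triple_product_mulVec M hdet]
  · ext a b
    have h1 : M = M * (frameMatrix v R p q r).map goldenToReal := by
      rw [hR, Matrix.map_one _ (map_zero _) (map_one _), mul_one]
    have h2 : ∀ i, goldenToReal (v (π i) a) = ∑ c, M a c * goldenToReal (v i c) := fun i =>
      (congrFun (hπ i) a).symm
    rw [h1]
    simp only [Matrix.mul_apply, Matrix.map_apply, frameMatrix, Matrix.of_apply, map_add, map_mul,
      h2, Fin.sum_univ_three]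
    ring

/-- The matrices of the elements of `G` in the orthonormal basis given by `Q`. -/
noncomputable def frameRep (Q : E3 ≃ₗᵢ[ℝ] E3) (G : Subgroup (E3 ≃ₗᵢ[ℝ] E3)) :
    G →* Matrix (Fin 3) (Fin 3) ℝ :=
  matOf.comp ((MulAut.conj Q⁻¹).toMonoidHom.comp G.subtype)

variable {Q : E3 ≃ₗᵢ[ℝ] E3} {G : Subgroup (E3 ≃ₗᵢ[ℝ] E3)}

lemma frameRep_apply (g : G) : frameRep Q G g = matOf (Q⁻¹ * g * Q) := by
  simp [frameRep]

lemma frameRep_injective : Function.Injective (frameRep Q G) := by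
  intro g h hgh
  rw [frameRep_apply, frameRep_apply] at hgh
  exact Subtype.ext (mul_left_cancel (mul_right_cancel (matOf_injective hgh)))

lemma transpose_mul_frameRep (g : G) : (frameRep Q G g)ᵀ * frameRep Q G g = 1 := by
  rw [frameRep_apply]
  exact transpose_mul_matOf _

/-- A symmetric orthogonal matrix is its own inverse; being an involution thus becomes a condition
on matrix entries. -/
lemma mul_self_eq_one_of_isSymm {g : G} (h : (frameRep Q G g).IsSymm) : g * g = 1 := by
  apply frameRep_injective (Q := Q)
  rw [map_mul, map_one]
  nth_rw 1 [← h]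
  exact transpose_mul_frameRep g

variable {v : Fin m → Fin 3 → GoldenField}

lemma det_frameRep (g : rotationGroup (Q '' vertexSet v)) : (frameRep Q _ g).det = 1 := by
  rw [frameRep_apply, map_mul, map_mul, Matrix.det_mul, Matrix.det_mul, mul_right_comm,
    ← Matrix.det_mul, ← map_mul, inv_mul_cancel, map_one, Matrix.det_one, one_mul, det_matOf]
  exact g.2.1

lemma exists_frameRep_mulVec (g : rotationGroup (Q '' vertexSet v)) (i : Fin m) :
    ∃ j, frameRep Q _ g *ᵥ (goldenToReal ∘ v i) = goldenToReal ∘ v j := by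
  have h : (g : E3 ≃ₗᵢ[ℝ] E3) (Q (WithLp.toLp 2 (goldenToReal ∘ v i))) ∈ Q '' vertexSet v :=
    g.2.2.subset ⟨_, ⟨_, ⟨i, rfl⟩, rfl⟩, rfl⟩
  obtain ⟨_, ⟨j, rfl⟩, hj⟩ := h
  refine ⟨j, ?_⟩
  have h3 := matOf_mulVec (Q⁻¹ * g * Q) (WithLp.toLp 2 (goldenToReal ∘ v i))
  rw [← frameRep_apply] at h3
  refine h3.trans ?_
  have h4 : (Q⁻¹ * (g : E3 ≃ₗᵢ[ℝ] E3) * Q) (WithLp.toLp 2 (goldenToReal ∘ v i)) =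
      Q⁻¹ ((g : E3 ≃ₗᵢ[ℝ] E3) (Q (WithLp.toLp 2 (goldenToReal ∘ v i)))) := rfl
  rw [h4, ← hj]
  exact congrArg WithLp.ofLp (Q.symm_apply_apply _)

/-- Every rotation in the group of a vertex set is determined by the images of three vertices. -/
lemma exists_frameRep_eq {R : Matrix (Fin 3) (Fin 3) GoldenField} {p q r : Fin m}
    (hR : frameMatrix v R p q r = 1) (g : rotationGroup (Q '' vertexSet v)) :
    ∃ i j k, v i ⬝ᵥ v j = v p ⬝ᵥ v q ∧ v i ⬝ᵥ v k = v p ⬝ᵥ v r ∧ v j ⬝ᵥ v k = v q ⬝ᵥ v r ∧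
      v i ⬝ᵥ (v j ⨯₃ v k) = v p ⬝ᵥ (v q ⨯₃ v r) ∧
      frameRep Q _ g = (frameMatrix v R i j k).map goldenToReal :=
  exists_frameMatrix v hR (transpose_mul_frameRep g) (det_frameRep g) (exists_frameRep_mulVec g)

lemma finite_rotationGroup {R : Matrix (Fin 3) (Fin 3) GoldenField} {p q r : Fin m}
    (hR : frameMatrix v R p q r = 1) : Finite (rotationGroup (Q '' vertexSet v)) := by
  choose i j k h using exists_frameRep_eq (Q := Q) hR
  refine Finite.of_injective (fun g => (i g, j g, k g)) fun g g' hg => ?_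
  simp only [Prod.mk.injEq] at hg
  apply frameRep_injective (Q := Q)
  rw [(h g).2.2.2.2, (h g').2.2.2.2, hg.1, hg.2.1, hg.2.2]

/-- A matrix of determinant one which permutes the vertices is the matrix of a rotation in the
group. -/
lemma exists_frameRep_eq_map (N : Matrix (Fin 3) (Fin 3) GoldenField) (hN : Nᵀ * N = 1)
    (hdet : N.det = 1) (hv : ∀ i, ∃ j, N *ᵥ v i = v j) :
    ∃ g : rotationGroup (Q '' vertexSet v), frameRep Q _ g = N.map goldenToReal := by
  have hA : (N.map goldenToReal)ᵀ * N.map goldenToReal = 1 := by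
    rw [← Matrix.transpose_map, ← Matrix.map_mul, hN,
      Matrix.map_one _ (map_zero _) (map_one _)]
  set u := isometryOfMatrix (N.map goldenToReal) hA with hu
  have hmat : matOf u = N.map goldenToReal := matOf_isometryOfMatrix _ hA
  have hmaps : Set.MapsTo u (vertexSet v) (vertexSet v) := by
    rintro _ ⟨i, rfl⟩
    obtain ⟨j, hj⟩ := hv i
    refine ⟨j, ?_⟩
    apply PiLp.ext
    intro a
    have h1 := congrFun (matOf_mulVec u (WithLp.toLp 2 (goldenToReal ∘ v i))) a
    rw [← h1, hmat]
    change goldenToReal (v j a) = _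
    rw [← hj]
    simp [Matrix.mulVec, dotProduct]
  -- An injective self-map of a finite set is onto.
  have himage : u '' vertexSet v = vertexSet v :=
    ((Set.finite_range _).injOn_iff_bijOn_of_mapsTo hmaps).1 u.injective.injOn |>.image_eq
  refine ⟨⟨Q * u * Q⁻¹, ?_, ?_⟩, ?_⟩
  · rw [← det_matOf, map_mul, map_mul, Matrix.det_mul, Matrix.det_mul, mul_right_comm,
      ← Matrix.det_mul, ← map_mul, mul_inv_cancel, map_one, Matrix.det_one, one_mul, hmat]
    exact (RingHom.map_det goldenToReal N).symm.trans (by rw [hdet, map_one])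
  · rw [← Set.image_comp]
    have h : (⇑(Q * u * Q⁻¹) : E3 → E3) ∘ Q = Q ∘ u := by
      funext x
      exact congrArg (fun y => Q (u y)) (Q.symm_apply_apply x)
    rw [h, Set.image_comp, himage]
  · rw [frameRep_apply]
    refine Eq.trans (congrArg matOf ?_) hmat
    change Q⁻¹ * (Q * u * Q⁻¹) * Q = u
    group

end Frames

/-! ### Real forms of the representations of the octahedral and icosahedral groups -/

section Signs

variable {G : Type*} [Group G] {V : Type*} [AddCommGroup V] [Module ℂ V]

lemma nontrivial_of_isIrreducible {ρ : Representation ℂ G V} (hρ : ρ.IsIrreducible) :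
    Nontrivial V := by
  by_contra h
  rw [not_nontrivial_iff_subsingleton] at h
  obtain ⟨x, y, hxy⟩ := hρ.toNontrivial
  exact hxy (by ext v; simp [Subsingleton.elim v 0])

/-- The elements which fix `u` up to a sign. -/
def signStabilizer (ρ : Representation ℂ G V) (u : V) : Subgroup G where
  carrier := {g | ρ g u = u ∨ ρ g u = -u}
  one_mem' := Or.inl (by rw [map_one]; rfl)
  mul_mem' := by
    rintro a b ha hb
    simp only [Set.mem_ofPred_eq, map_mul, Module.End.mul_apply] at *
    rcases hb with hb | hb <;> rcases ha with ha | ha <;> simp [ha, hb]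
  inv_mem' := by
    rintro a ha
    simp only [Set.mem_ofPred_eq] at *
    have h : ρ a⁻¹ (ρ a u) = u := ρ.inv_self_apply a u
    rcases ha with ha | ha <;> rw [ha] at h
    · exact Or.inl h
    · right
      rw [map_neg] at h
      exact neg_eq_iff_eq_neg.1 h

/-- If every element is a product of an involution and an element fixing `u` up to a sign, then
the representation is equivalent to a real one. -/
lemma exists_real_matrices_of_involutions [Finite G] [FiniteDimensional ℂ V]
    {ρ : Representation ℂ G V} (hρ : ρ.IsIrreducible) {u : V} (hu : u ≠ 0)
    (h : ∀ g, ∃ k ∈ signStabilizer ρ u, g * k * (g * k) = 1) :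
    ∃ (d : ℕ) (Γ : G →* Matrix (Fin d) (Fin d) ℂ),
      (∀ g, Γ g ∈ Matrix.unitaryGroup (Fin d) ℂ) ∧ (∀ g i j, (Γ g i j).im = 0) ∧
      Nonempty ((matRep Γ).Equiv ρ) := by
  refine exists_real_matrices_of_signs hρ hu fun g => ?_
  obtain ⟨k, hk, hgk⟩ := h g
  exact ⟨1, g * k, k⁻¹, by group, hgk, one_mem (signStabilizer ρ u), inv_mem hk⟩

/-- The sum of `w` and its image is fixed by the involution; if that sum vanishes, `w` itself
changes sign. -/
lemma exists_mem_signStabilizer_of_involution (ρ : Representation ℂ G V) (w : V)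
    {s : G} (hs : s * s = 1) : (ρ s w = -w ∧ s ∈ signStabilizer ρ w) ∨
      (w + ρ s w ≠ 0 ∧ s ∈ signStabilizer ρ (w + ρ s w)) := by
  by_cases h : w + ρ s w = 0
  · have h2 := eq_neg_of_add_eq_zero_right h
    exact Or.inl ⟨h2, Or.inr h2⟩
  · refine Or.inr ⟨h, Or.inl ?_⟩
    rw [map_add, ← Module.End.mul_apply, ← map_mul, hs, map_one, Module.End.one_apply, add_comm]

/-- In a representation of the octahedral group, some vector is fixed up to a sign by a rotation
`c` of order four; here `k` is a rotation of order three. -/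
lemma exists_fixed_up_to_sign_of_octahedral [Nontrivial V] (ρ : Representation ℂ G V) {c k : G}
    (hc : c ^ 4 = 1) (hk : k ^ 3 = 1) (hck : k * c ^ 2 * k ^ 2 * c ^ 2 * k ^ 2 = k ^ 2 * c ^ 2) :
    ∃ u, u ≠ 0 ∧ c ∈ signStabilizer ρ u := by
  -- If this sum always vanishes, the half turn `c ^ 2` acts as `-1`. But the relation `hck` says
  -- that the product of two conjugate half turns is a third one, so it would give `ρ (k ^ 2) = -ρ
  -- (k ^ 2)`.
  by_cases h : ∀ v, v + ρ (c ^ 2) v = 0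
  · exfalso
    have h1 : ρ (c ^ 2) = -1 := LinearMap.ext fun v => eq_neg_of_add_eq_zero_right (h v)
    have h2 := congrArg ρ hck
    simp only [map_mul, h1] at h2
    have h3 : ρ (k ^ 2) = -ρ (k ^ 2) := by
      have h4 : ρ k * ρ (k ^ 2) = 1 := by rw [← map_mul, ← pow_succ', hk, map_one]
      calc _ = ρ k * -1 * ρ (k ^ 2) * -1 * ρ (k ^ 2) := by
            simp only [mul_neg, mul_one, neg_mul, neg_neg, h4, one_mul]
        _ = _ := h2.trans (by simp)
    obtain ⟨v, hv⟩ := exists_ne (0 : V)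
    have h5 := LinearMap.congr_fun h3 (ρ k v)
    have h6 : ρ (k ^ 2) (ρ k v) = v := by
      rw [← Module.End.mul_apply, ← map_mul, ← pow_succ, hk, map_one, Module.End.one_apply]
    rw [LinearMap.neg_apply, h6] at h5
    have h7 : (2 : ℂ) • v = 0 := by
      rw [two_smul]
      nth_rw 2 [h5]
      exact add_neg_cancel v
    exact hv ((smul_eq_zero.1 h7).resolve_left two_ne_zero)
  · push Not at h
    obtain ⟨v, hv⟩ := h
    -- `w` is fixed by `c ^ 2`, so `c` acts on it as an involution.
    set w := v + ρ (c ^ 2) v with hw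
    have h1 : ρ c (ρ c w) = w := by
      rw [← Module.End.mul_apply, ← map_mul, ← sq, hw, map_add, ← Module.End.mul_apply,
        ← map_mul, ← pow_add, hc, map_one, Module.End.one_apply, add_comm]
    by_cases h2 : w + ρ c w = 0
    · exact ⟨w, hv, Or.inr (eq_neg_of_add_eq_zero_right h2)⟩
    · exact ⟨_, h2, Or.inl (by rw [map_add, h1, add_comm])⟩

/-- In a representation of the icosahedral group, some vector is fixed up to a sign by rotations
`c` of order three and `s` of order two which generate a dihedral group; here `t₁`, `t₂`, `t₃` are
the half turns about three orthogonal axes permuted by `c`. -/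
lemma exists_fixed_up_to_sign_of_icosahedral [Nontrivial V] (ρ : Representation ℂ G V)
    {c s k t₁ t₂ t₃ : G} (hc : c ^ 3 = 1) (hs : s * s = 1) (hsc : s * c * s = c ^ 2)
    (ht₁ : t₁ * t₁ = 1) (ht₂ : t₂ * t₂ = 1) (ht₃ : t₃ * t₃ = 1)
    (ht₁₂ : t₁ * t₂ = t₃) (ht₂₃ : t₂ * t₃ = t₁) (ht₃₁ : t₃ * t₁ = t₂)
    (h₁ : c * t₁ = t₂ * c) (h₂ : c * t₂ = t₃ * c) (h₃ : c * t₃ = t₁ * c) (hk : k * t₁ = s * k) :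
    ∃ u, u ≠ 0 ∧ c ∈ signStabilizer ρ u ∧ s ∈ signStabilizer ρ u := by
  -- If `c` has a nonzero fixed vector, symmetrising it under `s` keeps it fixed by `c`, since `s`
  -- inverts `c`. The other case is `1 + C + C² = 0`, which will force the representation to be
  -- trivial on `c`.
  by_cases h : ∀ v, v + ρ c v + ρ c (ρ c v) = 0
  · exfalso
    have hE : 1 + ρ c + ρ c * ρ c = 0 := LinearMap.ext h
    -- Conjugation of `1 + C + C² = 0` by a half turn `a`, with all half turns moved to the left of
    -- the powers of `c`.
    have key : ∀ {a x y x' y' : G}, a * a = 1 → c * a = x * c → c * x = y * c → a * x = x' →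
        a * y = y' → 1 + ρ x' * ρ c + ρ y' * (ρ c * ρ c) = 0 := by
      intro a x y x' y' haa hax hxy hx' hy'
      have h4 : ρ a * (1 + ρ c + ρ c * ρ c) * ρ a = 0 := by rw [hE, mul_zero, zero_mul]
      rw [← h4, mul_add, mul_add, add_mul, add_mul, mul_one]
      simp only [← map_mul]
      congr 1
      · congr 1
        · rw [haa, map_one]
        · rw [mul_assoc, hax, ← mul_assoc, hx']
      · rw [mul_assoc, mul_assoc c, hax, ← mul_assoc c, hxy, mul_assoc y, ← mul_assoc a, hy']
    have e₁ := key ht₁ h₁ h₂ ht₁₂ (show t₁ * t₃ = t₂ by rw [← ht₁₂, ← mul_assoc, ht₁, one_mul])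
    have e₂ := key ht₂ h₂ h₃ ht₂₃ (show t₂ * t₁ = t₃ by rw [← ht₂₃, ← mul_assoc, ht₂, one_mul])
    have e₃ := key ht₃ h₃ h₁ ht₃₁ (show t₃ * t₂ = t₁ by rw [← ht₃₁, ← mul_assoc, ht₃, one_mul])
    have f : ∀ t, ρ t + ρ t * ρ c + ρ t * (ρ c * ρ c) = 0 := fun t => by
      rw [← mul_zero (ρ t), ← hE, mul_add, mul_add, mul_one]
    -- In the sum of the three conjugated relations, `C` and `C²` each acquire the factor `ρ t₁ + ρ
    -- t₂ + ρ t₃`. The left multiples `f` have the same terms, which cancel.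
    have hsum : 1 + ρ t₁ + ρ t₂ + ρ t₃ = 1 + 1 + 1 + 1 := by
      linear_combination (norm := noncomm_ring) f t₁ + f t₂ + f t₃ - e₁ - e₂ - e₃
    have hT : ρ t₁ * (1 + ρ t₁ + ρ t₂ + ρ t₃) = 1 + ρ t₁ + ρ t₂ + ρ t₃ := by
      simp only [mul_add, ← map_mul, mul_one, ht₁, ht₁₂, map_one]
      rw [← ht₁₂, ← mul_assoc, ht₁, one_mul]
      abel
    -- The sum over the Klein four-group absorbs `ρ t₁` and equals `4`. Then `s`, a conjugate of
    -- `t₁`, acts trivially, so `C² = C`, hence `C = 1` and `3 = 0`.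
    have hT1 : ρ t₁ = 1 := by
      rw [hsum] at hT
      have h4 : (4 : ℂ) • ρ t₁ = (4 : ℂ) • 1 := by
        simp only [mul_add, mul_one] at hT
        linear_combination (norm := module) hT
      exact smul_right_injective _ (by norm_num : (4 : ℂ) ≠ 0) h4
    have hS : ρ s = 1 := by
      have h4 : s = k * t₁ * k⁻¹ := by rw [hk, mul_inv_cancel_right]
      rw [h4, map_mul, map_mul, hT1, mul_one, ← map_mul, mul_inv_cancel, map_one]
    have hC2 : ρ c * ρ c = ρ c := by
      have h4 := congrArg ρ hsc
      rw [map_mul, map_mul, hS, one_mul, mul_one, sq, map_mul] at h4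
      exact h4.symm
    have hC : ρ c = 1 := by
      have h4 := congrArg ρ hc
      rwa [pow_succ, sq, map_mul, map_mul, hC2, hC2, map_one] at h4
    rw [hC, mul_one] at hE
    obtain ⟨v, hv⟩ := exists_ne (0 : V)
    have h5 := LinearMap.congr_fun hE v
    have h6 : (3 : ℂ) • v = 0 := by
      refine Eq.trans ?_ h5
      simp only [LinearMap.add_apply, Module.End.one_apply]
      module
    exact hv ((smul_eq_zero.1 h6).resolve_left (by norm_num))
  · push Not at h
    obtain ⟨v, hv⟩ := h
    set w := v + ρ c v + ρ c (ρ c v) with hw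
    have h1 : ρ c w = w := by
      have h4 : ρ c (ρ c (ρ c v)) = v := by
        rw [← Module.End.mul_apply, ← Module.End.mul_apply, ← map_mul, ← map_mul,
          ← pow_three', hc, map_one, Module.End.one_apply]
      rw [hw, map_add, map_add, h4]
      abel
    rcases exists_mem_signStabilizer_of_involution ρ w hs with ⟨-, h2⟩ | ⟨h2, h3⟩
    · exact ⟨w, hv, Or.inl h1, h2⟩
    · refine ⟨_, h2, Or.inl ?_, h3⟩
      have h4 : c * s = s * (c * c) := by
        rw [← sq, ← hsc, ← mul_assoc, ← mul_assoc, hs, one_mul]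
      rw [map_add, h1, ← Module.End.mul_apply (ρ c), ← map_mul, h4, map_mul, map_mul,
        Module.End.mul_apply, Module.End.mul_apply, h1, h1]

end Signs

/-! ### The octahedral and icosahedral groups -/

section HasFrame

open Matrix

variable {Q : E3 ≃ₗᵢ[ℝ] E3} {G : Subgroup (E3 ≃ₗᵢ[ℝ] E3)}

/-- The matrix of `g` has the entries `N`. -/
def HasFrame (Q : E3 ≃ₗᵢ[ℝ] E3) {G : Subgroup (E3 ≃ₗᵢ[ℝ] E3)} (g : G)
    (N : Matrix (Fin 3) (Fin 3) GoldenField) : Prop :=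
  frameRep Q G g = N.map goldenToReal

lemma HasFrame.one : HasFrame Q (1 : G) 1 := by
  rw [HasFrame, map_one, Matrix.map_one _ (map_zero _) (map_one _)]

lemma HasFrame.mul {g h : G} {N N' : Matrix (Fin 3) (Fin 3) GoldenField} (hg : HasFrame Q g N)
    (hh : HasFrame Q h N') : HasFrame Q (g * h) (N * N') := by
  rw [HasFrame, map_mul, hg, hh, Matrix.map_mul]

lemma HasFrame.pow {g : G} {N : Matrix (Fin 3) (Fin 3) GoldenField} (hg : HasFrame Q g N) (n : ℕ) :
    HasFrame Q (g ^ n) (N ^ n) := by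
  induction n with
  | zero => simpa using HasFrame.one
  | succ n ih => simpa only [pow_succ] using ih.mul hg

lemma HasFrame.eq {g h : G} {N N' : Matrix (Fin 3) (Fin 3) GoldenField} (hg : HasFrame Q g N)
    (hh : HasFrame Q h N') (hN : N = N') : g = h :=
  frameRep_injective (hg.trans ((congrArg (fun A => Matrix.map A goldenToReal) hN).trans hh.symm))

lemma HasFrame.mul_self {g : G} {N : Matrix (Fin 3) (Fin 3) GoldenField} (hg : HasFrame Q g N)
    (hN : Nᵀ = N) : g * g = 1 := by
  refine mul_self_eq_one_of_isSymm (Q := Q) ?_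
  rw [hg, Matrix.IsSymm, ← Matrix.transpose_map, hN]

lemma toLp_goldenToReal (x y z : GoldenField) : WithLp.toLp 2 (goldenToReal ∘ ![x, y, z]) =
    !₂[goldenToReal x, goldenToReal y, goldenToReal z] := by
  ext a
  fin_cases a <;> rfl

end HasFrame

/-! ### The octahedral group: factorisation through a quarter turn. -/

section Octahedral

open Matrix

/-- The vertices of the octahedron. -/
def octaVertex : Fin 6 → Fin 3 → GoldenField :=
  ![![1, 0, 0], ![0, 1, 0], ![0, 0, 1], ![-1, 0, 0], ![0, -1, 0], ![0, 0, -1]]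

lemma octahedronVertices_eq : octahedronVertices = vertexSet octaVertex := by
  ext x
  constructor
  · rintro (rfl | rfl | rfl | rfl | rfl | rfl)
    · exact ⟨0, by simp [octaVertex, toLp_goldenToReal]⟩
    · exact ⟨3, by simp [octaVertex, toLp_goldenToReal]⟩
    · exact ⟨1, by simp [octaVertex, toLp_goldenToReal]⟩
    · exact ⟨4, by simp [octaVertex, toLp_goldenToReal]⟩
    · exact ⟨2, by simp [octaVertex, toLp_goldenToReal]⟩
    · exact ⟨5, by simp [octaVertex, toLp_goldenToReal]⟩
  · rintro ⟨i, rfl⟩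
    fin_cases i <;> simp [octaVertex, toLp_goldenToReal, octahedronVertices]

lemma frameMatrix_octaVertex : frameMatrix octaVertex 1 0 1 2 = 1 := by decide +kernel

/-- The rotation by a right angle about the third axis. -/
def quarterTurn : Matrix (Fin 3) (Fin 3) GoldenField := !![0, -1, 0; 1, 0, 0; 0, 0, 1]

/-- The cyclic permutation of the axes. -/
def cyclicTurn : Matrix (Fin 3) (Fin 3) GoldenField := !![0, 0, 1; 1, 0, 0; 0, 1, 0]

/-- The finite check: every rotation of the octahedron becomes the identity or a half turn after
multiplication by some power of the quarter turn. The conditions on `i`, `j` precede `k` so that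
failing pairs are discarded early. -/
lemma octahedral_isSymm : ∀ i j, octaVertex i ⬝ᵥ octaVertex j = octaVertex 0 ⬝ᵥ octaVertex 1 →
    ∀ k, octaVertex i ⬝ᵥ octaVertex k = octaVertex 0 ⬝ᵥ octaVertex 2 →
      octaVertex j ⬝ᵥ octaVertex k = octaVertex 1 ⬝ᵥ octaVertex 2 →
      octaVertex i ⬝ᵥ (octaVertex j ⨯₃ octaVertex k) =
        octaVertex 0 ⬝ᵥ (octaVertex 1 ⨯₃ octaVertex 2) →
      ∃ b : Fin 4, (frameMatrix octaVertex 1 i j k * quarterTurn ^ (b : ℕ))ᵀ =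
        frameMatrix octaVertex 1 i j k * quarterTurn ^ (b : ℕ) := by
  decide +kernel

lemma exists_real_matrices_octahedral {Q : E3 ≃ₗᵢ[ℝ] E3} {V : Type*} [AddCommGroup V] [Module ℂ V]
    [FiniteDimensional ℂ V] {ρ : Representation ℂ (rotationGroup (Q '' vertexSet octaVertex)) V}
    (hρ : ρ.IsIrreducible) :
    ∃ (d : ℕ) (Γ : rotationGroup (Q '' vertexSet octaVertex) →* Matrix (Fin d) (Fin d) ℂ),
      (∀ g, Γ g ∈ Matrix.unitaryGroup (Fin d) ℂ) ∧ (∀ g i j, (Γ g i j).im = 0) ∧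
      Nonempty ((matRep Γ).Equiv ρ) := by
  have := finite_rotationGroup (Q := Q) frameMatrix_octaVertex
  have : Nontrivial V := nontrivial_of_isIrreducible hρ
  obtain ⟨c, hc⟩ : ∃ c : rotationGroup (Q '' vertexSet octaVertex), HasFrame Q c quarterTurn :=
    exists_frameRep_eq_map _ (by decide +kernel) (by decide +kernel) (by decide +kernel)
  obtain ⟨k, hk⟩ : ∃ k : rotationGroup (Q '' vertexSet octaVertex), HasFrame Q k cyclicTurn :=
    exists_frameRep_eq_map _ (by decide +kernel) (by decide +kernel) (by decide +kernel)
  obtain ⟨u, hu, hcu⟩ := exists_fixed_up_to_sign_of_octahedral ρ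
    ((hc.pow 4).eq HasFrame.one (by decide +kernel)) ((hk.pow 3).eq HasFrame.one (by decide +kernel))
    (((((hk.mul (hc.pow 2)).mul (hk.pow 2)).mul (hc.pow 2)).mul (hk.pow 2)).eq
      ((hk.pow 2).mul (hc.pow 2)) (by decide +kernel))
  refine exists_real_matrices_of_involutions hρ hu fun g => ?_
  obtain ⟨i, j, l, h₁, h₂, h₃, h₄, hg⟩ := exists_frameRep_eq (Q := Q) frameMatrix_octaVertex g
  obtain ⟨b, hb⟩ := octahedral_isSymm i j h₁ l h₂ h₃ h₄
  exact ⟨c ^ (b : ℕ), pow_mem hcu _, (HasFrame.mul hg (hc.pow _)).mul_self hb⟩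

end Octahedral

/-! ### The icosahedral group: factorisation through a dihedral subgroup. -/

section Icosahedral

open Matrix

/-- The vertices of the icosahedron. -/
def icosaVertex : Fin 12 → Fin 3 → GoldenField :=
  ![![0, 1, ⟨0, 1⟩], ![0, -1, ⟨0, 1⟩], ![⟨0, 1⟩, 0, 1],
    ![0, 1, ⟨0, -1⟩], ![0, -1, ⟨0, -1⟩], ![1, ⟨0, 1⟩, 0],
    ![-1, ⟨0, 1⟩, 0], ![1, ⟨0, -1⟩, 0], ![-1, ⟨0, -1⟩, 0],
    ![⟨0, -1⟩, 0, 1], ![⟨0, 1⟩, 0, -1], ![⟨0, -1⟩, 0, -1]]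

lemma icosahedronVertices_eq : icosahedronVertices = vertexSet icosaVertex := by
  have h₁ : goldenToReal ⟨0, 1⟩ = Real.goldenRatio := by simp [goldenToReal_apply]
  have h₂ : goldenToReal ⟨0, -1⟩ = -Real.goldenRatio := by simp [goldenToReal_apply]
  ext x
  constructor
  · rintro ⟨s, t, rfl | rfl, rfl | rfl, rfl | rfl | rfl⟩
    · exact ⟨0, by simp [icosaVertex, toLp_goldenToReal, h₁]⟩
    · exact ⟨5, by simp [icosaVertex, toLp_goldenToReal, h₁]⟩
    · exact ⟨2, by simp [icosaVertex, toLp_goldenToReal, h₁]⟩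
    · exact ⟨3, by simp [icosaVertex, toLp_goldenToReal, h₂]⟩
    · exact ⟨7, by simp [icosaVertex, toLp_goldenToReal, h₂]⟩
    · exact ⟨9, by simp [icosaVertex, toLp_goldenToReal, h₂]⟩
    · exact ⟨1, by simp [icosaVertex, toLp_goldenToReal, h₁]⟩
    · exact ⟨6, by simp [icosaVertex, toLp_goldenToReal, h₁]⟩
    · exact ⟨10, by simp [icosaVertex, toLp_goldenToReal, h₁]⟩
    · exact ⟨4, by simp [icosaVertex, toLp_goldenToReal, h₂]⟩
    · exact ⟨8, by simp [icosaVertex, toLp_goldenToReal, h₂]⟩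
    · exact ⟨11, by simp [icosaVertex, toLp_goldenToReal, h₂]⟩
  · have h : ∀ s t : ℝ, (s = 1 ∨ s = -1) → (t = 1 ∨ t = -1) →
        !₂[0, s, t * Real.goldenRatio] ∈ icosahedronVertices ∧
        !₂[s, t * Real.goldenRatio, 0] ∈ icosahedronVertices ∧
        !₂[t * Real.goldenRatio, 0, s] ∈ icosahedronVertices := fun s t hs ht =>
      ⟨⟨s, t, hs, ht, Or.inl rfl⟩, ⟨s, t, hs, ht, Or.inr (Or.inl rfl)⟩,
        ⟨s, t, hs, ht, Or.inr (Or.inr rfl)⟩⟩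
    have pp := h 1 1 (Or.inl rfl) (Or.inl rfl)
    have pn := h 1 (-1) (Or.inl rfl) (Or.inr rfl)
    have np := h (-1) 1 (Or.inr rfl) (Or.inl rfl)
    have nn := h (-1) (-1) (Or.inr rfl) (Or.inr rfl)
    simp only [one_mul, neg_mul] at pp pn np nn
    rintro ⟨i, rfl⟩
    fin_cases i <;> simp [icosaVertex, toLp_goldenToReal, h₁, h₂, pp, pn, np, nn]

/-- The inverse of the matrix whose columns are the first three vertices. -/
def icosaInverse : Matrix (Fin 3) (Fin 3) GoldenField :=
  !![⟨-1, 1/2⟩, ⟨1/2, 0⟩, ⟨-1/2, 1/2⟩; ⟨-1, 1/2⟩, ⟨-1/2, 0⟩, ⟨-1/2, 1/2⟩; ⟨-1, 1⟩, 0, 0]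

lemma frameMatrix_icosaVertex : frameMatrix icosaVertex icosaInverse 0 1 2 = 1 := by
  decide +kernel

/-- A half turn which conjugates the cyclic permutation of the axes to its inverse. -/
def icosaHalfTurn : Matrix (Fin 3) (Fin 3) GoldenField :=
  !![⟨0, -1/2⟩, ⟨-1/2, 0⟩, ⟨-1/2, 1/2⟩; ⟨-1/2, 0⟩, ⟨-1/2, 1/2⟩, ⟨0, -1/2⟩;
    ⟨-1/2, 1/2⟩, ⟨0, -1/2⟩, ⟨-1/2, 0⟩]

/-- A rotation which conjugates the half turn about the first axis to `icosaHalfTurn`. -/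
def icosaConjugator : Matrix (Fin 3) (Fin 3) GoldenField :=
  !![⟨-1/2, 1/2⟩, ⟨0, 1/2⟩, ⟨-1/2, 0⟩; ⟨0, -1/2⟩, ⟨1/2, 0⟩, ⟨-1/2, 1/2⟩;
    ⟨1/2, 0⟩, ⟨-1/2, 1/2⟩, ⟨0, 1/2⟩]

/-- The same check with the six elements `c ^ a * s ^ b` of a dihedral group in place of the powers
of a quarter turn. -/
lemma icosahedral_isSymm :
    ∀ i j, icosaVertex i ⬝ᵥ icosaVertex j = icosaVertex 0 ⬝ᵥ icosaVertex 1 →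
    ∀ k, icosaVertex i ⬝ᵥ icosaVertex k = icosaVertex 0 ⬝ᵥ icosaVertex 2 →
      icosaVertex j ⬝ᵥ icosaVertex k = icosaVertex 1 ⬝ᵥ icosaVertex 2 →
      icosaVertex i ⬝ᵥ (icosaVertex j ⨯₃ icosaVertex k) =
        icosaVertex 0 ⬝ᵥ (icosaVertex 1 ⨯₃ icosaVertex 2) →
      ∃ (a : Fin 3) (b : Fin 2), (frameMatrix icosaVertex icosaInverse i j k *
          (cyclicTurn ^ (a : ℕ) * icosaHalfTurn ^ (b : ℕ)))ᵀ =
        frameMatrix icosaVertex icosaInverse i j k *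
          (cyclicTurn ^ (a : ℕ) * icosaHalfTurn ^ (b : ℕ)) := by
  decide +kernel

lemma exists_real_matrices_icosahedral {Q : E3 ≃ₗᵢ[ℝ] E3} {V : Type*} [AddCommGroup V] [Module ℂ V]
    [FiniteDimensional ℂ V] {ρ : Representation ℂ (rotationGroup (Q '' vertexSet icosaVertex)) V}
    (hρ : ρ.IsIrreducible) :
    ∃ (d : ℕ) (Γ : rotationGroup (Q '' vertexSet icosaVertex) →* Matrix (Fin d) (Fin d) ℂ),
      (∀ g, Γ g ∈ Matrix.unitaryGroup (Fin d) ℂ) ∧ (∀ g i j, (Γ g i j).im = 0) ∧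
      Nonempty ((matRep Γ).Equiv ρ) := by
  have := finite_rotationGroup (Q := Q) frameMatrix_icosaVertex
  have : Nontrivial V := nontrivial_of_isIrreducible hρ
  have hex := fun N => exists_frameRep_eq_map (Q := Q) (v := icosaVertex) N
  obtain ⟨c, hc : HasFrame Q c _⟩ := hex cyclicTurn (by decide +kernel) (by decide +kernel)
    (by decide +kernel)
  obtain ⟨s, hs : HasFrame Q s _⟩ := hex icosaHalfTurn (by decide +kernel) (by decide +kernel)
    (by decide +kernel)
  obtain ⟨k, hk : HasFrame Q k _⟩ := hex icosaConjugator (by decide +kernel) (by decide +kernel)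
    (by decide +kernel)
  obtain ⟨t₁, ht₁ : HasFrame Q t₁ _⟩ := hex !![1, 0, 0; 0, -1, 0; 0, 0, -1] (by decide +kernel)
    (by decide +kernel) (by decide +kernel)
  obtain ⟨t₂, ht₂ : HasFrame Q t₂ _⟩ := hex !![-1, 0, 0; 0, 1, 0; 0, 0, -1] (by decide +kernel)
    (by decide +kernel) (by decide +kernel)
  obtain ⟨t₃, ht₃ : HasFrame Q t₃ _⟩ := hex !![-1, 0, 0; 0, -1, 0; 0, 0, 1] (by decide +kernel)
    (by decide +kernel) (by decide +kernel)
  obtain ⟨u, hu, hcu, hsu⟩ := exists_fixed_up_to_sign_of_icosahedral ρ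
    ((hc.pow 3).eq .one (by decide +kernel)) (hs.mul_self (by decide +kernel))
    (((hs.mul hc).mul hs).eq (hc.pow 2) (by decide +kernel))
    (ht₁.mul_self (by decide +kernel)) (ht₂.mul_self (by decide +kernel))
    (ht₃.mul_self (by decide +kernel)) ((ht₁.mul ht₂).eq ht₃ (by decide +kernel))
    ((ht₂.mul ht₃).eq ht₁ (by decide +kernel)) ((ht₃.mul ht₁).eq ht₂ (by decide +kernel))
    ((hc.mul ht₁).eq (ht₂.mul hc) (by decide +kernel))
    ((hc.mul ht₂).eq (ht₃.mul hc) (by decide +kernel))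
    ((hc.mul ht₃).eq (ht₁.mul hc) (by decide +kernel))
    ((hk.mul ht₁).eq (hs.mul hk) (by decide +kernel))
  refine exists_real_matrices_of_involutions hρ hu fun g => ?_
  obtain ⟨i, j, l, h₁, h₂, h₃, h₄, hg⟩ := exists_frameRep_eq (Q := Q) frameMatrix_icosaVertex g
  obtain ⟨a, b, hab⟩ := icosahedral_isSymm i j h₁ l h₂ h₃ h₄
  exact ⟨c ^ (a : ℕ) * s ^ (b : ℕ), mul_mem (pow_mem hcu _) (pow_mem hsu _),
    (HasFrame.mul hg ((hc.pow _).mul (hs.pow _))).mul_self hab⟩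

end Icosahedral

/-! ### Complete real systems for the octahedral and icosahedral groups. -/

section Complete

/-- For groups all of whose irreducible representations are real, there is a complete real
orthonormal system of basis functions. -/
lemma exists_complete_real_system {G : Subgroup (E3 ≃ₗᵢ[ℝ] E3)} [Finite G]
    (h : ∀ (n : ℕ) (Δ : G →* Matrix (Fin n) (Fin n) ℂ), (matRep Δ).IsIrreducible →
      ∃ (d : ℕ) (Γ : G →* Matrix (Fin d) (Fin d) ℂ), (∀ g, Γ g ∈ Matrix.unitaryGroup (Fin d) ℂ) ∧
        (∀ g i j, (Γ g i j).im = 0) ∧ Nonempty ((matRep Γ).Equiv (matRep Δ))) :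
    ∃ (r : ℕ) (A : IrrepList G r) (N : Fin r → ℕ → ℕ)
      (I : ∀ p, (Σ l, Fin (N p l)) → Fin (A.d p) → L2S), IsRealOrthonormalBasisSystem A I ∧
        (∀ p l n j, IsSphericalHarmonic l (I p ⟨l, n⟩ j)) ∧ closedSpan I = ⊤ := by
  obtain ⟨r, A, hA⟩ := exists_real_irrepList h
  obtain ⟨N, I, h₁, h₂, h₃⟩ := exists_real_system A
  refine ⟨r, A, N, I, h₁, h₂, ?_⟩
  rw [eq_top_iff, ← topologicalClosure_iSup_isotypic A]
  refine Submodule.topologicalClosure_minimal _ (iSup_le fun p => ?_)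
    (Submodule.isClosed_topologicalClosure _)
  rw [← h₃ p (hA p)]
  refine Submodule.topologicalClosure_mono (Submodule.span_mono ?_)
  rintro _ ⟨z, j, rfl⟩
  exact ⟨p, z, j, rfl⟩

lemma exists_complete_real_system_of_isOctahedral_or_isIcosahedral
    {G : Subgroup (E3 ≃ₗᵢ[ℝ] E3)} (hG : IsOctahedral G ∨ IsIcosahedral G) :
    ∃ (r : ℕ) (A : IrrepList G r) (N : Fin r → ℕ → ℕ)
      (I : ∀ p, (Σ l, Fin (N p l)) → Fin (A.d p) → L2S), IsRealOrthonormalBasisSystem A I ∧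
        (∀ p l n j, IsSphericalHarmonic l (I p ⟨l, n⟩ j)) ∧ closedSpan I = ⊤ := by
  rcases hG with ⟨Q, rfl⟩ | ⟨Q, rfl⟩
  · rw [octahedronVertices_eq]
    have := finite_rotationGroup (Q := Q) frameMatrix_octaVertex
    exact exists_complete_real_system fun n Δ hΔ => exists_real_matrices_octahedral hΔ
  · rw [icosahedronVertices_eq]
    have := finite_rotationGroup (Q := Q) frameMatrix_icosaVertex
    exact exists_complete_real_system fun n Δ hΔ => exists_real_matrices_icosahedral hΔ

end Complete

/-! ### One-dimensional representations -/

section Characters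

variable {G : Type*} [Group G]

lemma isIrreducible_of_forall_eq_top {V : Type*} [AddCommGroup V] [Module ℂ V] [Nontrivial V]
    {ρ : Representation ℂ G V}
    (h : ∀ W : Submodule ℂ V, (∀ g, ∀ w ∈ W, ρ g w ∈ W) → W ≠ ⊥ → W = ⊤) : ρ.IsIrreducible where
  exists_pair_ne := ⟨⊥, ⊤, fun hbt => bot_ne_top (congrArg Subrepresentation.toSubmodule hbt)⟩
  eq_bot_or_eq_top W := by
    by_cases hW : W.toSubmodule = ⊥
    · exact Or.inl (Subrepresentation.toSubmodule_injective hW)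
    · exact Or.inr (Subrepresentation.toSubmodule_injective
        (h _ (fun g w hw => W.apply_mem_toSubmodule g hw) hW))

/-- The matrix representation given by a character. -/
noncomputable def charRep (χ : G →* ℂ) : G →* Matrix (Fin 1) (Fin 1) ℂ :=
  (Matrix.scalar (Fin 1)).toMonoidHom.comp χ

lemma charRep_apply (χ : G →* ℂ) (g : G) : charRep χ g = Matrix.scalar (Fin 1) (χ g) := rfl

lemma charRep_apply_apply (χ : G →* ℂ) (g : G) (i j : Fin 1) : charRep χ g i j = χ g := by
  rw [Subsingleton.elim i j, charRep_apply, Matrix.scalar_apply, Matrix.diagonal_apply_eq]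

lemma matRep_charRep (χ : G →* ℂ) (g : G) (v : Fin 1 → ℂ) : matRep (charRep χ) g v = χ g • v := by
  rw [matRep_apply, charRep_apply, Matrix.scalar_apply, ← Matrix.smul_one_eq_diagonal,
    Matrix.smul_mulVec, Matrix.one_mulVec]

lemma charRep_mem_unitaryGroup {χ : G →* ℂ} {g : G} (h : ‖χ g‖ = 1) :
    charRep χ g ∈ Matrix.unitaryGroup (Fin 1) ℂ := by
  rw [Matrix.mem_unitaryGroup_iff]
  ext i j
  rw [Subsingleton.elim i j, Matrix.mul_apply, Fin.sum_univ_one, Matrix.star_apply,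
    charRep_apply_apply]
  refine Eq.trans ?_ (Matrix.one_apply_eq j).symm
  exact (Complex.mul_conj' _).trans (by rw [h]; norm_num)

lemma isIrreducible_charRep (χ : G →* ℂ) : (matRep (charRep χ)).IsIrreducible := by
  refine isIrreducible_of_forall_eq_top fun W _ hW => ?_
  have : IsSimpleModule ℂ (Fin 1 → ℂ) := by
    rw [isSimpleModule_iff_finrank_eq_one]
    simp
  exact (eq_bot_or_eq_top W).resolve_left hW

lemma eq_of_nonempty_equiv_charRep {χ ψ : G →* ℂ}
    (h : Nonempty ((matRep (charRep χ)).Equiv (matRep (charRep ψ)))) : χ = ψ := by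
  obtain ⟨e⟩ := h
  ext g
  have h1 := LinearMap.congr_fun (e.isIntertwining' g) 1
  rw [LinearMap.comp_apply, LinearMap.comp_apply, matRep_charRep, matRep_charRep, map_smul] at h1
  have h2 : e.toLinearMap (1 : Fin 1 → ℂ) ≠ 0 := fun h0 => one_ne_zero (e.toLinearEquiv.map_eq_zero_iff.1 h0)
  exact smul_left_injective ℂ h2 h1

lemma dim_eq_of_nonempty_equiv {d e : ℕ} {Γ : G →* Matrix (Fin d) (Fin d) ℂ}
    {Δ : G →* Matrix (Fin e) (Fin e) ℂ} (h : Nonempty ((matRep Γ).Equiv (matRep Δ))) : d = e := by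
  obtain ⟨φ⟩ := h
  simpa using φ.toLinearEquiv.finrank_eq

lemma nonempty_equiv_of_eq_one {d e : ℕ} {Γ : G →* Matrix (Fin d) (Fin d) ℂ}
    {Δ : G →* Matrix (Fin e) (Fin e) ℂ} (hde : d = e) (hΓ : ∀ g, Γ g = 1) (hΔ : ∀ g, Δ g = 1) :
    Nonempty ((matRep Γ).Equiv (matRep Δ)) := by
  subst hde
  have h : Γ = Δ := MonoidHom.ext fun g => (hΓ g).trans (hΔ g).symm
  subst h
  exact ⟨Representation.Equiv.refl _⟩

lemma nonempty_equiv_charRep_one {d : ℕ} (hd : d = 1) (Γ : G →* Matrix (Fin d) (Fin d) ℂ)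
    (hΓ : ∀ g, Γ g = 1) : Nonempty ((matRep Γ).Equiv (matRep (charRep (1 : G →* ℂ)))) :=
  nonempty_equiv_of_eq_one hd hΓ fun g => by rw [charRep_apply, MonoidHom.one_apply, map_one]

end Characters

/-! ### Real basis functions of one-dimensional representations. -/

section RealFunctions

variable {G : Subgroup (E3 ≃ₗᵢ[ℝ] E3)}

/-- If a one-dimensional representation has a nonzero real basis function, its values are signs. -/
lemma eq_one_or_eq_neg_one_of_isRealValued {d : ℕ} (hd : d = 1)
    {Γ : G →* Matrix (Fin d) (Fin d) ℂ} {f : Fin d → L2S} (hf : IsBasisFunction Γ f)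
    (hreal : ∀ j, IsRealValued (f j)) (hne : ∀ j, f j ≠ 0) (g : G) : Γ g = 1 ∨ Γ g = -1 := by
  subst hd
  have h := isBasisFunction_iff.1 hf g 0
  rw [Fin.sum_univ_one] at h
  have hstar : star (f 0) = f 0 := (isRealValued_iff _).1 (hreal 0)
  -- Conjugating the transformation law of a real function shows that the entry is real; invariance
  -- of the norm shows that it has modulus one.
  have h1 : star (Γ g 0 0) = Γ g 0 0 := by
    have h2 := congrArg star h
    rw [← translate_star, star_smul_L2S, hstar, h] at h2
    exact (smul_left_injective ℂ (hne 0) h2).symm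
  have h3 : ‖Γ g 0 0‖ = 1 := by
    have h2 := congrArg norm h
    rw [LinearIsometry.norm_map, norm_smul] at h2
    exact mul_right_cancel₀ (norm_ne_zero_iff.2 (hne 0)) (h2.symm.trans (one_mul _).symm)
  have h4 : Γ g 0 0 * Γ g 0 0 = 1 := by
    have h5 := Complex.mul_conj' (Γ g 0 0)
    rw [h3] at h5
    calc _ = Γ g 0 0 * star (Γ g 0 0) := by rw [h1]
      _ = 1 := h5.trans (by norm_num)
  rcases mul_self_eq_one_iff.1 h4 with h5 | h5
  · left
    ext i j
    rw [Subsingleton.elim i 0, Subsingleton.elim j 0, h5, Matrix.one_apply_eq]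
  · right
    ext i j
    rw [Subsingleton.elim i 0, Subsingleton.elim j 0, h5, Matrix.neg_apply, Matrix.one_apply_eq]

end RealFunctions

/-! ### The tetrahedral group -/

section CubeRoots

/-- The powers of a primitive cube root of unity. -/
noncomputable def cubeRoot (i : Fin 3) : ℂ := Complex.exp (2 * Real.pi * Complex.I / 3) ^ (i : ℕ)

lemma isPrimitiveRoot_three : IsPrimitiveRoot (Complex.exp (2 * Real.pi * Complex.I / 3)) 3 :=
  Complex.isPrimitiveRoot_exp 3 (by norm_num)

lemma cubeRoot_zero : cubeRoot 0 = 1 := pow_zero _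

lemma cubeRoot_add (i j : Fin 3) : cubeRoot (i + j) = cubeRoot i * cubeRoot j := by
  rw [cubeRoot, cubeRoot, cubeRoot, ← pow_add, Fin.val_add,
    pow_eq_pow_mod ((i : ℕ) + j) isPrimitiveRoot_three.pow_eq_one]

lemma cubeRoot_pow_three (i : Fin 3) : cubeRoot i ^ 3 = 1 := by
  rw [cubeRoot, ← pow_mul, mul_comm (i : ℕ), pow_mul, isPrimitiveRoot_three.pow_eq_one, one_pow]

lemma cubeRoot_one_ne_one : cubeRoot 1 ≠ 1 := by
  intro h
  have h1 : Complex.exp (2 * Real.pi * Complex.I / 3) = 1 := by simpa [cubeRoot] using h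
  exact absurd (isPrimitiveRoot_three.unique (h1 ▸ IsPrimitiveRoot.one)) (by norm_num)

end CubeRoots

section Tetrahedral

open Matrix

/-- The vertices of the tetrahedron. -/
def tetraVertex : Fin 4 → Fin 3 → GoldenField :=
  ![![1, 1, 1], ![1, -1, -1], ![-1, 1, -1], ![-1, -1, 1]]

lemma tetrahedronVertices_eq : tetrahedronVertices = vertexSet tetraVertex := by
  ext x
  constructor
  · rintro (rfl | rfl | rfl | rfl)
    · exact ⟨0, by simp [tetraVertex, toLp_goldenToReal]⟩
    · exact ⟨1, by simp [tetraVertex, toLp_goldenToReal]⟩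
    · exact ⟨2, by simp [tetraVertex, toLp_goldenToReal]⟩
    · exact ⟨3, by simp [tetraVertex, toLp_goldenToReal]⟩
  · rintro ⟨i, rfl⟩
    fin_cases i <;> simp [tetraVertex, toLp_goldenToReal, tetrahedronVertices]

/-- The inverse of the matrix whose columns are the first three vertices. -/
def tetraInverse : Matrix (Fin 3) (Fin 3) GoldenField :=
  !![⟨1/2, 0⟩, ⟨1/2, 0⟩, 0; ⟨1/2, 0⟩, 0, ⟨-1/2, 0⟩; 0, ⟨1/2, 0⟩, ⟨-1/2, 0⟩]

lemma frameMatrix_tetraVertex : frameMatrix tetraVertex tetraInverse 0 1 2 = 1 := by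
  decide +kernel

/-- Three facts used separately: up to signs the matrix is a cyclic permutation matrix, which yields
the nontrivial characters; the rotation or its product with the cyclic turn has cube one, which
excludes sign characters; two vertices have distinct images, which bounds the order. -/
lemma tetrahedral_frame :
    ∀ i j, tetraVertex i ⬝ᵥ tetraVertex j = tetraVertex 0 ⬝ᵥ tetraVertex 1 →
    ∀ k, tetraVertex i ⬝ᵥ tetraVertex k = tetraVertex 0 ⬝ᵥ tetraVertex 2 →
      tetraVertex j ⬝ᵥ tetraVertex k = tetraVertex 1 ⬝ᵥ tetraVertex 2 →
      tetraVertex i ⬝ᵥ (tetraVertex j ⨯₃ tetraVertex k) =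
        tetraVertex 0 ⬝ᵥ (tetraVertex 1 ⨯₃ tetraVertex 2) →
      (∃ s : Fin 3, ∀ a b, frameMatrix tetraVertex tetraInverse i j k a b *
        frameMatrix tetraVertex tetraInverse i j k a b = if a = b + s then 1 else 0) ∧
      (frameMatrix tetraVertex tetraInverse i j k ^ 3 = 1 ∨
        (frameMatrix tetraVertex tetraInverse i j k * cyclicTurn) ^ 3 = 1) ∧ i ≠ j := by
  decide +kernel

/-- Once two images are fixed, orientation singles out the third among the remaining vertices. So a
rotation is determined by an ordered pair of distinct vertices, of which there are twelve. -/
lemma tetrahedral_third_unique :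
    ∀ i j, i ≠ j → ∀ k, tetraVertex i ⬝ᵥ (tetraVertex j ⨯₃ tetraVertex k) =
        tetraVertex 0 ⬝ᵥ (tetraVertex 1 ⨯₃ tetraVertex 2) →
    ∀ l, tetraVertex i ⬝ᵥ (tetraVertex j ⨯₃ tetraVertex l) =
        tetraVertex 0 ⬝ᵥ (tetraVertex 1 ⨯₃ tetraVertex 2) → k = l := by
  decide +kernel

/-- The rotation group of a regular tetrahedron. -/
abbrev tetraGroup (Q : E3 ≃ₗᵢ[ℝ] E3) : Subgroup (E3 ≃ₗᵢ[ℝ] E3) :=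
  rotationGroup (Q '' vertexSet tetraVertex)

variable {Q : E3 ≃ₗᵢ[ℝ] E3}

lemma exists_cyclicTurn_tetrahedral : ∃ c : tetraGroup Q, HasFrame Q c cyclicTurn :=
  exists_frameRep_eq_map _ (by decide +kernel) (by decide +kernel) (by decide +kernel)

lemma card_tetrahedral_le : Nat.card (tetraGroup Q) ≤ 12 := by
  choose i j k h using exists_frameRep_eq (Q := Q) frameMatrix_tetraVertex
  have hij : ∀ g, i g ≠ j g := fun g => (tetrahedral_frame _ _ (h g).1 _ (h g).2.1 (h g).2.2.1
    (h g).2.2.2.1).2.2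
  have hinj : Function.Injective fun g : tetraGroup Q => (⟨(i g, j g), hij g⟩ :
      {x : Fin 4 × Fin 4 // x.1 ≠ x.2}) := by
    intro g g' hg
    simp only [Subtype.mk.injEq, Prod.mk.injEq] at hg
    apply frameRep_injective (Q := Q)
    obtain ⟨-, -, -, h₄, h₅⟩ := h g
    obtain ⟨-, -, -, h₄', h₅'⟩ := h g'
    rw [hg.1, hg.2] at h₄
    rw [h₅, h₅', hg.1, hg.2, tetrahedral_third_unique _ _ (hij g') _ h₄ _ h₄']
  refine (Nat.card_le_card_of_injective _ hinj).trans ?_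
  rw [Nat.card_eq_fintype_card]
  decide

/-- A sign whose cube is one is one, and every element is a product of elements with cube one. The
target is a general monoid so that the lemma applies directly to matrices. -/
lemma eq_one_of_sign_tetrahedral {M : Type*} [Monoid M] [HasDistribNeg M] (hM : (-1 : M) ≠ 1)
    (χ : tetraGroup Q →* M) (h : ∀ g, χ g = 1 ∨ χ g = -1) (g : tetraGroup Q) : χ g = 1 := by
  have h3 : ∀ g, g ^ 3 = 1 → χ g = 1 := by
    intro g hg
    refine (h g).resolve_right fun hn => hM ?_
    have h1 := congrArg χ hg
    rw [map_pow, hn, map_one] at h1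
    simpa [pow_succ] using h1
  obtain ⟨c, hc⟩ := exists_cyclicTurn_tetrahedral (Q := Q)
  have hc3 : χ c = 1 := h3 c ((hc.pow 3).eq .one (by decide +kernel))
  obtain ⟨i, j, l, h₁, h₂, h₃, h₄, hg⟩ := exists_frameRep_eq (Q := Q) frameMatrix_tetraVertex g
  have hg : HasFrame Q g _ := hg
  rcases (tetrahedral_frame i j h₁ l h₂ h₃ h₄).2.1 with h5 | h5
  · exact h3 g ((hg.pow 3).eq .one h5)
  · have h6 := h3 _ (((hg.mul hc).pow 3).eq .one h5)
    rwa [map_mul, hc3, mul_one] at h6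

/-- Squaring the entries removes the signs and leaves the permutation of the axes, always a cyclic
one. This is the homomorphism onto `ℤ/3` behind the nontrivial characters. -/
lemma exists_shift (g : tetraGroup Q) :
    ∃ s : Fin 3, ∀ a b, frameRep Q _ g a b * frameRep Q _ g a b = if a = b + s then 1 else 0 := by
  obtain ⟨i, j, l, h₁, h₂, h₃, h₄, hg⟩ := exists_frameRep_eq (Q := Q) frameMatrix_tetraVertex g
  obtain ⟨s, hs⟩ := (tetrahedral_frame i j h₁ l h₂ h₃ h₄).1
  refine ⟨s, fun a b => ?_⟩
  rw [hg, Matrix.map_apply, ← map_mul, hs]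
  split_ifs <;> simp

/-- The cyclic permutation of the axes induced by a rotation of the tetrahedron. -/
noncomputable def shift (g : tetraGroup Q) : Fin 3 := (exists_shift g).choose

lemma frameRep_mul_self (g : tetraGroup Q) (a b : Fin 3) :
    frameRep Q _ g a b * frameRep Q _ g a b = if a = b + shift g then 1 else 0 :=
  (exists_shift g).choose_spec a b

lemma frameRep_eq_zero (g : tetraGroup Q) {a b : Fin 3} (h : a ≠ b + shift g) : frameRep Q _ g a b = 0 := by
  have h1 := frameRep_mul_self g a b
  rw [if_neg h] at h1
  exact mul_self_eq_zero.1 h1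

lemma shift_eq (g : tetraGroup Q) {a b : Fin 3} (h : frameRep Q _ g a b ≠ 0) : a = b + shift g := by
  by_contra h1
  exact h (frameRep_eq_zero g h1)

lemma shift_mul (g h : tetraGroup Q) : shift (g * h) = shift g + shift h := by
  have h1 : frameRep Q _ (g * h) (0 + shift h + shift g) 0 ≠ 0 := by
    rw [map_mul, Matrix.mul_apply, Finset.sum_eq_single (0 + shift h)]
    · refine mul_ne_zero (fun h0 => ?_) (fun h0 => ?_)
      · have h2 := frameRep_mul_self g (0 + shift h + shift g) (0 + shift h)
        rw [h0, if_pos rfl] at h2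
        norm_num at h2
      · have h2 := frameRep_mul_self h (0 + shift h) 0
        rw [h0, if_pos rfl] at h2
        norm_num at h2
    · intro b _ hb
      rw [frameRep_eq_zero h hb, mul_zero]
    · simp
  have h2 := shift_eq _ h1
  rw [zero_add, zero_add] at h2
  rw [← h2, add_comm]

lemma shift_one : shift (1 : tetraGroup Q) = 0 := by
  have h := shift_mul (1 : tetraGroup Q) 1
  rw [mul_one] at h
  exact left_eq_add.1 h

lemma shift_cyclicTurn {c : tetraGroup Q} (hc : HasFrame Q c cyclicTurn) : shift c = 1 := by
  have h : frameRep Q _ c 1 0 ≠ 0 := by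
    rw [hc, Matrix.map_apply]
    simp [cyclicTurn]
  simpa using (shift_eq c h).symm

variable (Q) in
/-- A nontrivial one-dimensional representation of the tetrahedral group. -/
noncomputable def tetraCharacter : tetraGroup Q →* ℂ where
  toFun g := cubeRoot (shift g)
  map_one' := by rw [shift_one, cubeRoot_zero]
  map_mul' g h := by rw [shift_mul, cubeRoot_add]

lemma tetraCharacter_apply (g : tetraGroup Q) : tetraCharacter Q g = cubeRoot (shift g) := rfl

lemma tetraCharacter_pow_three : tetraCharacter Q ^ 3 = 1 :=
  MonoidHom.ext fun g => cubeRoot_pow_three (shift g)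

lemma tetraCharacter_ne_one : tetraCharacter Q ≠ 1 := by
  intro h
  obtain ⟨c, hc⟩ := exists_cyclicTurn_tetrahedral (Q := Q)
  have h1 := DFunLike.congr_fun h c
  rw [tetraCharacter_apply, shift_cyclicTurn hc] at h1
  exact cubeRoot_one_ne_one h1

variable (Q) in
/-- The three-dimensional representation of the tetrahedral group. -/
noncomputable def tetraRotations : tetraGroup Q →* Matrix (Fin 3) (Fin 3) ℂ :=
  (Complex.ofRealHom.mapMatrix : Matrix (Fin 3) (Fin 3) ℝ →+* _).toMonoidHom.comp (frameRep Q _)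

lemma tetraRotations_apply (g : tetraGroup Q) (i j : Fin 3) :
    tetraRotations Q g i j = (frameRep Q _ g i j : ℂ) := rfl

lemma tetraRotations_eq {g : tetraGroup Q} {N : Matrix (Fin 3) (Fin 3) GoldenField} (hg : HasFrame Q g N) :
    tetraRotations Q g = N.map fun x => (goldenToReal x : ℂ) := by
  ext i j
  rw [tetraRotations_apply, hg, Matrix.map_apply, Matrix.map_apply]

lemma tetraRotations_mem_unitaryGroup (g : tetraGroup Q) :
    tetraRotations Q g ∈ Matrix.unitaryGroup (Fin 3) ℂ := by
  rw [Matrix.mem_unitaryGroup_iff']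
  have h : star (tetraRotations Q g) =
      (Complex.ofRealHom.mapMatrix : Matrix (Fin 3) (Fin 3) ℝ →+* _) (frameRep Q _ g)ᵀ := by
    ext i j
    rw [Matrix.star_apply, tetraRotations_apply]
    exact Complex.conj_ofReal _
  rw [h]
  change Complex.ofRealHom.mapMatrix _ * Complex.ofRealHom.mapMatrix _ = _
  rw [← map_mul, transpose_mul_frameRep, map_one]

/-- Averaging with the half turn about the first axis isolates the first coordinate, and the cyclic
turn moves any coordinate there. So a nonzero invariant subspace contains a multiple of a basis
vector, and then all of them. -/
lemma isIrreducible_tetraRotations : (matRep (tetraRotations Q)).IsIrreducible := by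
  refine isIrreducible_of_forall_eq_top fun W hinv hW => ?_
  obtain ⟨c, hc⟩ := exists_cyclicTurn_tetrahedral (Q := Q)
  obtain ⟨t, ht⟩ : ∃ t : tetraGroup Q, HasFrame Q t !![1, 0, 0; 0, -1, 0; 0, 0, -1] :=
    exists_frameRep_eq_map _ (by decide +kernel) (by decide +kernel) (by decide +kernel)
  have hcv : ∀ v, matRep (tetraRotations Q) c v = ![v 2, v 0, v 1] := by
    intro v
    rw [matRep_apply, tetraRotations_eq hc]
    ext a
    fin_cases a <;> simp [cyclicTurn, Matrix.mulVec, dotProduct, Fin.sum_univ_three]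
  have htv : ∀ v, matRep (tetraRotations Q) t v = ![v 0, -v 1, -v 2] := by
    intro v
    rw [matRep_apply, tetraRotations_eq ht]
    ext a
    fin_cases a <;> simp [Matrix.mulVec, dotProduct, Fin.sum_univ_three]
  have hrot : ∀ x y z : ℂ, ![x, y, z] ∈ W → ![z, x, y] ∈ W := by
    intro x y z h
    simpa [hcv] using hinv c _ h
  have hfirst : ∃ x : ℂ, x ≠ 0 ∧ ![x, 0, 0] ∈ W := by
    obtain ⟨w, hw, hw0⟩ := W.ne_bot_iff.1 hW
    have key : ∀ x y z : ℂ, ![x, y, z] ∈ W → ![x, 0, 0] ∈ W := by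
      intro x y z h
      have h1 := hinv t _ h
      rw [htv] at h1
      convert W.smul_mem (1 / 2 : ℂ) (W.add_mem h h1) using 1
      ext a
      fin_cases a <;> simp
      ring
    have hw' : ![w 0, w 1, w 2] ∈ W := by
      convert hw using 1
      ext a
      fin_cases a <;> rfl
    by_contra! hcon
    have h0 := fun h => hcon _ h (key _ _ _ hw')
    have h2 := fun h => hcon _ h (key _ _ _ (hrot _ _ _ hw'))
    have h1 := fun h => hcon _ h (key _ _ _ (hrot _ _ _ (hrot _ _ _ hw')))
    apply hw0
    ext a
    fin_cases a
    · exact not_not.1 h0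
    · exact not_not.1 h1
    · exact not_not.1 h2
  obtain ⟨x, hx, hxW⟩ := hfirst
  refine eq_top_iff.2 fun v _ => ?_
  convert W.add_mem (W.add_mem (W.smul_mem (v 0 / x) hxW) (W.smul_mem (v 1 / x) (hrot _ _ _ hxW)))
    (W.smul_mem (v 2 / x) (hrot _ _ _ (hrot _ _ _ hxW))) using 1
  ext a
  fin_cases a <;> simp [hx]

end Tetrahedral

/-! ### The complete list of irreducible representations of the tetrahedral group. -/

section TetrahedralList

variable (Q : E3 ≃ₗᵢ[ℝ] E3)

/-- The matrices of the irreducible representations of the tetrahedral group. -/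
noncomputable def tetraMatrices : ∀ p : Fin 4,
    tetraGroup Q →* Matrix (Fin (![1, 1, 1, 3] p)) (Fin (![1, 1, 1, 3] p)) ℂ
  | 0 => charRep 1
  | 1 => charRep (tetraCharacter Q)
  | 2 => charRep (tetraCharacter Q ^ 2)
  | 3 => tetraRotations Q

lemma norm_tetraCharacter (g : tetraGroup Q) : ‖tetraCharacter Q g‖ = 1 := by
  refine Complex.norm_eq_one_of_pow_eq_one (n := 3) ?_ (by norm_num)
  rw [← MonoidHom.pow_apply, tetraCharacter_pow_three, MonoidHom.one_apply]

lemma tetraMatrices_inequivalent (p q : Fin 4)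
    (h : Nonempty ((matRep (tetraMatrices Q p)).Equiv (matRep (tetraMatrices Q q)))) : p = q := by
  have h1 : tetraCharacter Q ≠ 1 := tetraCharacter_ne_one
  have h2 : tetraCharacter Q ^ 2 ≠ 1 := by
    intro h
    apply h1
    have h3 := tetraCharacter_pow_three (Q := Q)
    rwa [pow_succ, h, one_mul] at h3
  have h3 : tetraCharacter Q ^ 2 ≠ tetraCharacter Q := by
    intro h
    apply h2
    have h3 := tetraCharacter_pow_three (Q := Q)
    rwa [pow_succ, h, ← sq] at h3
  fin_cases p <;> fin_cases q <;>
    first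
    | rfl
    | exact absurd (dim_eq_of_nonempty_equiv h) (by decide)
    | exact absurd (eq_of_nonempty_equiv_charRep h) h1
    | exact absurd (eq_of_nonempty_equiv_charRep h) h1.symm
    | exact absurd (eq_of_nonempty_equiv_charRep h) h2
    | exact absurd (eq_of_nonempty_equiv_charRep h) h2.symm
    | exact absurd (eq_of_nonempty_equiv_charRep h) h3
    | exact absurd (eq_of_nonempty_equiv_charRep h) h3.symm

lemma isIrreducible_tetraMatrices (p : Fin 4) : (matRep (tetraMatrices Q p)).IsIrreducible := by
  fin_cases p
  · exact isIrreducible_charRep _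
  · exact isIrreducible_charRep _
  · exact isIrreducible_charRep _
  · exact isIrreducible_tetraRotations

/-- The irreducible representations of the tetrahedral group. -/
noncomputable def tetraIrreps : IrrepList (tetraGroup Q) 4 where
  d := ![1, 1, 1, 3]
  Γ := tetraMatrices Q
  unitary p g := by
    fin_cases p
    · exact charRep_mem_unitaryGroup (by rw [MonoidHom.one_apply, norm_one])
    · exact charRep_mem_unitaryGroup (norm_tetraCharacter Q g)
    · exact charRep_mem_unitaryGroup
        (by rw [MonoidHom.pow_apply, norm_pow, norm_tetraCharacter, one_pow])
    · exact tetraRotations_mem_unitaryGroup g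
  irreducible := isIrreducible_tetraMatrices Q
  inequivalent := tetraMatrices_inequivalent Q
  exhaustive n Δ hΔ := by
    have := finite_rotationGroup (Q := Q) frameMatrix_tetraVertex
    have := Fintype.ofFinite (tetraGroup Q)
    -- The squares of the dimensions add up to `1 + 1 + 1 + 9 = 12`, so the upper bound on the group
    -- order is enough.
    refine exhaustive_of_card_le (isIrreducible_tetraMatrices Q) (tetraMatrices_inequivalent Q)
      ?_ hΔ
    rw [← Nat.card_eq_fintype_card]
    exact card_tetrahedral_le

lemma isTetrahedralNumbering_tetraIrreps : (tetraIrreps Q).IsTetrahedralNumbering :=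
  ⟨rfl, fun g => by
    change charRep 1 g = 1
    rw [charRep_apply, MonoidHom.one_apply, map_one]⟩

lemma exists_real_system_tetrahedral : ∃ (A : IrrepList (tetraGroup Q) 4) (N : Fin 4 → ℕ → ℕ)
    (I : ∀ p, (Σ l, Fin (N p l)) → Fin (A.d p) → L2S), A.IsTetrahedralNumbering ∧
      IsRealOrthonormalBasisSystem A I ∧
      (∀ p l n j, IsSphericalHarmonic l (I p ⟨l, n⟩ j)) ∧
      closedSpanAt I 0 = isotypic (A.Γ 0) ∧ closedSpanAt I 3 = isotypic (A.Γ 3) := by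
  obtain ⟨N, I, h₁, h₂, h₃⟩ := exists_real_system (tetraIrreps Q)
  refine ⟨_, N, I, isTetrahedralNumbering_tetraIrreps Q, h₁, h₂, h₃ 0 fun g i j => ?_,
    h₃ 3 fun g i j => ?_⟩
  · have h : (tetraIrreps Q).Γ 0 g i j = 1 := charRep_apply_apply 1 g i j
    rw [h, Complex.one_im]
  · exact Complex.ofReal_im _

end TetrahedralList

/-! ### A quadratic spherical function with a nontrivial tetrahedral character. -/

section Quadratic

variable {Q : E3 ≃ₗᵢ[ℝ] E3}

open MvPolynomial

/-- Moving `g` past `Q` conjugates it to its matrix in the frame of the tetrahedron, so polynomials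
can be written in the standard position. -/
lemma translate_translate_polyL2 {G : Subgroup (E3 ≃ₗᵢ[ℝ] E3)} (g : G)
    (P : MvPolynomial (Fin 3) ℂ) : translate (g : E3 ≃ₗᵢ[ℝ] E3) (translate Q (polyL2 P)) =
      translate Q (polyL2 (substMatrix (frameRep Q G g⁻¹) P)) := by
  have h : (g : E3 ≃ₗᵢ[ℝ] E3) * Q = Q * (Q⁻¹ * g * Q) := by group
  have h' : (Q⁻¹ * (g : E3 ≃ₗᵢ[ℝ] E3) * Q)⁻¹ = Q⁻¹ * (g⁻¹ : G) * Q := by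
    rw [Subgroup.coe_inv]
    group
  rw [← translate_mul, h, translate_mul, translate_polyL2, frameRep_apply, h']

/-- A quadratic polynomial which transforms under the tetrahedral group with a nontrivial
character. -/
noncomputable def tetraQuadratic : MvPolynomial (Fin 3) ℂ := ∑ i, C (cubeRoot (-i)) * X i ^ 2

lemma substMatrix_X_sq (g : tetraGroup Q) (i : Fin 3) :
    substMatrix (frameRep Q _ g) (X i ^ 2) = X (i - shift g) ^ 2 := by
  rw [map_pow, substMatrix, aeval_X, Finset.sum_eq_single (i - shift g), mul_pow, ← C_pow,
    ← Complex.ofReal_pow, sq (frameRep _ _ _ _ _), frameRep_mul_self, if_pos (by abel),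
    Complex.ofReal_one, C_1, one_mul]
  · intro b _ hb
    rw [frameRep_eq_zero g fun h => hb (by rw [h]; abel), Complex.ofReal_zero, C_0, zero_mul]
  · simp

lemma substMatrix_tetraQuadratic (g : tetraGroup Q) :
    substMatrix (frameRep Q _ g⁻¹) tetraQuadratic = C (cubeRoot (shift g)) * tetraQuadratic := by
  have hinv : shift g⁻¹ = -shift g := by
    rw [eq_neg_iff_add_eq_zero, ← shift_mul, inv_mul_cancel, shift_one]
  have hC : ∀ c : ℂ, substMatrix (frameRep Q _ g⁻¹) (C c) = C c := fun c => by
    rw [substMatrix, aeval_C, algebraMap_eq]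
  -- The action shifts the indices of the squared variables; undoing the shift in the coefficients
  -- `cubeRoot (-i)` produces the factor `cubeRoot (shift g)`.
  rw [tetraQuadratic, map_sum, Finset.mul_sum, ← Equiv.sum_comp (Equiv.subRight (shift g))]
  refine Finset.sum_congr rfl fun i _ => ?_
  rw [map_mul, hC, substMatrix_X_sq, hinv, ← mul_assoc, ← C_mul, ← cubeRoot_add]
  simp only [Equiv.subRight_apply]
  congr 3
  · abel
  · abel

lemma tetraQuadratic_ne_zero : tetraQuadratic ≠ 0 := by
  intro h
  have h1 := congrArg (eval (Pi.single 0 1)) h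
  simp [tetraQuadratic, Fin.sum_univ_three, cubeRoot_zero] at h1

lemma polyL2_tetraQuadratic_ne_zero : polyL2 tetraQuadratic ≠ 0 := by
  intro h
  refine tetraQuadratic_ne_zero (eq_zero_of_polyC_eq_zero (l := 2) ?_ ((polyL2_eq_zero_iff _).1 h))
  refine IsHomogeneous.sum _ _ _ fun i _ => ?_
  simpa using (isHomogeneous_C (Fin 3) (cubeRoot (-i))).mul (isHomogeneous_X_pow i 2)

lemma isBasisFunction_tetraQuadratic : IsBasisFunction (charRep (tetraCharacter Q))
    fun _ => translate Q (polyL2 tetraQuadratic) := by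
  rw [isBasisFunction_iff]
  intro g j
  rw [Fin.sum_univ_one, charRep_apply_apply, translate_translate_polyL2,
    substMatrix_tetraQuadratic, ← smul_eq_C_mul, map_smul, map_smul]
  rfl

end Quadratic

/-! ### Limits on real systems for the tetrahedral group. -/

section TetrahedralSystems

variable {Q : E3 ≃ₗᵢ[ℝ] E3} {A : IrrepList (tetraGroup Q) 4} {ζ : Fin 4 → Type*}
  {I : ∀ p, ζ p → Fin (A.d p) → L2S}

/-- A real basis function of a one-dimensional representation belongs to the trivial one. -/
lemma isEmpty_of_isRealOrthonormalBasisSystem (hA : A.IsTetrahedralNumbering)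
    (hI : IsRealOrthonormalBasisSystem A I) {p : Fin 4} (hp : p ≠ 0) (hd : A.d p = 1) :
    IsEmpty (ζ p) := by
  refine ⟨fun z => hp ?_⟩
  have hne : ∀ j, I p z j ≠ 0 := fun j => hI.orthonormal.ne_zero ⟨p, z, j⟩
  have hneg : (-1 : Matrix (Fin (A.d p)) (Fin (A.d p)) ℂ) ≠ 1 := by
    intro h
    have h1 := congrFun (congrFun h ⟨0, by omega⟩) ⟨0, by omega⟩
    rw [Matrix.neg_apply, Matrix.one_apply_eq] at h1
    norm_num at h1
  -- Reality forces signs, and signs are trivial here; inequivalence then leaves only `p = 0`.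
  have h1 : ∀ g, A.Γ p g = 1 := eq_one_of_sign_tetrahedral hneg (A.Γ p)
    (eq_one_or_eq_neg_one_of_isRealValued hd (hI.transforms p z) (hI.real p z) hne)
  have h0 : A.d 0 = 1 := congrFun hA.1 0
  exact A.inequivalent p 0 (nonempty_equiv_of_eq_one (hd.trans h0.symm) h1 hA.2)

/-- The quadratic function transforms by a nontrivial character, which is equivalent neither to the
trivial nor to the three-dimensional representation. It is therefore a nonzero vector orthogonal to
the whole system. Which of `A.Γ 1`, `A.Γ 2` is equivalent to this character does not matter. -/
lemma closedSpan_ne_top_tetrahedral (hA : A.IsTetrahedralNumbering)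
    (hI : IsRealOrthonormalBasisSystem A I) (h₁ : IsEmpty (ζ 1)) (h₂ : IsEmpty (ζ 2)) :
    closedSpan I ≠ ⊤ := by
  intro htop
  set f : L2S := translate Q (polyL2 tetraQuadratic) with hf
  have hf0 : f ≠ 0 := fun h =>
    polyL2_tetraQuadratic_ne_zero ((translate Q).injective (h.trans (map_zero _).symm))
  have hd0 : A.d 0 = 1 := congrFun hA.1 0
  have hd3 : A.d 3 = 3 := congrFun hA.1 3
  have hne : ∀ p, ζ p →
      ¬ Nonempty ((matRep (charRep (tetraCharacter Q))).Equiv (matRep (A.Γ p))) := by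
    intro p z h
    fin_cases p
    · obtain ⟨e⟩ := h
      obtain ⟨e'⟩ := nonempty_equiv_charRep_one hd0 (A.Γ 0) hA.2
      exact tetraCharacter_ne_one (eq_of_nonempty_equiv_charRep ⟨e.trans e'⟩)
    · exact h₁.elim z
    · exact h₂.elim z
    · have h3 := (dim_eq_of_nonempty_equiv h).trans hd3
      omega
  have horth : closedSpan I ≤ (ℂ ∙ f)ᗮ := by
    refine Submodule.topologicalClosure_minimal _ ?_ (Submodule.isClosed_orthogonal _)
    rw [Submodule.span_le]
    rintro _ ⟨p, z, j, rfl⟩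
    rw [SetLike.mem_coe, Submodule.mem_orthogonal_singleton_iff_inner_left]
    exact inner_eq_zero_of_inequivalent (A.unitary p) (A.irreducible p) (isIrreducible_charRep _)
      (hne p z) (hI.transforms p z) isBasisFunction_tetraQuadratic j 0
  rw [htop] at horth
  have h := Submodule.mem_orthogonal_singleton_iff_inner_left.1 (horth (Submodule.mem_top (x := f)))
  exact hf0 (inner_self_eq_zero.1 h)

lemma closedSpan_le_tetrahedral (hI : IsRealOrthonormalBasisSystem A I) (h₁ : IsEmpty (ζ 1))
    (h₂ : IsEmpty (ζ 2)) :
    closedSpan I ≤ (isotypic (A.Γ 0) ⊔ isotypic (A.Γ 3)).topologicalClosure := by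
  refine Submodule.topologicalClosure_minimal _ ?_ (Submodule.isClosed_topologicalClosure _)
  rw [Submodule.span_le]
  rintro _ ⟨p, z, j, rfl⟩
  have hmem : I p z j ∈ isotypic (A.Γ p) :=
    Submodule.le_topologicalClosure _ (Submodule.subset_span ⟨I p z, hI.transforms p z, j, rfl⟩)
  apply Submodule.le_topologicalClosure
  fin_cases p
  · exact Submodule.mem_sup_left hmem
  · exact h₁.elim z
  · exact h₂.elim z
  · exact Submodule.mem_sup_right hmem

end TetrahedralSystems

end Polyhedral

theorem corollary1 :
    -- octahedral and icosahedral groups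
    (∀ G : Subgroup (Polyhedral.E3 ≃ₗᵢ[ℝ] Polyhedral.E3),
      (Polyhedral.IsOctahedral G ∨ Polyhedral.IsIcosahedral G) →
      ∃ (r : ℕ) (A : Polyhedral.IrrepList G r) (N : Fin r → ℕ → ℕ)
        (I : ∀ p, (Σ l, Fin (N p l)) → Fin (A.d p) → Polyhedral.L2S),
        Polyhedral.IsRealOrthonormalBasisSystem A I ∧
        (∀ p l n j, Polyhedral.IsSphericalHarmonic l (I p ⟨l, n⟩ j)) ∧
        Polyhedral.closedSpan I = ⊤) ∧
    -- tetrahedral group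
    (∀ G : Subgroup (Polyhedral.E3 ≃ₗᵢ[ℝ] Polyhedral.E3), Polyhedral.IsTetrahedral G →
      (∃ (A : Polyhedral.IrrepList G 4) (N : Fin 4 → ℕ → ℕ)
        (I : ∀ p, (Σ l, Fin (N p l)) → Fin (A.d p) → Polyhedral.L2S),
        A.IsTetrahedralNumbering ∧
        Polyhedral.IsRealOrthonormalBasisSystem A I ∧
        (∀ p l n j, Polyhedral.IsSphericalHarmonic l (I p ⟨l, n⟩ j)) ∧
        Polyhedral.closedSpanAt I 0 = Polyhedral.isotypic (A.Γ 0) ∧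
        Polyhedral.closedSpanAt I 3 = Polyhedral.isotypic (A.Γ 3)) ∧
      (∀ A : Polyhedral.IrrepList G 4, A.IsTetrahedralNumbering →
        ∀ (ζ : Fin 4 → Type) (I : ∀ p, ζ p → Fin (A.d p) → Polyhedral.L2S),
          Polyhedral.IsRealOrthonormalBasisSystem A I →
          IsEmpty (ζ 1) ∧ IsEmpty (ζ 2) ∧
          Polyhedral.closedSpan I ≤
            (Polyhedral.isotypic (A.Γ 0) ⊔ Polyhedral.isotypic (A.Γ 3)).topologicalClosure ∧
          Polyhedral.closedSpan I ≠ ⊤)) := by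
  refine ⟨fun G hG => Polyhedral.exists_complete_real_system_of_isOctahedral_or_isIcosahedral hG,
    fun G hG => ?_⟩
  obtain ⟨Q, rfl⟩ := hG
  rw [Polyhedral.tetrahedronVertices_eq]
  refine ⟨Polyhedral.exists_real_system_tetrahedral Q, fun A hA ζ I hI => ?_⟩
  have h₁ := Polyhedral.isEmpty_of_isRealOrthonormalBasisSystem hA hI (p := 1) (by decide)
    (congrFun hA.1 1)
  have h₂ := Polyhedral.isEmpty_of_isRealOrthonormalBasisSystem hA hI (p := 2) (by decide)
    (congrFun hA.1 2)
  exact ⟨h₁, h₂, Polyhedral.closedSpan_le_tetrahedral hI h₁ h₂,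
    Polyhedral.closedSpan_ne_top_tetrahedral hA hI h₁ h₂⟩
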